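/- Let $V$ be a real vector space of finite dimension $n$ with a lattice $\Gamma\subset V$ of rank $n$, and let $\Gamma^*=\{\alpha\in V^*:\langle\alpha,\Gamma\rangle\subset\mathbb Z\}$ be the dual lattice. Let $\Phi=[\beta_1,\dots,\beta_N]$ be a sequence of (not necessarily distinct) elements of $\Gamma^*$ that spans $V^*$ and lies in an open half-space: there is $v\in V$ with $\langle\beta_i,v\rangle>0$ for all $i$. For $\lambda\in\Gamma^*$ let $\iota_\Phi(\lambda)$ be the number of $x\in\mathbb Z_{\ge0}^N$ with $\sum_i x_i\beta_i=\lambda$. Write $C(w)$ for the closed convex cone generated by a family $w$, and $\mathrm{Box}(\Phi)=\sum_{i=1}^N[0,1]\beta_i$. A vector of $V^*$ is singular if it lies in a cone generated by fewer than $n$ elements of $\Phi$; a big chamber $\mathfrak c$ is a connected component of the set of nonsingular vectors. A basis $\sigma$ from $\Phi$ is a linearly independent $n$-tuple of members of $\Phi$. Put $G(\sigma,\Gamma)=\{p\in V_{\mathbb C}: e^{\langle\beta,p\rangle}=1\ \text{for all}\ \beta\in\sigma\}$, let $G(\Phi,\mathfrak c,\Gamma)$ be the union of the $G(\sigma,\Gamma)$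 over the bases $\sigma$ from $\Phi$ with $\mathfrak c\subset C(\sigma)$, and let $RG(\Phi,\mathfrak c,\Gamma)$ be any set that contains exactly one element of each class of $G(\Phi,\mathfrak c,\Gamma)$ modulo $2\pi i\Gamma$. Let $R_{\mathcal A}$ be the ring of rational functions on $V_{\mathbb C}$ with poles along the hyperplanes $\beta_i=0$, and $S_{\mathcal A}\subset R_{\mathcal A}$ the span of the fractions $f_\sigma=1/\prod_{\alpha\in\sigma}\alpha$, $\sigma$ a basis from $\Phi$. The total residue $\mathrm{Tres}:R_{\mathcal A}\to S_{\mathcal A}$ is the projection along $R_{\mathcal A}=\big(\sum_{v\in V_{\mathbb C}}\partial_vR_{\mathcal A}\big)\oplus S_{\mathcal A}$; for a formal quotient $P/\prod_k\beta_{i_k}$ with $P$ a power series at $0$, $\mathrm{Tres}$ is applied to the homogeneous component of degree $-n$. The Jeffrey--Kirwan residue $J\langle\mathfrak c,\cdot\rangle$ is the linear functional on $S_{\mathcal A}$ with $J\langle\mathfrak c,f_\sigma\rangle=\mathrm{vol}_{\Gamma^*}(\sigma)^{-1}$ if $\mathfrak c\subset C(\sigma)$ and $0$ if $\mathfrak c\cap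 C(\sigma)=\emptyset$, where $\mathrm{vol}_{\Gamma^*}(\sigma)$ is the volume of $\sum_{\alpha\in\sigma}[0,1]\alpha$, normalized so that a fundamental parallelepiped of $\Gamma^*$ has volume $1$. **Theorem.** Let $\mathfrak c$ be a big chamber. The set $RG(\Phi,\mathfrak c,\Gamma)$ is finite, the function $$\iota[\mathfrak c,\Phi](\lambda)=\sum_{p\in RG(\Phi,\mathfrak c,\Gamma)}e^{-\langle\lambda,p\rangle}\,J\Big\langle\mathfrak c,\ \mathrm{Tres}\Big(\frac{e^{\langle\lambda,z\rangle}}{\prod_{i=1}^N\big(1-e^{\langle\beta_i,p\rangle}e^{-\langle\beta_i,z\rangle}\big)}\Big)\Big\rangle$$ is periodic-polynomial on $\Gamma^*$ (that is, in the algebra of functions generated by the additive characters $\Gamma^*\to\mathbb C$ and the multiplicative characters with values in the roots of unity), and $$\iota_\Phi(\lambda)=\iota[\mathfrak c,\Phi](\lambda)\qquad\text{for all }\lambda\in(\mathfrak c-\mathrm{Box}(\Phi))\cap\Gamma^*.$$ Moreover, if $\mathfrak c\subset C(\Phi)$, then $\overline{\mathfrak c}\subset\mathfrak c-\mathrm{Box}(\Phi)$,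 and this inclusion is strict if $n\ge1$. -/

import Mathlib

open scoped TensorProduct Pointwise

noncomputable section

namespace VectorPartition

/-! ### Lattices, cones, chambers -/

section Cones

variable {V : Type*} [NormedAddCommGroup V] [NormedSpace ℝ V]

/-- The dual lattice `Γ* ⊂ V*`: the linear forms which are integral on `Γ`. -/
def dualLattice (Γ : Submodule ℤ V) : Submodule ℤ (StrongDual ℝ V) where
  carrier := {α | ∀ γ ∈ Γ, ∃ m : ℤ, α γ = m}
  add_mem' := by
    intro α α' h h' γ hγ
    obtain ⟨m, hm⟩ := h γ hγ
    obtain ⟨m', hm'⟩ := h' γ hγ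
    exact ⟨m + m', by simp [hm, hm']⟩
  zero_mem' := fun γ _ => ⟨0, by simp⟩
  smul_mem' := by
    intro k α h γ hγ
    obtain ⟨m, hm⟩ := h γ hγ
    exact ⟨k * m, by simp [hm]⟩

/-- The closed convex cone generated by a finite family `w`. -/
def cone {ι : Type*} [Fintype ι] (w : ι → StrongDual ℝ V) : Set (StrongDual ℝ V) :=
  {a | ∃ x : ι → ℝ, (∀ i, 0 ≤ x i) ∧ a = ∑ i, x i • w i}

/-- The zonotope `Box(Φ) = ∑ [0,1] β_i`. -/
def box {N : ℕ} (β : Fin N → StrongDual ℝ V) : Set (StrongDual ℝ V) :=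
  {a | ∃ t : Fin N → ℝ, (∀ i, 0 ≤ t i ∧ t i ≤ 1) ∧ a = ∑ i, t i • β i}

/-- The singular vectors: those in a cone generated by fewer than `n = dim V` elements of `Φ`. -/
def singularSet {N : ℕ} (β : Fin N → StrongDual ℝ V) : Set (StrongDual ℝ V) :=
  {a | ∃ k : ℕ, k < Module.finrank ℝ V ∧ ∃ ν : Fin k → Fin N, a ∈ cone (β ∘ ν)}

/-- A big chamber is a connected component of the set of regular (nonsingular) vectors of `V*`. -/
def IsBigChamber {N : ℕ} (β : Fin N → StrongDual ℝ V) (c : Set (StrongDual ℝ V)) : Prop :=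
  ∃ a ∈ (singularSet β)ᶜ, c = connectedComponentIn (singularSet β)ᶜ a

/-- `σ` picks a basis of `V*` out of `Φ`: `n = dim V` linearly independent members of the
sequence. -/
def IsBasisOf {N : ℕ} (β : Fin N → StrongDual ℝ V)
    (σ : Fin (Module.finrank ℝ V) → Fin N) : Prop :=
  LinearIndependent ℝ (β ∘ σ)

/-- The vector partition function `ι_Φ(a)`: the number of `x ∈ ℕ^N` with `∑ x_i β_i = a`. -/
def partitionFunction {N : ℕ} (β : Fin N → StrongDual ℝ V) (a : StrongDual ℝ V) : ℕ :=
  Set.ncard {x : Fin N → ℕ | ∑ i, x i • β i = a}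

/-- `vol_{Γ*}(w)`: the volume of the parallelepiped `∑ [0,1] w_i` in `V*`, for the volume form on
`V*` normalized by the lattice `Γ*`. It is the absolute value of the determinant of the
coordinates `⟨w_i, γ_j⟩` of the `w_i` in the basis of `Γ*` dual to a `ℤ`-basis `γ_j` of `Γ`; the
choice of that basis does not matter. -/
def latticeVol [FiniteDimensional ℝ V] (Γ : Submodule ℤ V) [DiscreteTopology Γ] [IsZLattice ℝ Γ]
    (w : Fin (Module.finrank ℝ V) → StrongDual ℝ V) : ℝ :=
  haveI : Module.Free ℤ Γ := ZLattice.module_free ℝ Γ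
  haveI : Module.Finite ℤ Γ := ZLattice.module_finite ℝ Γ
  |Matrix.det (Matrix.of fun i j =>
    w i ((Module.finBasisOfFinrankEq ℤ Γ (ZLattice.rank ℝ Γ) j : Γ) : V))|

/-! ### The complexification -/

/-- The pairing `⟨α, ·⟩`: the complex linear extension of `α ∈ V*` to `V_ℂ = ℂ ⊗ V`. -/
def pair (α : StrongDual ℝ V) : ℂ ⊗[ℝ] V →ₗ[ℂ] ℂ :=
  (TensorProduct.AlgebraTensorModule.rid ℝ ℂ ℂ).toLinearMap ∘ₗ
    (α : V →ₗ[ℝ] ℝ).baseChange ℂ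

/-- The lattice `2πi Γ ⊂ V_ℂ`. -/
def periodLattice (Γ : Submodule ℤ V) : Set (ℂ ⊗[ℝ] V) :=
  {z | ∃ γ ∈ Γ, z = (2 * Real.pi * Complex.I : ℂ) ⊗ₜ[ℝ] γ}

/-- `G(Φ, c, Γ)`: the union, over the bases `σ` from `Φ` with `c ⊆ C(σ)`, of the groups
`G(σ, Γ) = {p ∈ V_ℂ | e^{⟨β, p⟩} = 1 for all β ∈ σ}`. -/
def poleSet {N : ℕ} (β : Fin N → StrongDual ℝ V) (c : Set (StrongDual ℝ V)) :
    Set (ℂ ⊗[ℝ] V) :=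
  {p | ∃ σ : Fin (Module.finrank ℝ V) → Fin N, IsBasisOf β σ ∧ c ⊆ cone (β ∘ σ) ∧
    ∀ k, Complex.exp (pair (β (σ k)) p) = 1}

/-- `R` is a reduced set `RG(Φ, c, Γ)`: it consists of exactly one element of each class of
`G(Φ, c, Γ)` modulo `2πi Γ`. -/
def IsReducedPoleSet (Γ : Submodule ℤ V) {N : ℕ} (β : Fin N → StrongDual ℝ V)
    (c : Set (StrongDual ℝ V)) (R : Set (ℂ ⊗[ℝ] V)) : Prop :=
  R ⊆ poleSet β c ∧ ∀ q ∈ poleSet β c, ∃! p, p ∈ R ∧ q - p ∈ periodLattice Γ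

/-! ### Rational functions with poles on the arrangement, and the total residue -/

/-- The complement in `V_ℂ` of the hyperplanes `β_i = 0`. A rational function with poles along
these hyperplanes is identified with its restriction to this dense open set. -/
def regularPoints {N : ℕ} (β : Fin N → StrongDual ℝ V) : Set (ℂ ⊗[ℝ] V) :=
  {z | ∀ i, pair (β i) z ≠ 0}

/-- The ring `R_A` of rational functions on `V_ℂ` with poles along the hyperplanes `β_i = 0`. -/
def ratRing {N : ℕ} (β : Fin N → StrongDual ℝ V) : Subalgebra ℂ (regularPoints β → ℂ) :=
  Algebra.adjoin ℂ
    ({f | ∃ ℓ : ℂ ⊗[ℝ] V →ₗ[ℂ] ℂ, f = fun z : regularPoints β => ℓ z} ∪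
      {f | ∃ i, f = fun z : regularPoints β => (pair (β i) z)⁻¹})

/-- The space `∑_v ∂_v R_A` spanned by the directional derivatives of elements of `R_A`. -/
def derivSpace {N : ℕ} (β : Fin N → StrongDual ℝ V) : Submodule ℂ (regularPoints β → ℂ) :=
  Submodule.span ℂ {g | ∃ (v : ℂ ⊗[ℝ] V) (f : ℂ ⊗[ℝ] V → ℂ),
    (fun z : regularPoints β => f z) ∈ ratRing β ∧
      ∀ z : regularPoints β, HasLineDerivAt ℂ f (g z) (z : ℂ ⊗[ℝ] V) v}

/-- The fraction `f_σ = 1 / ∏_{α ∈ σ} α`. -/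
def simpleFraction {N : ℕ} (β : Fin N → StrongDual ℝ V)
    (σ : Fin (Module.finrank ℝ V) → Fin N) : regularPoints β → ℂ :=
  fun z => (∏ k, pair (β (σ k)) (z : ℂ ⊗[ℝ] V))⁻¹

/-- The space `S_A` of simple elements, spanned by the `f_σ`, `σ` a basis from `Φ`. -/
def simpleSpace {N : ℕ} (β : Fin N → StrongDual ℝ V) : Submodule ℂ (regularPoints β → ℂ) :=
  Submodule.span ℂ {f | ∃ σ, IsBasisOf β σ ∧ f = simpleFraction β σ}

theorem simpleFraction_mem {N : ℕ} {β : Fin N → StrongDual ℝ V}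
    {σ : Fin (Module.finrank ℝ V) → Fin N} (hσ : IsBasisOf β σ) :
    simpleFraction β σ ∈ simpleSpace β :=
  Submodule.subset_span ⟨σ, hσ, rfl⟩

open Classical in
/-- The total residue `Tres : R_A → S_A`, the projection along the decomposition
`R_A = (∑_v ∂_v R_A) ⊕ S_A`: the element `s` of `S_A` with `f - s ∈ ∑_v ∂_v R_A`, which
exists and is unique for every `f ∈ R_A`. -/
def totalResidue {N : ℕ} (β : Fin N → StrongDual ℝ V) (f : regularPoints β → ℂ) :
    simpleSpace β :=
  if h : ∃ s : simpleSpace β, f - (s : regularPoints β → ℂ) ∈ derivSpace β then h.choose else 0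

/-- The total residue of a formal meromorphic function `G = P / ∏ β_{i_k}` near `0`, with `P` a
formal power series: the total residue of its homogeneous component of degree `-n`.
Here `G` is recorded by its expansions `t ↦ G(t z)`, Laurent series in `t`, at the points `z` off
the hyperplanes; the coefficient of `t ^ m` is the value at `z` of the homogeneous component of
`G` of degree `m`. -/
def totalResidueFormal {N : ℕ} (β : Fin N → StrongDual ℝ V)
    (G : regularPoints β → LaurentSeries ℂ) : simpleSpace β :=
  totalResidue β fun z => (G z).coeff (-(Module.finrank ℝ V : ℤ))

/-- The series `e^{a t}` in the variable `t`. -/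
def expSeries (a : ℂ) : LaurentSeries ℂ :=
  HahnSeries.ofPowerSeries ℤ ℂ (PowerSeries.rescale a (PowerSeries.exp ℂ))

/-- The formal meromorphic function
`z ↦ e^{⟨a, z⟩} / ∏_i (1 - e^{⟨β_i, p⟩} e^{-⟨β_i, z⟩})`, recorded by its expansions along the
lines through `0`. -/
def kernelFun {N : ℕ} (β : Fin N → StrongDual ℝ V) (a : StrongDual ℝ V) (p : ℂ ⊗[ℝ] V) :
    regularPoints β → LaurentSeries ℂ :=
  fun z => expSeries (pair a (z : ℂ ⊗[ℝ] V)) /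
    ∏ i, (1 - HahnSeries.C (Complex.exp (pair (β i) p)) *
      expSeries (-(pair (β i) (z : ℂ ⊗[ℝ] V))))

/-! ### The Jeffrey-Kirwan residue and the periodic-polynomial function -/

variable [FiniteDimensional ℝ V]

open Classical in
/-- The Jeffrey-Kirwan residue `J⟨c, ·⟩_{vol_{Γ*}}`: the linear functional on `S_A` taking the
value `1 / vol_{Γ*}(σ)` at `f_σ` if `c ⊆ C(σ)` and the value `0` if `c ∩ C(σ) = ∅`. For a big
chamber `c` there is exactly one such functional. -/
def jkResidue (Γ : Submodule ℤ V) [DiscreteTopology Γ] [IsZLattice ℝ Γ] {N : ℕ}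
    (β : Fin N → StrongDual ℝ V) (c : Set (StrongDual ℝ V)) : simpleSpace β →ₗ[ℂ] ℂ :=
  if h : ∃ J : simpleSpace β →ₗ[ℂ] ℂ, ∀ (σ : _) (hσ : IsBasisOf β σ),
      (c ⊆ cone (β ∘ σ) →
        J ⟨simpleFraction β σ, simpleFraction_mem hσ⟩ = ((latticeVol Γ (β ∘ σ) : ℝ) : ℂ)⁻¹) ∧
      (c ∩ cone (β ∘ σ) = ∅ → J ⟨simpleFraction β σ, simpleFraction_mem hσ⟩ = 0)
  then h.choose else 0

/-- The function `ι[c, Φ]` on `Γ*`, computed with the reduced set `R` of poles. -/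
def chamberFunction (Γ : Submodule ℤ V) [DiscreteTopology Γ] [IsZLattice ℝ Γ] {N : ℕ}
    (β : Fin N → StrongDual ℝ V) (c : Set (StrongDual ℝ V)) (R : Set (ℂ ⊗[ℝ] V))
    (a : dualLattice Γ) : ℂ :=
  ∑ᶠ p ∈ R, Complex.exp (-(pair (a : StrongDual ℝ V) p)) *
    jkResidue Γ β c (totalResidueFormal β (kernelFun β (a : StrongDual ℝ V) p))

end Cones

/-- Periodic-polynomial (quasipolynomial) functions on a lattice `W`: those in the `ℂ`-algebra of
functions generated by the additive characters `W → ℂ` and by the multiplicative characters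
`W → ℂˣ` with values in the roots of unity. -/
def IsPeriodicPolynomial {W : Type*} [AddCommGroup W] (f : W → ℂ) : Prop :=
  f ∈ Algebra.adjoin ℂ
    ({g : W → ℂ | ∃ φ : W →+ ℂ, g = fun w => φ w} ∪
      {g : W → ℂ | ∃ χ : Multiplicative W →* ℂˣ,
        (∀ w, ∃ k : ℕ, 0 < k ∧ χ w ^ k = 1) ∧ g = fun w => (χ (Multiplicative.ofAdd w) : ℂ)})

end VectorPartition

end

/-!
The proof has an analytic half, which turns the Jeffrey-Kirwan residue of the total residue into one
explicit linear functional, and an arithmetic half, which matches that functional with the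
partition function by deforming the family `Φ` to multiples of a basis.

**The residue functional.** By partial fractions, every element of `R_A` is a combination of
Laurent monomials `β_σ ^ k`, where `σ` is a basis from `Φ` and `k` an integer vector, and no new
poles are introduced (`polarRing_le_monoSpan`). There is a linear functional `ℓ` with
`ℓ (β_σ ^ k) = vol(σ)⁻¹` if `k = (-1, …, -1)` and `c ⊆ C(σ)`, and `ℓ (β_σ ^ k) = 0` otherwise
(`exists_residueFunctional`). Only its consistency with the relations between the monomials needs
an argument. The monomials with negative exponents are the Laplace transforms of products of the
functions `t ^ r / r!` on the simplicial cones `C(σ)`; by Fourier inversion a relation between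
monomials is a relation between these piecewise polynomial functions at generic points, and `ℓ` is
their value at `t x`, `x ∈ c`, `t → 0`. Monomials with a nonnegative exponent are reduced to this
case by differentiating. A monomial with some `k_l ≠ -1` is a directional derivative of another
monomial, so `ℓ` kills derivatives and `J⟨c, Tres f⟩ = ℓ f` (`jkResidue_totalResidue`).

**The residue formula.** For a family `γ` of positive multiples of members of `Φ`, the statement
`ResidueFormula c ℓ γ` says that the number of `x ∈ ℕ ^ N` with `∑ x_k γ_k = a` is the sum, over the
characters `ψ` of `Γ*` of order dividing a sufficiently divisible `M`, of `ℓ` applied to the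
degree `-n` part of `e^{⟨a, z⟩} ψ(a)⁻¹ / ∏ (1 - ψ(γ_k) e^{-⟨γ_k, z⟩})`, as soon as
`a + ∑ t_k γ_k ∈ c` for some `t ∈ [0, 1] ^ N`. A relation `1 / ∏ (1 - e^{γ_k}) =
∑_j c_j e^{δ_j} / ∏ (1 - e^{γ'_{j,k}})` holds both for the counts, as an identity of generating
functions supported in a half-space, and for the kernels. Two such relations are used: replacing
`γ_k` with a multiple, and, given a relation `γ_{k₀} + ∑_{k ∈ s} ± γ_k = 0`, exchanging one of the
`γ_j`, `j ∈ s`, for `γ_{k₀}`, by a telescoping sum. The telescoping may be carried out in any order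
of `s`; ordering `s` by the coordinates `t_k` (or `1 - t_k`, according to the sign) is exactly what
keeps all shifted arguments `a - δ_j` in the translate of `c` by the box
(`ResidueFormula.of_exchange`). Exchanging always for the member of smallest index, one arrives at
families supported on a basis (`ResidueFormula.of_simplicial`). There both sides are products:
the count is a product of binomial coefficients on the sublattice spanned by the basis, which are
one-dimensional residues of `e^{b w} / (1 - e^{-w}) ^ m` for all `b > -m` (`expResidue_eq_ncard`),
and the restriction to the sublattice is the orthogonality of the characters of the quotient
(`residueFormula_simplicial`).

**Conclusion.** Each character is `a ↦ e^{⟨a, p⟩}` for a `p ∈ V_ℂ`, unique modulo `2πi Γ`. If `p`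
is not in `G(Φ, c, Γ)`, then the kernel at `p` has poles only on hyperplanes `β_i = 0` with
`e^{⟨β_i, p⟩} = 1`, among which there is no basis `σ` with `c ⊆ C(σ)`, and `ℓ` vanishes on it. The
remaining sum runs over the reduced set of poles. For the last assertion, a chamber inside
`C(Φ)` is the intersection of the interiors of the simplicial cones containing it; therefore
`closure c + c ⊆ c`, and `c` meets the box in points close to `0`.
-/

set_option linter.unusedSectionVars false

noncomputable section
namespace VectorPartition

/-! ### Finitely generated cones -/

section FiniteCones

variable {E ι : Type*} [AddCommGroup E] [Module ℝ E]

/-- The cone generated by the members of a family `w` indexed by the finite set `s`. -/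
def coneOn (w : ι → E) (s : Finset ι) : Set E :=
  {a | ∃ x : ι → ℝ, (∀ i, 0 ≤ x i) ∧ a = ∑ i ∈ s, x i • w i}

theorem coneOn_mono {w : ι → E} {s t : Finset ι} (h : s ⊆ t) : coneOn w s ⊆ coneOn w t := by
  classical
  rintro a ⟨x, hx, rfl⟩
  refine ⟨fun i => if i ∈ s then x i else 0, fun i => ?_, ?_⟩
  · dsimp only; split_ifs <;> simp [hx]
  · rw [← Finset.sum_subset h]
    · exact Finset.sum_congr rfl fun i hi => by simp [hi]
    · intro i _ hi; simp [hi]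

/-- Carathéodory's theorem for cones: a member of a finitely generated cone is a positive
combination of linearly independent generators. -/
theorem coneOn_caratheodory [DecidableEq ι] {w : ι → E} (s : Finset ι) {a : E}
    (ha : a ∈ coneOn w s) :
    ∃ t ⊆ s, LinearIndepOn ℝ w (t : Set ι) ∧
      ∃ x : ι → ℝ, (∀ i ∈ t, 0 < x i) ∧ a = ∑ i ∈ t, x i • w i := by
  induction s using Finset.strongInduction generalizing a with
  | H s ih =>
  obtain ⟨x, hx, rfl⟩ := ha
  by_cases hpos : ∀ i ∈ s, 0 < x i
  · by_cases hli : LinearIndepOn ℝ w (s : Set ι)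
    · exact ⟨s, subset_rfl, hli, x, hpos, rfl⟩
    · rw [linearIndepOn_finset_iff] at hli
      push Not at hli
      obtain ⟨g0, hg0, i1, hi1, hgi1⟩ := hli
      -- a relation with a positive coefficient
      obtain ⟨g, hg, i0, hi0, hgi0⟩ : ∃ g : ι → ℝ, ∑ i ∈ s, g i • w i = 0 ∧
          ∃ i ∈ s, 0 < g i := by
        rcases lt_or_gt_of_ne hgi1 with h | h
        · exact ⟨-g0, by simp [hg0], i1, hi1, by simpa using h⟩
        · exact ⟨g0, hg0, i1, hi1, h⟩
      obtain ⟨j, hj, hmin⟩ := Finset.exists_min_image (s.filter fun i => 0 < g i)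
        (fun i => x i / g i) ⟨i0, by simp [hi0, hgi0]⟩
      simp only [Finset.mem_filter] at hj hmin
      have hjp := hj.2
      obtain ⟨t, ht, h⟩ := ih (s.erase j) (Finset.erase_ssubset hj.1)
        (a := ∑ i ∈ s, x i • w i) (by
          refine ⟨fun i => if i ∈ s then x i - x j / g j * g i else 0, fun i => ?_, ?_⟩
          · dsimp only
            split_ifs with his
            · rcases lt_or_ge 0 (g i) with hgi | hgi
              · have := hmin i ⟨his, hgi⟩
                rw [le_div_iff₀ hgi] at this
                linarith
              · have : x j / g j * g i ≤ 0 :=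
                  mul_nonpos_of_nonneg_of_nonpos (div_nonneg (hx j) hjp.le) hgi
                linarith [hx i]
            · exact le_rfl
          · have h1 : ∑ i ∈ s, x i • w i =
                ∑ i ∈ s, (if i ∈ s then x i - x j / g j * g i else 0) • w i := by
              rw [← sub_zero (∑ i ∈ s, x i • w i), ← smul_zero (x j / g j), ← hg, Finset.smul_sum,
                ← Finset.sum_sub_distrib]
              refine Finset.sum_congr rfl fun i hi => ?_
              rw [if_pos hi, sub_smul, mul_smul]
            rw [h1, ← Finset.add_sum_erase s _ hj.1, if_pos hj.1, div_mul_cancel₀ _ hjp.ne',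
              sub_self, zero_smul, zero_add])
      exact ⟨t, ht.trans (Finset.erase_subset _ _), h⟩
  · push Not at hpos
    obtain ⟨j, hj, hxj⟩ := hpos
    obtain ⟨t, ht, h⟩ := ih (s.erase j) (Finset.erase_ssubset hj) (a := ∑ i ∈ s, x i • w i)
      ⟨x, hx, by
        rw [← Finset.add_sum_erase s _ hj, le_antisymm hxj (hx j), zero_smul, zero_add]⟩
    exact ⟨t, ht.trans (Finset.erase_subset _ _), h⟩

theorem smul_mem_coneOn {w : ι → E} {s : Finset ι} {a : E} (ha : a ∈ coneOn w s) {r : ℝ}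
    (hr : 0 ≤ r) : r • a ∈ coneOn w s := by
  obtain ⟨x, hx, rfl⟩ := ha
  exact ⟨fun i => r * x i, fun i => mul_nonneg hr (hx i), by
    rw [Finset.smul_sum]; simp only [mul_smul]⟩

end FiniteCones

theorem isClosed_coneOn {E ι : Type*} [NormedAddCommGroup E] [NormedSpace ℝ E]
    [FiniteDimensional ℝ E] [DecidableEq ι] (w : ι → E) (s : Finset ι) :
    IsClosed (coneOn w s) := by
  classical
  have key : coneOn w s = ⋃ t ∈ s.powerset.filter fun t : Finset ι => LinearIndepOn ℝ w (t : Set ι),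
      coneOn w t := by
    refine subset_antisymm (fun a ha => ?_) ?_
    · obtain ⟨t, ht, hli, x, hx, rfl⟩ := coneOn_caratheodory s ha
      simp only [Set.mem_iUnion, Finset.mem_filter, Finset.mem_powerset]
      refine ⟨t, ⟨ht, hli⟩, fun i => if i ∈ t then x i else 0, fun i => ?_,
        Finset.sum_congr rfl fun i hi => by simp [hi]⟩
      dsimp only
      split_ifs with h
      exacts [(hx i h).le, le_rfl]
    · simp only [Set.iUnion_subset_iff, Finset.mem_filter, Finset.mem_powerset]
      exact fun t ht => coneOn_mono ht.1
  rw [key]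
  refine Set.Finite.isClosed_biUnion (Finset.finite_toSet _) fun t ht => ?_
  simp only [Finset.coe_filter, Finset.mem_powerset, Set.mem_ofPred_eq] at ht
  have hli : LinearIndependent ℝ fun i : t => w i := ht.2
  have hemb := LinearMap.isClosedEmbedding_of_injective
    (f := Fintype.linearCombination ℝ fun i : t => w i)
    (LinearMap.ker_eq_bot.2 hli.fintypeLinearCombination_injective)
  have : coneOn w t = Fintype.linearCombination ℝ (fun i : t => w i) '' {x | ∀ i, 0 ≤ x i} := by
    ext a
    constructor
    · rintro ⟨x, hx, rfl⟩
      refine ⟨fun i => x i, fun i => hx i, ?_⟩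
      rw [Fintype.linearCombination_apply]
      exact Finset.sum_coe_sort t fun i => x i • w i
    · rintro ⟨x, hx, rfl⟩
      refine ⟨fun i => if h : i ∈ t then x ⟨i, h⟩ else 0, fun i => ?_, ?_⟩
      · dsimp only
        split_ifs with h
        exacts [hx _, le_rfl]
      · rw [Fintype.linearCombination_apply, ← Finset.sum_coe_sort t]
        exact Finset.sum_congr rfl fun i _ => by simp
  rw [this]
  refine hemb.isClosedMap _ ?_
  simp only [Set.ofPred_forall]
  exact isClosed_iInter fun i => isClosed_le continuous_const (continuous_apply i)

/-! ### Bases from the sequence and chambers -/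

section Chambers

variable {V : Type*} [NormedAddCommGroup V] [NormedSpace ℝ V] [FiniteDimensional ℝ V]
variable {N : ℕ} {β : Fin N → StrongDual ℝ V}

theorem finrank_strongDual (V : Type*) [NormedAddCommGroup V] [NormedSpace ℝ V]
    [FiniteDimensional ℝ V] : Module.finrank ℝ (StrongDual ℝ V) = Module.finrank ℝ V := by
  rw [← Subspace.dual_finrank_eq (K := ℝ) (V := V)]
  exact (LinearMap.toContinuousLinearMap (𝕜 := ℝ) (E := V) (F' := ℝ)).symm.finrank_eq

/-- A basis from the sequence, as a basis of `V*`. -/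
def IsBasisOf.basis {σ : Fin (Module.finrank ℝ V) → Fin N} (hσ : IsBasisOf β σ) :
    Module.Basis (Fin (Module.finrank ℝ V)) ℝ (StrongDual ℝ V) :=
  Module.Basis.mk (v := β ∘ σ) hσ (by
    rw [hσ.span_eq_top_of_card_eq_finrank' (by simp [finrank_strongDual])])

@[simp]
theorem IsBasisOf.basis_apply {σ : Fin (Module.finrank ℝ V) → Fin N} (hσ : IsBasisOf β σ)
    (l : Fin (Module.finrank ℝ V)) : hσ.basis l = β (σ l) := by
  exact Module.Basis.mk_apply (v := β ∘ σ) _ _ l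

theorem IsBasisOf.injective {σ : Fin (Module.finrank ℝ V) → Fin N} (hσ : IsBasisOf β σ) :
    Function.Injective σ :=
  Function.Injective.of_comp (LinearIndependent.injective hσ)

theorem IsBasisOf.mem_cone_iff {σ : Fin (Module.finrank ℝ V) → Fin N} (hσ : IsBasisOf β σ)
    {a : StrongDual ℝ V} : a ∈ cone (β ∘ σ) ↔ ∀ l, 0 ≤ hσ.basis.repr a l := by
  constructor
  · rintro ⟨x, hx, rfl⟩ l
    have : (∑ i, x i • (β ∘ σ) i) = ∑ i, x i • hσ.basis i := by simp
    rw [this, Module.Basis.repr_sum_self]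
    exact hx l
  · intro h
    refine ⟨fun l => hσ.basis.repr a l, h, ?_⟩
    conv_lhs => rw [← hσ.basis.sum_repr a]
    simp

theorem mem_singularSet_of_coneOn {s : Finset (Fin N)} (hs : s.card < Module.finrank ℝ V)
    {a : StrongDual ℝ V} (ha : a ∈ coneOn β s) : a ∈ singularSet β := by
  obtain ⟨x, hx, rfl⟩ := ha
  refine ⟨s.card, hs, fun j => s.equivFin.symm j, fun j => x (s.equivFin.symm j),
    fun j => hx _, ?_⟩
  rw [← Finset.sum_coe_sort s]
  exact (Equiv.sum_comp s.equivFin.symm fun i : s => x i • β i).symm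

theorem exists_coneOn_of_cone {k : ℕ} {ν : Fin k → Fin N} {a : StrongDual ℝ V}
    (ha : a ∈ cone (β ∘ ν)) : a ∈ coneOn β (Finset.univ.image ν) := by
  classical
  obtain ⟨x, hx, rfl⟩ := ha
  refine ⟨fun i => ∑ j with ν j = i, x j, fun i => Finset.sum_nonneg fun j _ => hx j, ?_⟩
  rw [← Finset.sum_fiberwise_of_maps_to (s := Finset.univ) (t := Finset.univ.image ν) (g := ν)
    (fun j _ => Finset.mem_image_of_mem _ (Finset.mem_univ j))]
  refine Finset.sum_congr rfl fun i _ => ?_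
  rw [Finset.sum_smul]
  refine Finset.sum_congr rfl fun j hj => ?_
  rw [← (Finset.mem_filter.1 hj).2]; rfl

theorem mem_singularSet_iff {a : StrongDual ℝ V} :
    a ∈ singularSet β ↔ ∃ s : Finset (Fin N), s.card < Module.finrank ℝ V ∧ a ∈ coneOn β s := by
  classical
  refine ⟨fun ⟨k, hk, ν, ha⟩ => ⟨Finset.univ.image ν, ?_, exists_coneOn_of_cone ha⟩,
    fun ⟨s, hs, ha⟩ => mem_singularSet_of_coneOn hs ha⟩
  exact (Finset.card_image_le.trans (by simp)).trans_lt hk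

theorem isClosed_singularSet (β : Fin N → StrongDual ℝ V) : IsClosed (singularSet β) := by
  have : singularSet β = ⋃ s ∈ {s : Finset (Fin N) | s.card < Module.finrank ℝ V},
      coneOn β s := by
    ext a
    rw [mem_singularSet_iff]
    simp
  rw [this]
  exact Set.Finite.isClosed_biUnion (Set.toFinite _) fun s _ => isClosed_coneOn β s

theorem IsBasisOf.continuous_repr {σ : Fin (Module.finrank ℝ V) → Fin N} (hσ : IsBasisOf β σ)
    (l : Fin (Module.finrank ℝ V)) : Continuous fun a => hσ.basis.repr a l :=
  (hσ.basis.coord l).continuous_of_finiteDimensional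

theorem IsBasisOf.repr_pos {σ : Fin (Module.finrank ℝ V) → Fin N} (hσ : IsBasisOf β σ)
    {a : StrongDual ℝ V} (ha : a ∉ singularSet β) (hc : a ∈ cone (β ∘ σ))
    (l : Fin (Module.finrank ℝ V)) : 0 < hσ.basis.repr a l := by
  classical
  rw [hσ.mem_cone_iff] at hc
  refine (hc l).lt_of_ne fun h0 => ha ?_
  refine mem_singularSet_of_coneOn (s := (Finset.univ.erase l).image σ) ?_ ?_
  · refine Finset.card_image_le.trans_lt ?_
    rw [Finset.card_erase_of_mem (Finset.mem_univ l), Finset.card_univ, Fintype.card_fin]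
    exact Nat.sub_lt l.pos one_pos
  · have : a ∈ cone (β ∘ σ) := by rwa [hσ.mem_cone_iff]
    refine ⟨fun i => ∑ j with σ j = i, hσ.basis.repr a j,
      fun i => Finset.sum_nonneg fun j _ => hc j, ?_⟩
    rw [Finset.sum_image fun x _ y _ h => hσ.injective h]
    conv_lhs => rw [← hσ.basis.sum_repr a, ← Finset.add_sum_erase _ _ (Finset.mem_univ l), ← h0,
      zero_smul, zero_add]
    refine Finset.sum_congr rfl fun j _ => ?_
    have : (Finset.univ.filter fun j' => σ j' = σ j) = {j} := by
      ext j'; simp [hσ.injective.eq_iff]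
    dsimp only
    rw [this, Finset.sum_singleton, hσ.basis_apply]

/-- On a cone spanned by a basis, the interior is where all coordinates are positive. -/
theorem IsBasisOf.isOpen_pos {σ : Fin (Module.finrank ℝ V) → Fin N} (hσ : IsBasisOf β σ) :
    IsOpen {a | ∀ l, 0 < hσ.basis.repr a l} := by
  simp only [Set.ofPred_forall]
  exact isOpen_iInter_of_finite fun l => isOpen_lt continuous_const (hσ.continuous_repr l)

theorem IsBasisOf.isClosed_cone {σ : Fin (Module.finrank ℝ V) → Fin N} (hσ : IsBasisOf β σ) :
    IsClosed (cone (β ∘ σ)) := by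
  have : cone (β ∘ σ) = {a | ∀ l, 0 ≤ hσ.basis.repr a l} := Set.ext fun a => hσ.mem_cone_iff
  rw [this]
  simp only [Set.ofPred_forall]
  exact isClosed_iInter fun l => isClosed_le continuous_const (hσ.continuous_repr l)

theorem IsBigChamber.subset_regular {c : Set (StrongDual ℝ V)} (hc : IsBigChamber β c) :
    c ⊆ (singularSet β)ᶜ := by
  obtain ⟨a, _, rfl⟩ := hc
  exact connectedComponentIn_subset _ _

theorem IsBigChamber.nonempty {c : Set (StrongDual ℝ V)} (hc : IsBigChamber β c) :
    c.Nonempty := by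
  obtain ⟨a, ha, rfl⟩ := hc
  exact ⟨a, mem_connectedComponentIn ha⟩

theorem IsBigChamber.isOpen {c : Set (StrongDual ℝ V)} (hc : IsBigChamber β c) : IsOpen c := by
  obtain ⟨a, _, rfl⟩ := hc
  exact (isClosed_singularSet β).isOpen_compl.connectedComponentIn

theorem IsBigChamber.subset_of_isPreconnected {c K : Set (StrongDual ℝ V)}
    (hc : IsBigChamber β c) (hK : IsPreconnected K) (hKr : K ⊆ (singularSet β)ᶜ)
    {x : StrongDual ℝ V} (hx : x ∈ c) (hxK : x ∈ K) : K ⊆ c := by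
  obtain ⟨a, ha, rfl⟩ := hc
  rw [connectedComponentIn_eq hx]
  exact hK.subset_connectedComponentIn hxK hKr

/-- A big chamber that meets the cone of a basis lies in its interior. -/
theorem IsBigChamber.repr_pos {c : Set (StrongDual ℝ V)} (hc : IsBigChamber β c)
    {σ : Fin (Module.finrank ℝ V) → Fin N} (hσ : IsBasisOf β σ) {x y : StrongDual ℝ V}
    (hx : x ∈ c) (hxσ : x ∈ cone (β ∘ σ)) (hy : y ∈ c) (l : Fin (Module.finrank ℝ V)) :
    0 < hσ.basis.repr y l := by
  have hpre : IsPreconnected c := by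
    obtain ⟨a, _, rfl⟩ := hc
    exact isPreconnected_connectedComponentIn
  have hsub := hc.subset_regular
  suffices h : c ⊆ {a | ∀ l, 0 < hσ.basis.repr a l} from h hy l
  refine hpre.subset_left_of_subset_union hσ.isOpen_pos hσ.isClosed_cone.isOpen_compl ?_ ?_
    ⟨x, hx, fun l => hσ.repr_pos (hsub hx) hxσ l⟩
  · rw [Set.disjoint_left]
    exact fun a ha hn => hn (hσ.mem_cone_iff.2 fun l => (ha l).le)
  · intro a ha
    by_cases h : a ∈ cone (β ∘ σ)
    · exact Or.inl fun l => hσ.repr_pos (hsub ha) h l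
    · exact Or.inr h

theorem IsBigChamber.subset_cone_iff {c : Set (StrongDual ℝ V)} (hc : IsBigChamber β c)
    {σ : Fin (Module.finrank ℝ V) → Fin N} (hσ : IsBasisOf β σ) {x : StrongDual ℝ V}
    (hx : x ∈ c) : c ⊆ cone (β ∘ σ) ↔ x ∈ cone (β ∘ σ) :=
  ⟨fun h => h hx, fun h _ hy => hσ.mem_cone_iff.2 fun l => (hc.repr_pos hσ hx h hy l).le⟩

theorem smul_mem_singularSet_iff {a : StrongDual ℝ V} {r : ℝ} (hr : 0 < r) :
    r • a ∈ singularSet β ↔ a ∈ singularSet β := by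
  have key : ∀ {a : StrongDual ℝ V} {r : ℝ}, 0 < r → a ∈ singularSet β →
      r • a ∈ singularSet β := by
    intro a r hr h
    rw [mem_singularSet_iff] at h ⊢
    obtain ⟨s, hs, h⟩ := h
    exact ⟨s, hs, smul_mem_coneOn h hr.le⟩
  refine ⟨fun h => ?_, key hr⟩
  have := key (inv_pos.2 hr) h
  rwa [smul_smul, inv_mul_cancel₀ hr.ne', one_smul] at this

theorem IsBigChamber.smul_mem {c : Set (StrongDual ℝ V)} (hc : IsBigChamber β c)
    {x : StrongDual ℝ V} (hx : x ∈ c) {r : ℝ} (hr : 0 < r) : r • x ∈ c := by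
  have hK : IsPreconnected ((fun t : ℝ => t • x) '' Set.Ioi 0) :=
    isPreconnected_Ioi.image _ (by fun_prop)
  refine hc.subset_of_isPreconnected hK ?_ hx ⟨1, by simp, by simp⟩ ⟨r, hr, rfl⟩
  rintro _ ⟨t, ht, rfl⟩
  exact fun h => hc.subset_regular hx ((smul_mem_singularSet_iff ht).1 h)

/-- A chamber contains a vector which lies on none of the hyperplanes spanned by the facets of the
cones of the bases. -/
theorem IsBigChamber.exists_generic {c : Set (StrongDual ℝ V)} (hc : IsBigChamber β c) :
    ∃ x ∈ c, ∀ (σ : Fin (Module.finrank ℝ V) → Fin N) (hσ : IsBasisOf β σ)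
      (l : Fin (Module.finrank ℝ V)), hσ.basis.repr x l ≠ 0 := by
  let ι := {σ : Fin (Module.finrank ℝ V) → Fin N // IsBasisOf β σ} × Fin (Module.finrank ℝ V)
  let f : ι → Set (StrongDual ℝ V) := fun i => {x | i.1.2.basis.repr x i.2 ≠ 0}
  have hd : Dense (⋂ i, f i) := by
    refine dense_iInter_of_isOpen (fun i => ?_) (fun i => ?_)
    · exact isOpen_ne_fun (i.1.2.continuous_repr i.2) continuous_const
    · have hker : f i = ((LinearMap.ker (i.1.2.basis.coord i.2) : Submodule ℝ _) : Set _)ᶜ := by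
        ext x; simp [f]
      rw [hker]
      rw [← interior_eq_empty_iff_dense_compl, ← Set.not_nonempty_iff_eq_empty]
      intro hne
      have h := Submodule.eq_top_of_nonempty_interior' _ hne
      have h1 : i.1.2.basis i.2 ∈ LinearMap.ker (i.1.2.basis.coord i.2) := by rw [h]; trivial
      rw [LinearMap.mem_ker, Module.Basis.coord_apply, Module.Basis.repr_self] at h1
      simp at h1
  obtain ⟨x, hx, hxc⟩ := hd.inter_open_nonempty c hc.isOpen hc.nonempty
  exact ⟨x, hx, fun σ hσ l => Set.mem_iInter.1 hxc (⟨σ, hσ⟩, l)⟩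

theorem IsBasisOf.repr_self {σ : Fin (Module.finrank ℝ V) → Fin N} (hσ : IsBasisOf β σ)
    (l : Fin (Module.finrank ℝ V)) : hσ.basis.repr (β (σ l)) = Finsupp.single l 1 := by
  rw [← hσ.basis_apply, Module.Basis.repr_self]

theorem exists_basis_extension (hspan : Submodule.span ℝ (Set.range β) = ⊤) {τ : Set (Fin N)}
    (hτ : LinearIndepOn ℝ β τ) :
    ∃ σ : Fin (Module.finrank ℝ V) → Fin N, IsBasisOf β σ ∧ τ ⊆ Set.range σ := by
  classical
  obtain ⟨b, -, hτb, hsp, hli⟩ := exists_linearIndepOn_extension hτ (Set.subset_univ τ)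
  have htop : Submodule.span ℝ (β '' b) = ⊤ := by
    rw [eq_top_iff, ← hspan, Submodule.span_le, ← Set.image_univ]
    exact hsp
  have hcard : Fintype.card b = Module.finrank ℝ V := by
    rw [← finrank_strongDual, ← finrank_top, ← htop, Set.image_eq_range,
      finrank_span_eq_card (b := fun i : b => β i) hli]
  refine ⟨fun l => (Fintype.equivFinOfCardEq hcard).symm l, ?_, fun i hi => ?_⟩
  · exact (show LinearIndependent ℝ fun i : b => β i from hli).comp _
      (Fintype.equivFinOfCardEq hcard).symm.injective
  · exact ⟨Fintype.equivFinOfCardEq hcard ⟨i, hτb hi⟩, by simp⟩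

/-- Let `x` lie in the cone of the sequence and let `y` be singular. Some cone of a basis contains
`y`, on its boundary, and the points of the segment from `y` to `x` close to `y`. -/
theorem exists_basis_near_singular (hspan : Submodule.span ℝ (Set.range β) = ⊤)
    {x y : StrongDual ℝ V} (hx : x ∈ cone β) (hy : y ∈ singularSet β) :
    ∃ (σ : Fin (Module.finrank ℝ V) → Fin N) (hσ : IsBasisOf β σ),
      (∃ l, hσ.basis.repr y l = 0) ∧
      ∃ μ₀ > (0 : ℝ), ∀ μ, 0 ≤ μ → μ ≤ μ₀ → (1 - μ) • y + μ • x ∈ cone (β ∘ σ) := by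
  classical
  obtain ⟨s, hs, hys⟩ := mem_singularSet_iff.1 hy
  obtain ⟨τ, hτs, hτ, t, ht, hyt⟩ := coneOn_caratheodory s hys
  let Q := Submodule.span ℝ (β '' (τ : Set (Fin N)))
  obtain ⟨x', hx', hxx'⟩ := hx
  obtain ⟨ρ, -, hρ, r, hr, hxr⟩ := coneOn_caratheodory (w := fun i => Q.mkQ (β i)) Finset.univ
    (a := Q.mkQ x) ⟨x', hx', by rw [hxx', map_sum]; simp⟩
  have hli : LinearIndepOn ℝ β ((τ : Set (Fin N)) ∪ ρ) := hτ.union_of_quotient hρ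
  obtain ⟨σ, hσ, hsub⟩ := exists_basis_extension hspan hli
  have hcoord : ∀ i ∈ (τ : Set (Fin N)) ∪ ρ, ∀ l, hσ.basis.repr (β i) l =
      if σ l = i then 1 else 0 := by
    intro i hi l
    obtain ⟨l', rfl⟩ := hsub hi
    rw [hσ.repr_self, Finsupp.single_apply]
    simp [hσ.injective.eq_iff, eq_comm]
  have hy1 : ∀ l, hσ.basis.repr y l = if σ l ∈ τ then t (σ l) else 0 := by
    intro l
    rw [hyt, map_sum, Finsupp.finsetSum_apply,
      Finset.sum_congr rfl fun i hi => by
        rw [map_smul, Finsupp.smul_apply, hcoord i (Or.inl hi), smul_eq_mul, mul_ite, mul_one,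
          mul_zero]]
    simp
  have hx1 : ∀ l, σ l ∉ τ → 0 ≤ hσ.basis.repr x l := by
    intro l hl
    have hmem : x - ∑ i ∈ ρ, r i • β i ∈ Q := by
      rw [← Submodule.Quotient.mk_eq_zero, Submodule.Quotient.mk_sub, sub_eq_zero]
      rw [← Submodule.mkQ_apply, ← Submodule.mkQ_apply, hxr, map_sum]
      simp
    have hker : Q ≤ LinearMap.ker (hσ.basis.coord l) := by
      rw [Submodule.span_le]
      rintro _ ⟨i, hi, rfl⟩
      rw [SetLike.mem_coe, LinearMap.mem_ker, Module.Basis.coord_apply, hcoord i (Or.inl hi),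
        if_neg]
      rintro rfl
      exact hl hi
    have h0 := hker hmem
    rw [LinearMap.mem_ker, map_sub, sub_eq_zero, Module.Basis.coord_apply] at h0
    rw [h0, map_sum]
    refine Finset.sum_nonneg fun i hi => ?_
    rw [map_smul, Module.Basis.coord_apply, hcoord i (Or.inr hi), smul_eq_mul]
    have := hr i hi
    split_ifs <;> simp [this.le]
  have hex : ∃ l, σ l ∉ τ := by
    by_contra! h
    have h1 := Finset.card_le_card_of_injOn (s := Finset.univ) σ (fun l _ => h l)
      hσ.injective.injOn
    rw [Finset.card_univ, Fintype.card_fin] at h1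
    exact absurd (h1.trans (Finset.card_le_card hτs)) (not_le.2 hs)
  obtain ⟨l0, hl0⟩ := hex
  refine ⟨σ, hσ, ⟨l0, by rw [hy1, if_neg hl0]⟩, ?_⟩
  have hev : ∀ l, ∃ m > (0 : ℝ), ∀ μ, 0 ≤ μ → μ ≤ m →
      0 ≤ (1 - μ) * hσ.basis.repr y l + μ * hσ.basis.repr x l := by
    intro l
    by_cases hl : σ l ∈ τ
    · have hp : 0 < hσ.basis.repr y l := by rw [hy1, if_pos hl]; exact ht _ hl
      set p := hσ.basis.repr y l
      set q := hσ.basis.repr x l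
      refine ⟨p / (p + |q|), by positivity, fun μ h0 h1 => ?_⟩
      rw [le_div_iff₀ (by positivity)] at h1
      have : μ * -|q| ≤ μ * q := mul_le_mul_of_nonneg_left (neg_abs_le q) h0
      nlinarith
    · refine ⟨1, one_pos, fun μ h0 h1 => ?_⟩
      rw [hy1, if_neg hl, mul_zero, zero_add]
      exact mul_nonneg h0 (hx1 l hl)
  choose m hm hmm using hev
  have hne : (Finset.univ : Finset (Fin (Module.finrank ℝ V))).Nonempty := ⟨l0, Finset.mem_univ _⟩
  refine ⟨Finset.univ.inf' hne m, by simp [hm], fun μ h0 h1 => ?_⟩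
  rw [hσ.mem_cone_iff]
  intro l
  rw [map_add, map_smul, map_smul, Finsupp.add_apply, Finsupp.smul_apply, Finsupp.smul_apply]
  exact hmm l μ h0 (h1.trans (Finset.inf'_le _ (Finset.mem_univ l)))

/-- A big chamber inside `C(Φ)` is the intersection of the interiors of the cones of the bases
that contain it. -/
theorem IsBigChamber.mem_of_forall_pos (hspan : Submodule.span ℝ (Set.range β) = ⊤)
    {c : Set (StrongDual ℝ V)} (hc : IsBigChamber β c) {x y : StrongDual ℝ V}
    (hx : x ∈ c) (hxΦ : x ∈ cone β)
    (hy : ∀ (σ : Fin (Module.finrank ℝ V) → Fin N) (hσ : IsBasisOf β σ), x ∈ cone (β ∘ σ) →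
      ∀ l, 0 < hσ.basis.repr y l) : y ∈ c := by
  let f : ℝ → StrongDual ℝ V := fun θ => x + θ • (y - x)
  have hf : Continuous f := by fun_prop
  have hf0 : f 0 = x := by simp [f]
  -- the segment from `x` to `y` avoids the singular vectors
  have hreg : ∀ θ ∈ Set.Icc (0 : ℝ) 1, f θ ∉ singularSet β := by
    by_contra! hcon
    let T := Set.Icc (0 : ℝ) 1 ∩ f ⁻¹' singularSet β
    have hTc : IsClosed T := isClosed_Icc.inter ((isClosed_singularSet β).preimage hf)
    have hTb : BddBelow T := ⟨0, fun θ h => h.1.1⟩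
    have hT : sInf T ∈ T := hTc.csInf_mem (by obtain ⟨θ, h1, h2⟩ := hcon; exact ⟨θ, h1, h2⟩) hTb
    set θ₀ := sInf T with hθ₀
    have hpos : 0 < θ₀ := by
      refine hT.1.1.lt_of_ne fun h => hc.subset_regular hx ?_
      have := hT.2
      rwa [← h, Set.mem_preimage, hf0] at this
    have hbefore : ∀ θ, 0 ≤ θ → θ < θ₀ → f θ ∈ c := by
      intro θ h0 h1
      refine hc.subset_of_isPreconnected (K := f '' Set.Icc 0 θ)
        (isPreconnected_Icc.image _ hf.continuousOn) ?_ hx ⟨0, ⟨le_rfl, h0⟩, hf0⟩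
        ⟨θ, ⟨h0, le_rfl⟩, rfl⟩
      rintro _ ⟨η, hη, rfl⟩ hs
      have := csInf_le hTb (show η ∈ T from ⟨⟨hη.1, hη.2.trans (h1.le.trans hT.1.2)⟩, hs⟩)
      linarith [hη.2]
    obtain ⟨σ, hσ, ⟨l, hl⟩, μ₀, hμ₀, hμ⟩ := exists_basis_near_singular hspan hxΦ hT.2
    have hm : 0 < min μ₀ 1 := lt_min hμ₀ one_pos
    have h1 := hμ (min μ₀ 1) hm.le (min_le_left _ _)
    set μ := min μ₀ 1 with hμdef
    have hμ1 : μ ≤ 1 := min_le_right _ _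
    have h2 : (1 - μ) • f θ₀ + μ • x = f ((1 - μ) * θ₀) := by
      simp only [f]; module
    rw [h2] at h1
    have h3 : f ((1 - μ) * θ₀) ∈ c :=
      hbefore _ (mul_nonneg (by linarith) hpos.le) (by nlinarith)
    have h4 : x ∈ cone (β ∘ σ) := hσ.mem_cone_iff.2 fun l => (hc.repr_pos hσ h3 h1 hx l).le
    have h5 := hσ.repr_pos (hc.subset_regular hx) h4 l
    have h6 := hy σ hσ h4 l
    have h7 : hσ.basis.repr (f θ₀) l =
        (1 - θ₀) * hσ.basis.repr x l + θ₀ * hσ.basis.repr y l := by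
      simp only [f, map_add, map_smul, map_sub, Finsupp.add_apply, Finsupp.smul_apply,
        Finsupp.sub_apply, smul_eq_mul]
      ring
    rw [h7] at hl
    nlinarith [hT.1.2, mul_nonneg (sub_nonneg.2 hT.1.2) h5.le, mul_pos hpos h6]
  have : f 1 = y := by simp [f]
  rw [← this]
  refine hc.subset_of_isPreconnected (K := f '' Set.Icc 0 1)
    (isPreconnected_Icc.image _ hf.continuousOn) ?_ hx ⟨0, by simp, hf0⟩ ⟨1, by simp, rfl⟩
  rintro _ ⟨θ, hθ, rfl⟩
  exact hreg θ hθ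

/-- A chamber `c` in the cone of the sequence is cut out by strict inequalities: positivity of the
coordinates with respect to the bases whose cones contain `c`. Hence `closure c + c ⊆ c`, while `c`
has points in the box, close to `0`. -/
theorem IsBigChamber.closure_subset (hspan : Submodule.span ℝ (Set.range β) = ⊤)
    {c : Set (StrongDual ℝ V)} (hc : IsBigChamber β c) (hcΦ : c ⊆ cone β) :
    closure c ⊆ c - box β := by
  obtain ⟨x, hx⟩ := hc.nonempty
  obtain ⟨u, hu, hxu⟩ := hcΦ hx
  intro y hy
  -- `y + ε x` lies in `c`, and `ε x` lies in the zonotope for small `ε`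
  set ε : ℝ := (1 + ∑ i, u i)⁻¹ with hε
  have hsum : 0 ≤ ∑ i, u i := Finset.sum_nonneg fun i _ => hu i
  have hεp : 0 < ε := inv_pos.2 (by linarith)
  refine ⟨y + ε • x, ?_, ε • x, ⟨fun i => ε * u i, fun i => ⟨mul_nonneg hεp.le (hu i), ?_⟩, ?_⟩,
    by simp⟩
  · refine hc.mem_of_forall_pos hspan hx (hcΦ hx) fun σ hσ hxσ l => ?_
    have h1 := hσ.repr_pos (hc.subset_regular hx) hxσ l
    have h2 : y ∈ cone (β ∘ σ) :=
      closure_minimal ((hc.subset_cone_iff hσ hx).2 hxσ) hσ.isClosed_cone hy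
    have h3 := hσ.mem_cone_iff.1 h2 l
    rw [map_add, map_smul, Finsupp.add_apply, Finsupp.smul_apply, smul_eq_mul]
    positivity
  · rw [hε, inv_mul_le_iff₀ (by linarith)]
    have := Finset.single_le_sum (fun i _ => hu i) (Finset.mem_univ i)
    linarith
  · rw [hxu, Finset.smul_sum]
    simp only [mul_smul]

/-- The inclusion is strict since `c - β i` has points outside the closed cone of the sequence. -/
theorem IsBigChamber.closure_ssubset (hspan : Submodule.span ℝ (Set.range β) = ⊤)
    (hhalf : ∃ v : V, ∀ i, 0 < β i v)
    {c : Set (StrongDual ℝ V)} (hc : IsBigChamber β c) (hcΦ : c ⊆ cone β)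
    (hn : 0 < Module.finrank ℝ V) : closure c ⊂ c - box β := by
  refine ⟨hc.closure_subset hspan hcΦ, fun hsub => ?_⟩
  obtain ⟨v, hv⟩ := hhalf
  obtain ⟨x, hx⟩ := hc.nonempty
  have : Nonempty (Fin N) := by
    by_contra hN
    rw [not_nonempty_iff] at hN
    rw [Set.range_eq_empty, Submodule.span_empty] at hspan
    rw [← finrank_strongDual, ← finrank_top, ← hspan, finrank_bot] at hn
    exact lt_irrefl _ hn
  obtain ⟨i⟩ := this
  have hcl : closure c ⊆ cone β := closure_minimal hcΦ (isClosed_coneOn β Finset.univ)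
  -- a member of `c - β i` on which the linear form `v` is negative
  set δ : ℝ := β i v / (2 * (|x v| + 1)) with hδ
  have hδp : 0 < δ := div_pos (hv i) (by positivity)
  have hmem : δ • x - β i ∈ c - box β := by
    classical
    refine Set.sub_mem_sub (hc.smul_mem hx hδp) ⟨fun j => if j = i then 1 else 0, fun j => ?_, ?_⟩
    · dsimp only; split_ifs <;> simp
    · simp
  obtain ⟨u, hu, hxu⟩ := hcl (hsub hmem)
  have h1 : 0 ≤ (δ • x - β i) v := by
    rw [hxu, sum_apply]
    exact Finset.sum_nonneg fun j _ => mul_nonneg (hu j) (hv j).le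
  have h2 : δ * x v ≤ β i v / 2 := by
    refine (mul_le_mul_of_nonneg_left (le_abs_self (x v)) hδp.le).trans ?_
    rw [hδ, div_mul_eq_mul_div, div_le_div_iff₀ (by positivity) two_pos]
    nlinarith [hv i, abs_nonneg (x v)]
  have h3 : (δ • x - β i) v = δ * x v - β i v := rfl
  linarith [hv i]

end Chambers
end VectorPartition
end

noncomputable section
namespace VectorPartition

/-! ### Partial fractions -/

section PartialFractions

variable {V : Type*} [NormedAddCommGroup V] [NormedSpace ℝ V]

@[simp]
theorem pair_tmul (α : StrongDual ℝ V) (s : ℂ) (v : V) : pair α (s ⊗ₜ[ℝ] v) = s * α v := by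
  simp [pair, mul_comm]

theorem pair_add (α α' : StrongDual ℝ V) (z : ℂ ⊗[ℝ] V) :
    pair (α + α') z = pair α z + pair α' z := by
  induction z with
  | zero => simp
  | tmul s v => simp [mul_add]
  | add x y hx hy => simp only [map_add, hx, hy]; ring

theorem pair_smul (r : ℝ) (α : StrongDual ℝ V) (z : ℂ ⊗[ℝ] V) :
    pair (r • α) z = r * pair α z := by
  induction z with
  | zero => simp
  | tmul s v => simp; ring
  | add x y hx hy => simp only [map_add, hx, hy]; ring

/-- The pairing with a fixed point of `V_ℂ`, as a linear map on `V*`. -/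
def pairing (z : ℂ ⊗[ℝ] V) : StrongDual ℝ V →ₗ[ℝ] ℂ where
  toFun α := pair α z
  map_add' α α' := pair_add α α' z
  map_smul' r α := by rw [pair_smul]; simp

@[simp]
theorem pairing_apply (z : ℂ ⊗[ℝ] V) (α : StrongDual ℝ V) : pairing z α = pair α z := rfl

variable [FiniteDimensional ℝ V] {N : ℕ} {β : Fin N → StrongDual ℝ V}

/-- The basis of `V` dual to a basis from the sequence. -/
def IsBasisOf.dualVec {σ : Fin (Module.finrank ℝ V) → Fin N} (hσ : IsBasisOf β σ) :
    Module.Basis (Fin (Module.finrank ℝ V)) ℝ V :=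
  ((hσ.basis.map (LinearMap.toContinuousLinearMap (𝕜 := ℝ) (E := V) (F' := ℝ)).symm).dualBasis).map
    (Module.evalEquiv ℝ V).symm

theorem IsBasisOf.apply_dualVec {σ : Fin (Module.finrank ℝ V) → Fin N} (hσ : IsBasisOf β σ)
    (a : StrongDual ℝ V) (l : Fin (Module.finrank ℝ V)) :
    a (hσ.dualVec l) = hσ.basis.repr a l := by
  have h : ∀ a' : Module.Dual ℝ V, a' (hσ.dualVec l) =
      (hσ.basis.map (LinearMap.toContinuousLinearMap (𝕜 := ℝ) (E := V) (F' := ℝ)).symm).repr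
        a' l := by
    intro a'
    rw [IsBasisOf.dualVec, Module.Basis.map_apply, Module.apply_evalEquiv_symm_apply,
      Module.Basis.dualBasis_apply]
  rw [← ContinuousLinearMap.coe_coe, h]
  simp only [Module.Basis.map_repr, LinearEquiv.trans_apply, LinearEquiv.symm_symm]
  rfl

theorem IsBasisOf.form_apply {σ : Fin (Module.finrank ℝ V) → Fin N} (hσ : IsBasisOf β σ)
    (ℓ : ℂ ⊗[ℝ] V →ₗ[ℂ] ℂ) (z : ℂ ⊗[ℝ] V) :
    ℓ z = ∑ l, ℓ (1 ⊗ₜ[ℝ] hσ.dualVec l) * pair (β (σ l)) z := by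
  induction z with
  | zero => simp
  | tmul s v =>
    have h1 : v = ∑ l, β (σ l) v • hσ.dualVec l := by
      conv_lhs => rw [← hσ.dualVec.sum_repr v]
      refine Finset.sum_congr rfl fun l _ => ?_
      congr 1
      conv_rhs => rw [← hσ.dualVec.sum_repr v]
      rw [map_sum]
      simp [hσ.apply_dualVec, hσ.repr_self, Finsupp.single_apply]
    conv_lhs => rw [h1, TensorProduct.tmul_sum, map_sum]
    refine Finset.sum_congr rfl fun l _ => ?_
    rw [pair_tmul, TensorProduct.tmul_smul, ← mul_one s, ← smul_eq_mul s 1,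
      ← TensorProduct.smul_tmul', ← algebraMap_smul ℂ, map_smul, map_smul]
    simp; ring
  | add x y hx hy => simp only [map_add, hx, hy, mul_add, Finset.sum_add_distrib]

theorem IsBasisOf.pair_eq {σ : Fin (Module.finrank ℝ V) → Fin N} (hσ : IsBasisOf β σ)
    (a : StrongDual ℝ V) (z : ℂ ⊗[ℝ] V) :
    pair a z = ∑ l, (hσ.basis.repr a l : ℂ) * pair (β (σ l)) z := by
  rw [hσ.form_apply (pair a) z]
  simp [hσ.apply_dualVec]

/-- The Laurent monomial `∏ β_{σ(l)} ^ k(l)` in the members of a basis. -/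
def mono (β : Fin N → StrongDual ℝ V) (σ : Fin (Module.finrank ℝ V) → Fin N)
    (k : Fin (Module.finrank ℝ V) → ℤ) : regularPoints β → ℂ :=
  fun z => ∏ l, pair (β (σ l)) (z : ℂ ⊗[ℝ] V) ^ k l

theorem pair_ne_zero (z : regularPoints β) (i : Fin N) : pair (β i) (z : ℂ ⊗[ℝ] V) ≠ 0 := z.2 i

theorem mono_add_single (σ : Fin (Module.finrank ℝ V) → Fin N)
    (k : Fin (Module.finrank ℝ V) → ℤ) (l : Fin (Module.finrank ℝ V)) (m : ℤ)
    (z : regularPoints β) :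
    mono β σ (k + Pi.single l m) z = pair (β (σ l)) (z : ℂ ⊗[ℝ] V) ^ m * mono β σ k z := by
  simp only [mono, Pi.add_apply, zpow_add₀ (pair_ne_zero z _), Finset.prod_mul_distrib]
  rw [mul_comm]
  congr 1
  rw [Finset.prod_eq_single l]
  · simp
  · intro b _ hb; simp [hb]
  · simp

theorem mono_neg_one (σ : Fin (Module.finrank ℝ V) → Fin N) :
    mono β σ (-1) = simpleFraction β σ := by
  ext z
  simp [mono, simpleFraction]

/-- The span of the Laurent monomials whose poles are on the hyperplanes `β_i = 0`, `i ∈ Ψ`. -/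
def monoSpan (β : Fin N → StrongDual ℝ V) (Ψ : Set (Fin N)) : Submodule ℂ (regularPoints β → ℂ) :=
  Submodule.span ℂ {f | ∃ σ k, IsBasisOf β σ ∧ (∀ l, k l < 0 → σ l ∈ Ψ) ∧ f = mono β σ k}

theorem mono_mem_monoSpan {Ψ : Set (Fin N)} {σ : Fin (Module.finrank ℝ V) → Fin N}
    (hσ : IsBasisOf β σ) {k : Fin (Module.finrank ℝ V) → ℤ} (hk : ∀ l, k l < 0 → σ l ∈ Ψ) :
    mono β σ k ∈ monoSpan β Ψ :=
  Submodule.subset_span ⟨σ, k, hσ, hk, rfl⟩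

theorem form_mul_mem_monoSpan {Ψ : Set (Fin N)} (ℓ : ℂ ⊗[ℝ] V →ₗ[ℂ] ℂ)
    {f : regularPoints β → ℂ} (hf : f ∈ monoSpan β Ψ) :
    (fun z : regularPoints β => ℓ z) * f ∈ monoSpan β Ψ := by
  induction hf using Submodule.span_induction with
  | mem f h =>
    obtain ⟨σ, k, hσ, hk, rfl⟩ := h
    have : (fun z : regularPoints β => ℓ z) * mono β σ k =
        ∑ l, ℓ (1 ⊗ₜ[ℝ] hσ.dualVec l) • mono β σ (k + Pi.single l 1) := by
      ext z
      rw [Pi.mul_apply, hσ.form_apply ℓ z, Finset.sum_mul, Finset.sum_apply]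
      refine Finset.sum_congr rfl fun l _ => ?_
      rw [Pi.smul_apply, mono_add_single, zpow_one, smul_eq_mul]; ring
    rw [this]
    refine Submodule.sum_mem _ fun l _ => Submodule.smul_mem _ _ (mono_mem_monoSpan hσ ?_)
    intro l' hl'
    refine hk l' (lt_of_le_of_lt ?_ hl')
    by_cases h : l' = l
    · subst h; simp
    · simp [h]
  | zero => simp
  | add f g _ _ hf hg => rw [mul_add]; exact Submodule.add_mem _ hf hg
  | smul c f _ hf => rw [mul_smul_comm]; exact Submodule.smul_mem _ _ hf

theorem form_pow_mul_mem_monoSpan {Ψ : Set (Fin N)} (ℓ : ℂ ⊗[ℝ] V →ₗ[ℂ] ℂ) (m : ℕ)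
    {f : regularPoints β → ℂ} (hf : f ∈ monoSpan β Ψ) :
    (fun z : regularPoints β => ℓ z) ^ m * f ∈ monoSpan β Ψ := by
  induction m with
  | zero => simpa using hf
  | succ m ih => rw [pow_succ', mul_assoc]; exact form_mul_mem_monoSpan ℓ ih

/-- The exchange lemma: a basis stays a basis when the member `β_{σ(l)}` is replaced with a vector
that involves it. -/
theorem IsBasisOf.update {σ : Fin (Module.finrank ℝ V) → Fin N} (hσ : IsBasisOf β σ) {i : Fin N}
    {l : Fin (Module.finrank ℝ V)} (hl : hσ.basis.repr (β i) l ≠ 0) :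
    IsBasisOf β (Function.update σ l i) := by
  refine linearIndependent_of_top_le_span_of_card_eq_finrank ?_ (by simp [finrank_strongDual])
  set S := Submodule.span ℝ (Set.range (β ∘ Function.update σ l i)) with hS
  have h1 : β i ∈ S := Submodule.subset_span ⟨l, by simp⟩
  have h2 : ∀ l' ≠ l, β (σ l') ∈ S := fun l' h => Submodule.subset_span ⟨l', by simp [h]⟩
  have h3 : β (σ l) ∈ S := by
    have h4 : β i = hσ.basis.repr (β i) l • β (σ l) +
        ∑ l' ∈ Finset.univ.erase l, hσ.basis.repr (β i) l' • β (σ l') := by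
      rw [Finset.add_sum_erase Finset.univ (fun l' => hσ.basis.repr (β i) l' • β (σ l'))
        (Finset.mem_univ l)]
      conv_lhs => rw [← hσ.basis.sum_repr (β i)]
      simp
    have h5 : hσ.basis.repr (β i) l • β (σ l) ∈ S := by
      rw [eq_sub_of_add_eq h4.symm]
      exact S.sub_mem h1 (S.sum_mem fun l' hl' => S.smul_mem _ (h2 l' (Finset.ne_of_mem_erase hl')))
    exact (S.smul_mem_iff hl).1 h5
  rw [← hσ.basis.span_eq, Submodule.span_le]
  rintro _ ⟨l', rfl⟩
  rw [hσ.basis_apply]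
  by_cases h : l' = l
  · rw [h]; exact h3
  · exact h2 l' h

/-- Partial fractions for one more pole. If `β_i` involves a member of the basis that is not a pole
of the monomial, it is exchanged with it; otherwise `1 = ∑ c_l β_{σ(l)} / β_i` lowers the order of
the other poles. -/
theorem inv_pow_mul_mono_mem {Ψ : Set (Fin N)} {i : Fin N} (hi : i ∈ Ψ) (m : ℕ) :
    ∀ (σ : Fin (Module.finrank ℝ V) → Fin N) (k : Fin (Module.finrank ℝ V) → ℤ),
      IsBasisOf β σ → (∀ l, k l < 0 → σ l ∈ Ψ) → ∑ l, (-k l).toNat = m → ∀ r : ℕ,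
      (fun z : regularPoints β => (pair (β i) (z : ℂ ⊗[ℝ] V) ^ r)⁻¹ * mono β σ k z) ∈
        monoSpan β Ψ := by
  induction m using Nat.strong_induction_on with
  | _ m ih =>
  intro σ k hσ hk hm r
  by_cases hex : ∃ l, hσ.basis.repr (β i) l ≠ 0 ∧ 0 ≤ k l
  · obtain ⟨l, hl, hkl⟩ := hex
    have h1 : mono β (Function.update σ l i) (Function.update k l (-(r : ℤ))) ∈ monoSpan β Ψ := by
      refine mono_mem_monoSpan (hσ.update hl) fun l' hl' => ?_
      by_cases h : l' = l
      · rw [h]; simpa using hi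
      · rw [Function.update_of_ne h] at hl' ⊢
        exact hk l' hl'
    have h2 := form_pow_mul_mem_monoSpan (pair (β (σ l))) (k l).toNat h1
    convert h2 using 1
    ext z
    simp only [Pi.mul_apply, Pi.pow_apply, mono]
    rw [← Finset.mul_prod_erase _ _ (Finset.mem_univ l),
      ← Finset.mul_prod_erase (a := l) _ _ (Finset.mem_univ l)]
    have h3 : ∏ x ∈ Finset.univ.erase l, pair (β (Function.update σ l i x)) (z : ℂ ⊗[ℝ] V) ^
        Function.update k l (-(r : ℤ)) x =
        ∏ x ∈ Finset.univ.erase l, pair (β (σ x)) (z : ℂ ⊗[ℝ] V) ^ k x := by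
      refine Finset.prod_congr rfl fun x hx => ?_
      rw [Function.update_of_ne (Finset.ne_of_mem_erase hx),
        Function.update_of_ne (Finset.ne_of_mem_erase hx)]
    rw [h3]
    simp only [Function.update_self, zpow_neg, zpow_natCast]
    rw [← zpow_natCast (pair (β (σ l)) (z : ℂ ⊗[ℝ] V)), Int.toNat_of_nonneg hkl]
    ring
  · push Not at hex
    have h1 : (fun z : regularPoints β => (pair (β i) (z : ℂ ⊗[ℝ] V) ^ r)⁻¹ * mono β σ k z) =
        ∑ l, (hσ.basis.repr (β i) l : ℂ) • fun z : regularPoints β =>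
          (pair (β i) (z : ℂ ⊗[ℝ] V) ^ (r + 1))⁻¹ * mono β σ (k + Pi.single l 1) z := by
      ext z
      have h0 := pair_ne_zero z i
      simp only [Finset.sum_apply, Pi.smul_apply, smul_eq_mul, mono_add_single, zpow_one]
      have h2 := hσ.pair_eq (β i) z
      calc (pair (β i) (z : ℂ ⊗[ℝ] V) ^ r)⁻¹ * mono β σ k z
          = pair (β i) (z : ℂ ⊗[ℝ] V) *
              ((pair (β i) (z : ℂ ⊗[ℝ] V) ^ (r + 1))⁻¹ * mono β σ k z) := by
            rw [pow_succ]; field_simp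
        _ = _ := by
            conv_lhs => rw [h2]
            rw [Finset.sum_mul, ← h2]
            exact Finset.sum_congr rfl fun l _ => by ring
    rw [h1]
    refine Submodule.sum_mem _ fun l _ => ?_
    by_cases hl : hσ.basis.repr (β i) l = 0
    · simp [hl]
    · have hkl := hex l hl
      refine Submodule.smul_mem _ _ (ih _ ?_ σ _ hσ ?_ rfl _)
      · rw [← hm]
        refine Finset.sum_lt_sum (fun l' _ => ?_) ⟨l, Finset.mem_univ l, ?_⟩
        · by_cases h : l' = l
          · subst h; simp
          · simp [h]
        · simp; omega
      · intro l' hl'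
        refine hk l' (lt_of_le_of_lt ?_ hl')
        by_cases h : l' = l
        · subst h; simp
        · simp [h]

theorem inv_mul_mem_monoSpan {Ψ : Set (Fin N)} {i : Fin N} (hi : i ∈ Ψ)
    {f : regularPoints β → ℂ} (hf : f ∈ monoSpan β Ψ) :
    (fun z : regularPoints β => (pair (β i) (z : ℂ ⊗[ℝ] V))⁻¹) * f ∈ monoSpan β Ψ := by
  induction hf using Submodule.span_induction with
  | mem f h =>
    obtain ⟨σ, k, hσ, hk, rfl⟩ := h
    convert inv_pow_mul_mono_mem hi _ σ k hσ hk rfl 1 using 1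
    ext z; simp
  | zero => simp
  | add f g _ _ hf hg => rw [mul_add]; exact Submodule.add_mem _ hf hg
  | smul c f _ hf => rw [mul_smul_comm]; exact Submodule.smul_mem _ _ hf

/-- The algebra of rational functions with poles on the hyperplanes `β_i = 0`, `i ∈ Ψ`. -/
def polarRing (β : Fin N → StrongDual ℝ V) (Ψ : Set (Fin N)) :
    Subalgebra ℂ (regularPoints β → ℂ) :=
  Algebra.adjoin ℂ
    ({f | ∃ ℓ : ℂ ⊗[ℝ] V →ₗ[ℂ] ℂ, f = fun z : regularPoints β => ℓ z} ∪
      {f | ∃ i ∈ Ψ, f = fun z : regularPoints β => (pair (β i) z)⁻¹})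

theorem form_mem_polarRing {Ψ : Set (Fin N)} (ℓ : ℂ ⊗[ℝ] V →ₗ[ℂ] ℂ) :
    (fun z : regularPoints β => ℓ z) ∈ polarRing β Ψ :=
  Algebra.subset_adjoin (Set.mem_union_left _ ⟨ℓ, rfl⟩)

theorem inv_mem_polarRing {Ψ : Set (Fin N)} {i : Fin N} (hi : i ∈ Ψ) :
    (fun z : regularPoints β => (pair (β i) (z : ℂ ⊗[ℝ] V))⁻¹) ∈ polarRing β Ψ :=
  Algebra.subset_adjoin (Set.mem_union_right _ ⟨i, hi, rfl⟩)

theorem polarRing_univ : polarRing β Set.univ = ratRing β := by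
  simp [polarRing, ratRing]

theorem polarRing_mono {Ψ Ψ' : Set (Fin N)} (h : Ψ ⊆ Ψ') : polarRing β Ψ ≤ polarRing β Ψ' := by
  refine Algebra.adjoin_mono (Set.union_subset_union_right _ ?_)
  rintro f ⟨i, hi, rfl⟩
  exact ⟨i, h hi, rfl⟩

theorem mul_mem_monoSpan {Ψ : Set (Fin N)} {g : regularPoints β → ℂ} (hg : g ∈ polarRing β Ψ) :
    ∀ {f : regularPoints β → ℂ}, f ∈ monoSpan β Ψ → g * f ∈ monoSpan β Ψ := by
  induction hg using Algebra.adjoin_induction with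
  | mem g h =>
    intro f hf
    rcases h with ⟨ℓ, rfl⟩ | ⟨i, hi, rfl⟩
    · exact form_mul_mem_monoSpan ℓ hf
    · exact inv_mul_mem_monoSpan hi hf
  | algebraMap r =>
    intro f hf
    rw [← Algebra.smul_def]
    exact Submodule.smul_mem _ _ hf
  | add g g' _ _ h h' =>
    intro f hf
    rw [add_mul]
    exact Submodule.add_mem _ (h hf) (h' hf)
  | mul g g' _ _ h h' =>
    intro f hf
    rw [mul_assoc]
    exact h (h' hf)

/-- Partial fractions. -/
theorem polarRing_le_monoSpan (hspan : Submodule.span ℝ (Set.range β) = ⊤) {Ψ : Set (Fin N)}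
    {f : regularPoints β → ℂ} (hf : f ∈ polarRing β Ψ) : f ∈ monoSpan β Ψ := by
  obtain ⟨σ, hσ, -⟩ := exists_basis_extension hspan (τ := ∅) (by simp)
  have h1 : mono β σ 0 ∈ monoSpan β Ψ := mono_mem_monoSpan hσ (by simp)
  have h2 : f * mono β σ 0 = f := by ext z; simp [mono]
  rw [← h2]
  exact mul_mem_monoSpan hf h1

theorem mono_mem_ratRing (σ : Fin (Module.finrank ℝ V) → Fin N)
    (k : Fin (Module.finrank ℝ V) → ℤ) : mono β σ k ∈ ratRing β := by
  have h : mono β σ k = ∏ l, fun z : regularPoints β => pair (β (σ l)) (z : ℂ ⊗[ℝ] V) ^ k l := by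
    ext z; simp [mono]
  rw [h, ← polarRing_univ]
  refine Subalgebra.prod_mem _ fun l _ => ?_
  obtain ⟨m, hm | hm⟩ := Int.eq_nat_or_neg (k l)
  · have : (fun z : regularPoints β => pair (β (σ l)) (z : ℂ ⊗[ℝ] V) ^ k l) =
        (fun z : regularPoints β => pair (β (σ l)) (z : ℂ ⊗[ℝ] V)) ^ m := by
      ext z; simp [hm]
    rw [this]
    exact Subalgebra.pow_mem _ (form_mem_polarRing _) _
  · have : (fun z : regularPoints β => pair (β (σ l)) (z : ℂ ⊗[ℝ] V) ^ k l) =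
        (fun z : regularPoints β => (pair (β (σ l)) (z : ℂ ⊗[ℝ] V))⁻¹) ^ m := by
      ext z; simp [hm]
    rw [this]
    exact Subalgebra.pow_mem _ (inv_mem_polarRing (Set.mem_univ _)) _

/-! ### Derivatives of Laurent monomials -/

theorem hasDerivAt_mono_line (σ : Fin (Module.finrank ℝ V) → Fin N)
    (k : Fin (Module.finrank ℝ V) → ℤ) (z : regularPoints β) (v : ℂ ⊗[ℝ] V) :
    HasDerivAt (fun t : ℂ => ∏ l, pair (β (σ l)) ((z : ℂ ⊗[ℝ] V) + t • v) ^ k l)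
      (∑ l, (k l * pair (β (σ l)) v) * mono β σ (k - Pi.single l 1) z) 0 := by
  have h1 : ∀ l ∈ Finset.univ, HasDerivAt
      (fun t : ℂ => pair (β (σ l)) ((z : ℂ ⊗[ℝ] V) + t • v) ^ k l)
      (k l * pair (β (σ l)) (z : ℂ ⊗[ℝ] V) ^ (k l - 1) * pair (β (σ l)) v) 0 := by
    intro l _
    have h2 : HasDerivAt (fun t : ℂ => pair (β (σ l)) ((z : ℂ ⊗[ℝ] V) + t • v))
        (pair (β (σ l)) v) 0 := by
      simp only [map_add, map_smul, smul_eq_mul]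
      simpa using ((hasDerivAt_id (0 : ℂ)).mul_const (pair (β (σ l)) v)).const_add
        (pair (β (σ l)) (z : ℂ ⊗[ℝ] V))
    have h3 := (hasDerivAt_zpow (k l) (pair (β (σ l)) ((z : ℂ ⊗[ℝ] V) + (0 : ℂ) • v))
      (Or.inl (by simpa using pair_ne_zero z (σ l)))).comp (0 : ℂ) h2
    simpa [Function.comp_def] using h3
  have h4 := HasDerivAt.fun_finsetProd h1
  refine h4.congr_deriv (Finset.sum_congr rfl fun l _ => ?_)
  rw [sub_eq_add_neg k, ← Pi.single_neg, mono_add_single]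
  simp only [zero_smul, add_zero, mono, smul_eq_mul]
  rw [← Finset.mul_prod_erase _ _ (Finset.mem_univ l), zpow_sub_one₀ (pair_ne_zero z _),
      zpow_neg_one]
  ring

end PartialFractions
end VectorPartition
end

noncomputable section
namespace VectorPartition

/-! ### Laplace transforms of monomials on simplicial cones -/

section OneVariable

open MeasureTheory Filter Topology

/-- The function `t ^ r / r!` on the half-line `t ≥ 0`. -/
def halfPow (r : ℕ) (t : ℝ) : ℂ := if 0 ≤ t then (t : ℂ) ^ r / (r.factorial : ℂ) else 0

theorem integrableOn_pow_mul_cexp (r : ℕ) {w : ℂ} (hw : 0 < w.re) :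
    IntegrableOn (fun t : ℝ => (t : ℂ) ^ r / (r.factorial : ℂ) * Complex.exp (-(t * w)))
      (Set.Ioi 0) := by
  have h1 := integrableOn_rpow_mul_exp_neg_mul_rpow (p := 1) (s := r) (b := w.re)
    (by have : (0 : ℝ) ≤ r := Nat.cast_nonneg r
        linarith) one_pos hw
  refine (h1.norm.div_const (r.factorial : ℝ)).mono' ?_ ?_
  · exact (Continuous.aestronglyMeasurable (by fun_prop))
  · filter_upwards with t
    rw [norm_mul, norm_div, norm_pow, Complex.norm_exp]
    simp only [Real.rpow_natCast, Real.rpow_one, norm_mul, norm_pow, Complex.norm_real,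
      Complex.norm_natCast, Complex.neg_re, Complex.re_ofReal_mul, Real.norm_eq_abs, Real.abs_exp]
    rw [div_mul_eq_mul_div, neg_mul, mul_comm t]

theorem integral_pow_mul_cexp (r : ℕ) {w : ℂ} (hw : 0 < w.re) :
    ∫ t in Set.Ioi (0 : ℝ), (t : ℂ) ^ r / (r.factorial : ℂ) * Complex.exp (-(t * w)) =
      w ^ (-(r : ℤ) - 1) := by
  have hw0 : w ≠ 0 := by rintro rfl; simp at hw
  have hexp : ∀ t : ℝ, HasDerivAt (fun t : ℝ => Complex.exp (-(t * w)))
      (-w * Complex.exp (-(t * w))) t := by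
    intro t
    have h1 : HasDerivAt (fun t : ℝ => -((t : ℂ) * w)) (-w) t := by
      simpa using ((Complex.ofRealCLM.hasDerivAt (x := t)).mul_const w).fun_neg
    simpa [mul_comm] using h1.cexp
  have hlim : ∀ m : ℕ, Tendsto (fun t : ℝ => (t : ℂ) ^ m * Complex.exp (-(t * w))) atTop (𝓝 0) := by
    intro m
    rw [tendsto_zero_iff_norm_tendsto_zero]
    have h1 := (isLittleO_pow_exp_pos_mul_atTop m hw).tendsto_div_nhds_zero
    refine (h1.congr' ?_)
    filter_upwards [eventually_ge_atTop 0] with t ht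
    rw [norm_mul, norm_pow, Complex.norm_exp, Complex.norm_real, Real.norm_of_nonneg ht,
      Complex.neg_re, Complex.re_ofReal_mul, Real.exp_neg, div_eq_mul_inv, mul_comm t]
  induction r with
  | zero =>
    have h1 := integral_Ioi_of_hasDerivAt_of_tendsto (a := (0 : ℝ))
      (f := fun t : ℝ => -w⁻¹ * Complex.exp (-(t * w)))
      (f' := fun t : ℝ => Complex.exp (-(t * w))) (m := 0)
      (by fun_prop) (fun t _ => by
        refine ((hexp t).const_mul (-w⁻¹)).congr_deriv ?_
        field_simp)
      (by simpa using integrableOn_pow_mul_cexp 0 hw)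
      (by simpa using (hlim 0).const_mul (-w⁻¹))
    simpa using h1
  | succ r ih =>
    have h1 := integral_Ioi_of_hasDerivAt_of_tendsto (a := (0 : ℝ))
      (f := fun t : ℝ => w⁻¹ * ((t : ℂ) ^ (r + 1) / ((r + 1).factorial : ℂ) *
        Complex.exp (-(t * w))))
      (f' := fun t : ℝ => w⁻¹ * ((t : ℂ) ^ r / (r.factorial : ℂ) * Complex.exp (-(t * w))) -
        (t : ℂ) ^ (r + 1) / ((r + 1).factorial : ℂ) * Complex.exp (-(t * w))) (m := 0)
      (Continuous.continuousWithinAt (by fun_prop)) (fun t _ => by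
        have h2 : HasDerivAt (fun t : ℝ => (t : ℂ) ^ (r + 1) / ((r + 1).factorial : ℂ))
            ((t : ℂ) ^ r / (r.factorial : ℂ)) t := by
          have h3 := ((Complex.ofRealCLM.hasDerivAt (x := t)).pow (r + 1)).div_const
            ((r + 1).factorial : ℂ)
          refine h3.congr_deriv ?_
          have : (r.factorial : ℂ) ≠ 0 := by exact_mod_cast r.factorial_ne_zero
          have : (r : ℂ) + 1 ≠ 0 := by exact_mod_cast r.succ_ne_zero
          simp [Nat.factorial_succ]
          field_simp
        refine ((h2.mul (hexp t)).const_mul w⁻¹).congr_deriv ?_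
        field_simp
        ring)
      (((integrableOn_pow_mul_cexp r hw).const_mul w⁻¹).sub (integrableOn_pow_mul_cexp (r + 1) hw))
      (by
        have h3 := (hlim (r + 1)).const_mul (w⁻¹ / ((r + 1).factorial : ℂ))
        rw [mul_zero] at h3
        refine h3.congr fun t => ?_
        ring)
    rw [integral_sub ((integrableOn_pow_mul_cexp r hw).const_mul w⁻¹)
      (integrableOn_pow_mul_cexp (r + 1) hw), integral_const_mul, ih] at h1
    have h4 : w ^ (-((r + 1 : ℕ) : ℤ) - 1) = w⁻¹ * w ^ (-(r : ℤ) - 1) := by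
      rw [← zpow_neg_one, ← zpow_add₀ hw0]
      congr 1; push_cast; ring
    rw [h4]
    simp at h1
    rw [← sub_eq_zero, ← neg_sub, h1, neg_zero]

theorem integrable_halfPow_mul_cexp (r : ℕ) {w : ℂ} (hw : 0 < w.re) :
    Integrable fun t : ℝ => halfPow r t * Complex.exp (-(t * w)) := by
  have h1 :=
    (integrableOn_Ici_iff_integrableOn_Ioi (μ := volume)).2 (integrableOn_pow_mul_cexp r hw)
  rw [← integrable_indicator_iff measurableSet_Ici] at h1
  refine h1.congr (Eventually.of_forall fun t => ?_)
  by_cases ht : 0 ≤ t <;> simp [halfPow, ht, Set.indicator]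

theorem integral_halfPow_mul_cexp (r : ℕ) {w : ℂ} (hw : 0 < w.re) :
    ∫ t : ℝ, halfPow r t * Complex.exp (-(t * w)) = w ^ (-(r : ℤ) - 1) := by
  rw [← integral_pow_mul_cexp r hw, ← integral_Ici_eq_integral_Ioi,
    ← integral_indicator measurableSet_Ici]
  congr 1
  ext t
  by_cases ht : 0 ≤ t <;> simp [halfPow, ht, Set.indicator]

end OneVariable

section Laplace

open MeasureTheory Filter Topology

variable {V : Type*} [NormedAddCommGroup V] [NormedSpace ℝ V] [FiniteDimensional ℝ V]

/-- The `ℤ`-basis of `Γ` that enters `latticeVol`, as a basis of `V`. -/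
def latticeBasis (Γ : Submodule ℤ V) [DiscreteTopology Γ] [IsZLattice ℝ Γ] :
    Module.Basis (Fin (Module.finrank ℝ V)) ℝ V :=
  haveI : Module.Free ℤ Γ := ZLattice.module_free ℝ Γ
  haveI : Module.Finite ℤ Γ := ZLattice.module_finite ℝ Γ
  (Module.finBasisOfFinrankEq ℤ Γ (ZLattice.rank ℝ Γ)).ofZLatticeBasis ℝ Γ

variable (Γ : Submodule ℤ V) [DiscreteTopology Γ] [IsZLattice ℝ Γ]

theorem latticeVol_eq (w : Fin (Module.finrank ℝ V) → StrongDual ℝ V) :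
    latticeVol Γ w = |Matrix.det (Matrix.of fun i j => w i (latticeBasis Γ j))| := by
  simp only [latticeVol, latticeBasis, Module.Basis.ofZLatticeBasis_apply]

theorem span_latticeBasis : Submodule.span ℤ (Set.range (latticeBasis Γ)) = Γ := by
  have : Module.Free ℤ Γ := ZLattice.module_free ℝ Γ
  have : Module.Finite ℤ Γ := ZLattice.module_finite ℝ Γ
  exact (Module.finBasisOfFinrankEq ℤ Γ (ZLattice.rank ℝ Γ)).ofZLatticeBasis_span ℝ

/-- The linear form with given values on the lattice basis. -/
def formOf : (Fin (Module.finrank ℝ V) → ℝ) ≃ₗ[ℝ] StrongDual ℝ V :=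
  ((latticeBasis Γ).constr ℝ (M' := ℝ)).trans LinearMap.toContinuousLinearMap

@[simp]
theorem formOf_apply_latticeBasis (y : Fin (Module.finrank ℝ V) → ℝ)
    (j : Fin (Module.finrank ℝ V)) : formOf Γ y (latticeBasis Γ j) = y j := by
  simp [formOf]

variable {N : ℕ} {β : Fin N → StrongDual ℝ V}

/-- The matrix of the coordinates of a tuple of vectors of `V*` in the lattice basis. -/
def coordMatrix (w : Fin (Module.finrank ℝ V) → StrongDual ℝ V) :
    Matrix (Fin (Module.finrank ℝ V)) (Fin (Module.finrank ℝ V)) ℝ :=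
  Matrix.of fun i j => w i (latticeBasis Γ j)

theorem formOf_mulVec (w : Fin (Module.finrank ℝ V) → StrongDual ℝ V)
    (s : Fin (Module.finrank ℝ V) → ℝ) :
    formOf Γ (Matrix.toLin' (coordMatrix Γ w).transpose s) = ∑ l, s l • w l := by
  ext v
  refine congrFun (congrArg DFunLike.coe ((latticeBasis Γ).ext (f₁ := (formOf Γ _ : V →ₗ[ℝ] ℝ))
    (f₂ := ((∑ l, s l • w l : StrongDual ℝ V) : V →ₗ[ℝ] ℝ)) fun j => ?_)) v
  simp [Matrix.mulVec, dotProduct, coordMatrix, mul_comm]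

theorem IsBasisOf.det_ne_zero {σ : Fin (Module.finrank ℝ V) → Fin N} (hσ : IsBasisOf β σ) :
    (coordMatrix Γ (β ∘ σ)).det ≠ 0 := by
  have hinj : Function.Injective (Matrix.toLin' (coordMatrix Γ (β ∘ σ)).transpose) := by
    intro s s' h
    have h1 := congrArg (formOf Γ) h
    rw [formOf_mulVec, formOf_mulVec] at h1
    have h2 : ∀ s : Fin (Module.finrank ℝ V) → ℝ,
        ∑ l, s l • (β ∘ σ) l = hσ.basis.equivFun.symm s := by
      intro s
      simp [Module.Basis.equivFun_symm_apply]
    rw [h2, h2] at h1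
    exact hσ.basis.equivFun.symm.injective h1
  rw [← Matrix.det_transpose, ← LinearMap.det_toLin']
  have := LinearMap.ker_eq_bot.2 hinj
  exact (LinearEquiv.ofInjectiveEndo _ hinj).isUnit_det'.ne_zero

variable (β) in
/-- The index set of the Laurent monomials `β_σ ^ k` in the bases from the sequence. -/
abbrev MonoIdx : Type :=
  {σ : Fin (Module.finrank ℝ V) → Fin N // IsBasisOf β σ} × (Fin (Module.finrank ℝ V) → ℤ)

variable (β) in
/-- The inverse Laplace transform of `β_σ ^ k`, evaluated at `a`, apart from distributions
supported on the boundary of the cone: it vanishes if some exponent is nonnegative. -/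
def monoInv (a : StrongDual ℝ V)
    (i : MonoIdx β) : ℂ :=
  if ∀ l, i.2 l < 0 then
    ((latticeVol Γ (β ∘ i.1.1) : ℝ) : ℂ)⁻¹ *
      ∏ l, halfPow (-i.2 l - 1).toNat (i.1.2.basis.repr a l)
  else 0

/-- A Laurent monomial with negative exponents is the Laplace transform of its `monoInv`: in the
coordinates with respect to the basis both sides are products. -/
theorem laplace_monoInv
    (i : MonoIdx β) (hi : ∀ l, i.2 l < 0) (z : regularPoints β)
    (hz : ∀ j, 0 < (pair (β j) (z : ℂ ⊗[ℝ] V)).re) :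
    Integrable (fun y => monoInv Γ β (formOf Γ y) i *
        Complex.exp (-pair (formOf Γ y) (z : ℂ ⊗[ℝ] V))) ∧
      ∫ y, monoInv Γ β (formOf Γ y) i * Complex.exp (-pair (formOf Γ y) (z : ℂ ⊗[ℝ] V)) =
        mono β i.1 i.2 z := by
  obtain ⟨⟨σ, hσ⟩, k⟩ := i
  dsimp only at hi
  set A := (coordMatrix Γ (β ∘ σ)).transpose with hA
  have hdet : A.det ≠ 0 := by rw [hA, Matrix.det_transpose]; exact hσ.det_ne_zero Γ
  have hvol : latticeVol Γ (β ∘ σ) = |A.det| := by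
    rw [hA, Matrix.det_transpose, latticeVol_eq]; rfl
  set G : (Fin (Module.finrank ℝ V) → ℝ) → ℂ := fun y =>
    monoInv Γ β (formOf Γ y) (⟨σ, hσ⟩, k) * Complex.exp (-pair (formOf Γ y) (z : ℂ ⊗[ℝ] V)) with hG
  -- in the coordinates with respect to `σ` the integrand is a product
  have hGA : ∀ s, G (Matrix.toLin' A s) = ((|A.det| : ℝ) : ℂ)⁻¹ *
      ∏ l, (halfPow (-k l - 1).toNat (s l) *
        Complex.exp (-(s l * pair (β (σ l)) (z : ℂ ⊗[ℝ] V)))) := by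
    intro s
    have h1 : formOf Γ (Matrix.toLin' A s) = ∑ l, s l • hσ.basis l := by
      rw [hA, formOf_mulVec]; simp
    have h2 : ∀ l, hσ.basis.repr (formOf Γ (Matrix.toLin' A s)) l = s l := by
      intro l; rw [h1, Module.Basis.repr_sum_self]
    have h3 : pair (formOf Γ (Matrix.toLin' A s)) (z : ℂ ⊗[ℝ] V) =
        ∑ l, s l * pair (β (σ l)) (z : ℂ ⊗[ℝ] V) := by
      rw [hσ.pair_eq]; simp only [h2]
    simp only [hG, monoInv]
    rw [if_pos hi, h3, ← Finset.sum_neg_distrib, Complex.exp_sum, hvol, mul_assoc,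
      ← Finset.prod_mul_distrib]
    simp only [h2]
  have hint : Integrable fun s => G (Matrix.toLin' A s) := by
    simp only [hGA]
    exact (Integrable.fintype_prod fun l =>
      integrable_halfPow_mul_cexp (-k l - 1).toNat (hz (σ l))).const_mul _
  have hmap := Real.map_matrix_volume_pi_eq_smul_volume_pi hdet
  have hemb : MeasurableEmbedding (Matrix.toLin' A) := by
    have hinj : Function.Injective (Matrix.toLin' A) := by
      rw [show ⇑(Matrix.toLin' A) = A.mulVec from rfl]
      exact Matrix.mulVec_injective_iff_isUnit.2 ((Matrix.isUnit_iff_isUnit_det _).2 hdet.isUnit)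
    exact
      (LinearMap.isClosedEmbedding_of_injective (LinearMap.ker_eq_bot.2 hinj)).measurableEmbedding
  have hd0 : ENNReal.ofReal |A.det⁻¹| ≠ 0 := by
    simpa using hdet
  have hGint : Integrable G := by
    have h1 : Integrable G (Measure.map (Matrix.toLin' A) volume) := by
      rw [hemb.integrable_map_iff]; exact hint
    rw [hmap, integrable_smul_measure hd0 ENNReal.ofReal_ne_top] at h1
    exact h1
  refine ⟨hGint, ?_⟩
  have h2 : ∫ y, G y ∂(Measure.map (Matrix.toLin' A) volume) = ∫ s, G (Matrix.toLin' A s) :=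
    hemb.integral_map G
  rw [hmap, integral_smul_measure, ENNReal.toReal_ofReal (abs_nonneg _)] at h2
  simp only [hGA] at h2
  rw [integral_const_mul, integral_fintype_prod_volume_eq_prod
    (fun l (t : ℝ) => halfPow (-k l - 1).toNat t *
      Complex.exp (-(t * pair (β (σ l)) (z : ℂ ⊗[ℝ] V))))] at h2
  simp only [integral_halfPow_mul_cexp _ (hz _)] at h2
  have hne : ((|A.det| : ℝ) : ℂ)⁻¹ ≠ 0 := by simpa using hdet
  rw [abs_inv, Complex.real_smul, Complex.ofReal_inv] at h2
  rw [mul_left_cancel₀ hne h2, mono]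
  refine Finset.prod_congr rfl fun l _ => ?_
  congr 1
  rw [Int.toNat_of_nonneg (by have := hi l; omega)]
  ring

end Laplace
end VectorPartition
end

noncomputable section
namespace VectorPartition

/-! ### Linear relations between Laurent monomials -/

section Relations

open MeasureTheory Filter Topology

variable {V : Type*} [NormedAddCommGroup V] [NormedSpace ℝ V] [FiniteDimensional ℝ V]
variable (Γ : Submodule ℤ V) [DiscreteTopology Γ] [IsZLattice ℝ Γ]
variable {N : ℕ} {β : Fin N → StrongDual ℝ V}

/-- The rational function represented by a formal combination of Laurent monomials. -/
def evalMono : (MonoIdx β →₀ ℂ) →ₗ[ℂ] (regularPoints β → ℂ) :=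
  Finsupp.linearCombination ℂ fun i => mono β i.1 i.2

/-- The inverse Laplace transform at `a` of a formal combination of Laurent monomials. -/
def invMono (a : StrongDual ℝ V) : (MonoIdx β →₀ ℂ) →ₗ[ℂ] ℂ :=
  Finsupp.linearCombination ℂ (monoInv Γ β a)

/-- The operator `-∂_γ` on formal combinations of Laurent monomials. -/
def dirDeriv (γ : V) : (MonoIdx β →₀ ℂ) →ₗ[ℂ] (MonoIdx β →₀ ℂ) :=
  Finsupp.linearCombination ℂ fun i => ∑ l, (-(i.2 l : ℂ) * (β (i.1.1 l) γ : ℂ)) •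
    Finsupp.single (i.1, i.2 - Pi.single l 1) 1

theorem evalMono_single (i : MonoIdx β) (r : ℂ) :
    evalMono (Finsupp.single i r) = r • mono β i.1 i.2 := by
  simp [evalMono]

theorem evalMono_apply (m : MonoIdx β →₀ ℂ) (z : regularPoints β) :
    evalMono m z = ∑ i ∈ m.support, m i * mono β i.1 i.2 z := by
  simp [evalMono, Finsupp.linearCombination_apply, Finsupp.sum]

theorem eventually_mem_regularPoints (z : regularPoints β) (v : ℂ ⊗[ℝ] V) :
    ∀ᶠ t in 𝓝 (0 : ℂ), (z : ℂ ⊗[ℝ] V) + t • v ∈ regularPoints β := by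
  change ∀ᶠ t in 𝓝 (0 : ℂ), ∀ i, pair (β i) ((z : ℂ ⊗[ℝ] V) + t • v) ≠ 0
  rw [eventually_all]
  intro i
  have hc : Continuous fun t : ℂ => pair (β i) ((z : ℂ ⊗[ℝ] V) + t • v) := by
    simp only [map_add, map_smul, smul_eq_mul]
    fun_prop
  exact hc.continuousAt.eventually_ne (by simpa using pair_ne_zero z i)

theorem evalMono_dirDeriv_apply (γ : V) (m : MonoIdx β →₀ ℂ) (z : regularPoints β) :
    evalMono (dirDeriv γ m) z = -∑ i ∈ m.support, m i * ∑ l, (i.2 l *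
      pair (β (i.1.1 l)) ((1 : ℂ) ⊗ₜ[ℝ] γ)) * mono β i.1 (i.2 - Pi.single l 1) z := by
  rw [dirDeriv, Finsupp.linearCombination_apply, Finsupp.sum, map_sum, Finset.sum_apply,
    ← Finset.sum_neg_distrib]
  refine Finset.sum_congr rfl fun i _ => ?_
  rw [map_smul, map_sum, Pi.smul_apply, Finset.sum_apply, smul_eq_mul, ← mul_neg,
    ← Finset.sum_neg_distrib]
  congr 1
  refine Finset.sum_congr rfl fun l _ => ?_
  rw [map_smul, evalMono_single]
  simp

theorem hasLineDerivAt_evalMono {f : ℂ ⊗[ℝ] V → ℂ} {m : MonoIdx β →₀ ℂ}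
    (hf : (fun z : regularPoints β => f z) = evalMono m) (v : ℂ ⊗[ℝ] V) (z : regularPoints β) :
    HasLineDerivAt ℂ f (∑ i ∈ m.support, m i * ∑ l, (i.2 l * pair (β (i.1.1 l)) v) *
      mono β i.1 (i.2 - Pi.single l 1) z) (z : ℂ ⊗[ℝ] V) v := by
  have h1 : HasDerivAt (fun t : ℂ => ∑ i ∈ m.support, m i *
      ∏ l, pair (β (i.1.1 l)) ((z : ℂ ⊗[ℝ] V) + t • v) ^ i.2 l)
      (∑ i ∈ m.support, m i * ∑ l, (i.2 l * pair (β (i.1.1 l)) v) *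
        mono β i.1 (i.2 - Pi.single l 1) z) 0 :=
    HasDerivAt.fun_sum fun i _ => (hasDerivAt_mono_line i.1.1 i.2 z v).const_mul (m i)
  refine h1.congr_of_eventuallyEq ?_
  filter_upwards [eventually_mem_regularPoints z v] with t ht
  have := congrFun hf ⟨_, ht⟩
  dsimp only at this
  rw [this, evalMono_apply]
  rfl

theorem evalMono_dirDeriv {m : MonoIdx β →₀ ℂ} (hm : evalMono m = 0) (γ : V) :
    evalMono (dirDeriv γ m) = 0 := by
  ext z
  rw [evalMono_dirDeriv_apply]
  have h1 := hasLineDerivAt_evalMono (f := fun _ => 0) (m := m) (by rw [hm]; rfl)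
    ((1 : ℂ) ⊗ₜ[ℝ] γ) z
  have h2 : HasLineDerivAt ℂ (fun _ : ℂ ⊗[ℝ] V => (0 : ℂ)) 0 (z : ℂ ⊗[ℝ] V)
      ((1 : ℂ) ⊗ₜ[ℝ] γ) := hasDerivAt_const _ _
  rw [HasDerivAt.unique h1 h2]
  simp

theorem halfPow_succ (r : ℕ) (t : ℝ) :
    ((r : ℂ) + 1) * halfPow (r + 1) t = t * halfPow r t := by
  unfold halfPow
  split_ifs
  · have : (r.factorial : ℂ) ≠ 0 := by exact_mod_cast r.factorial_ne_zero
    have : (r : ℂ) + 1 ≠ 0 := by exact_mod_cast r.succ_ne_zero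
    rw [Nat.factorial_succ]
    push_cast
    field_simp
    ring
  · simp

theorem monoInv_sub_single (a : StrongDual ℝ V) (i : MonoIdx β)
    (l : Fin (Module.finrank ℝ V)) :
    -(i.2 l : ℂ) * monoInv Γ β a (i.1, i.2 - Pi.single l 1) =
      i.1.2.basis.repr a l * monoInv Γ β a i := by
  obtain ⟨⟨σ, hσ⟩, k⟩ := i
  dsimp only
  by_cases hk : ∀ l, k l < 0
  · have hk' : ∀ l', (k - Pi.single l 1 : Fin (Module.finrank ℝ V) → ℤ) l' < 0 := by
      intro l'
      have := hk l'
      by_cases h : l' = l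
      · subst h; simp; omega
      · simp [h, this]
    rw [monoInv, if_pos hk', monoInv, if_pos hk, ← Finset.mul_prod_erase _ _ (Finset.mem_univ l),
      ← Finset.mul_prod_erase (a := l) _ _ (Finset.mem_univ l)]
    have h1 : ∏ x ∈ Finset.univ.erase l,
        halfPow (-(k - Pi.single l 1 : Fin (Module.finrank ℝ V) → ℤ) x - 1).toNat
          (hσ.basis.repr a x) =
        ∏ x ∈ Finset.univ.erase l, halfPow (-k x - 1).toNat (hσ.basis.repr a x) := by
      refine Finset.prod_congr rfl fun x hx => ?_
      simp [Finset.ne_of_mem_erase hx]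
    have h2 : (-(k - Pi.single l 1 : Fin (Module.finrank ℝ V) → ℤ) l - 1).toNat =
        (-k l - 1).toNat + 1 := by
      have := hk l
      simp; omega
    have h3 : -(k l : ℂ) = ((-k l - 1).toNat : ℂ) + 1 := by
      have h4 : ((-k l - 1).toNat : ℤ) + 1 = -k l := by
        rw [Int.toNat_of_nonneg (by have := hk l; omega)]; ring
      exact_mod_cast h4.symm
    have h5 := halfPow_succ (-k l - 1).toNat (hσ.basis.repr a l)
    rw [h1, h2, h3]
    linear_combination ((latticeVol Γ (β ∘ σ) : ℝ) : ℂ)⁻¹ *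
      (∏ x ∈ Finset.univ.erase l, halfPow (-k x - 1).toNat (hσ.basis.repr a x)) * h5
  · have h1 : monoInv Γ β a (⟨σ, hσ⟩, k) = 0 := if_neg hk
    rw [h1, mul_zero]
    by_cases hl : k l = 0
    · simp [hl]
    · rw [monoInv, if_neg, mul_zero]
      push Not at hk ⊢
      obtain ⟨l', hl'⟩ := hk
      refine ⟨l', ?_⟩
      by_cases h : l' = l
      · subst h; simp; omega
      · simp [h, hl']

/-- Under the inverse Laplace transform, `dirDeriv γ` becomes multiplication by `⟨a, γ⟩`. -/
theorem invMono_dirDeriv (a : StrongDual ℝ V) (γ : V) (m : MonoIdx β →₀ ℂ) :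
    invMono Γ a (dirDeriv γ m) = a γ * invMono Γ a m := by
  induction m using Finsupp.induction_linear with
  | zero => simp
  | add f g hf hg => simp only [map_add, hf, hg, mul_add]
  | single i r =>
    have h1 : (a γ : ℂ) = ∑ l, (i.1.2.basis.repr a l : ℂ) * (β (i.1.1 l) γ : ℂ) := by
      have h2 := i.1.2.pair_eq a ((1 : ℂ) ⊗ₜ[ℝ] γ)
      simpa using h2
    simp only [invMono, dirDeriv, Finsupp.linearCombination_single, map_smul, map_sum, smul_eq_mul]
    rw [h1, Finset.sum_mul, Finset.mul_sum]
    refine Finset.sum_congr rfl fun l _ => ?_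
    have h3 := monoInv_sub_single Γ a i l
    linear_combination r * (β (i.1.1 l) γ : ℂ) * h3

/-- All exponents at the pole `q` are less than `K` in a formal combination of monomials. -/
def poleBounded (q : {σ : Fin (Module.finrank ℝ V) → Fin N // IsBasisOf β σ} ×
    Fin (Module.finrank ℝ V)) (K : ℕ) : Submodule ℂ (MonoIdx β →₀ ℂ) :=
  Finsupp.supported ℂ ℂ {i | i.1 = q.1 → i.2 q.2 < K}

theorem dirDeriv_mem_poleBounded
    {q : {σ : Fin (Module.finrank ℝ V) → Fin N // IsBasisOf β σ} × Fin (Module.finrank ℝ V)}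
    {K : ℕ} {m : MonoIdx β →₀ ℂ} (hm : m ∈ poleBounded q K) (γ : V) :
    dirDeriv γ m ∈ poleBounded q K := by
  rw [dirDeriv, Finsupp.linearCombination_apply]
  refine Submodule.sum_mem _ fun i hi => Submodule.smul_mem _ _ (Submodule.sum_mem _ fun l _ =>
    Submodule.smul_mem _ _
      (Finsupp.single_mem_supported _ _ fun hiq => lt_of_le_of_lt ?_ (hm hi hiq)))
  by_cases h : q.2 = l
  · subst h; simp
  · simp [h]

/-- For `q = (σ, l)`, differentiating along the dual vector of `β_{σ(l)}` lowers the exponent at the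
pole `q` of the monomials in `σ`, and annihilates those in which this exponent is zero. -/
theorem dirDeriv_dualVec_mem_poleBounded
    {q : {σ : Fin (Module.finrank ℝ V) → Fin N // IsBasisOf β σ} × Fin (Module.finrank ℝ V)}
    {K : ℕ} {m : MonoIdx β →₀ ℂ} (hm : m ∈ poleBounded q (K + 1)) :
    dirDeriv (q.1.2.dualVec q.2) m ∈ poleBounded q K := by
  rw [dirDeriv, Finsupp.linearCombination_apply]
  refine Submodule.sum_mem _ fun i hi => Submodule.smul_mem _ _ (Submodule.sum_mem _ fun l _ => ?_)
  by_cases hiq : i.1 = q.1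
  · rw [hiq, q.1.2.apply_dualVec, q.1.2.repr_self, Finsupp.single_apply]
    by_cases h : l = q.2
    · subst h
      have h1 : i.2 q.2 < (K : ℤ) + 1 := by exact_mod_cast hm hi hiq
      by_cases h0 : i.2 q.2 = 0
      · simp [h0]
      · refine Submodule.smul_mem _ _ (Finsupp.single_mem_supported _ _ fun _ => ?_)
        simp only [Pi.sub_apply, Pi.single_eq_same]
        omega
    · simp [h]
  · exact Submodule.smul_mem _ _ (Finsupp.single_mem_supported _ _ fun h => absurd h hiq)

theorem exists_poleBounded (q : {σ : Fin (Module.finrank ℝ V) → Fin N // IsBasisOf β σ} ×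
    Fin (Module.finrank ℝ V)) (m : MonoIdx β →₀ ℂ) : ∃ K, m ∈ poleBounded q K := by
  refine ⟨∑ i ∈ m.support, (i.2 q.2 + 1).toNat, fun i hi _ => ?_⟩
  have h1 := Finset.single_le_sum (f := fun i : MonoIdx β => (i.2 q.2 + 1).toNat)
    (fun _ _ => Nat.zero_le _) hi
  omega

end Relations
end VectorPartition
end

noncomputable section
namespace VectorPartition

section Relations

open MeasureTheory Filter Topology

variable {V : Type*} [NormedAddCommGroup V] [NormedSpace ℝ V] [FiniteDimensional ℝ V]
variable (Γ : Submodule ℤ V) [DiscreteTopology Γ] [IsZLattice ℝ Γ]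
variable {N : ℕ} {β : Fin N → StrongDual ℝ V}

theorem continuousAt_halfPow (r : ℕ) {t : ℝ} (ht : t ≠ 0) : ContinuousAt (halfPow r) t := by
  rcases lt_or_gt_of_ne ht with h | h
  · refine (continuousAt_const (y := (0 : ℂ))).congr ?_
    filter_upwards [Iio_mem_nhds h] with s hs
    simp [halfPow, not_le.2 (Set.mem_Iio.1 hs)]
  · have hc : ContinuousAt (fun t : ℝ => (t : ℂ) ^ r / (r.factorial : ℂ)) t :=
      Continuous.continuousAt (by fun_prop)
    refine hc.congr ?_
    filter_upwards [Ioi_mem_nhds h] with s hs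
    simp [halfPow, (Set.mem_Ioi.1 hs).le]

theorem continuousAt_invMono {a : StrongDual ℝ V}
    (ha : ∀ (σ : Fin (Module.finrank ℝ V) → Fin N) (hσ : IsBasisOf β σ)
      (l : Fin (Module.finrank ℝ V)), hσ.basis.repr a l ≠ 0) (m : MonoIdx β →₀ ℂ) :
    ContinuousAt (fun a => invMono Γ a m) a := by
  simp only [invMono, Finsupp.linearCombination_apply, Finsupp.sum]
  refine tendsto_finsetSum _ fun i _ => Tendsto.const_smul
    (?_ : ContinuousAt (fun a => monoInv Γ β a i) a) _
  unfold monoInv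
  split_ifs
  · refine continuousAt_const.mul (tendsto_finsetProd _ fun l _ => ?_)
    exact (continuousAt_halfPow _ (ha i.1.1 i.1.2 l)).comp
      (f := fun a => i.1.2.basis.repr a l) (i.1.2.continuous_repr l).continuousAt
  · exact continuousAt_const

/-- Injectivity of the Laplace transform: a relation between Laurent monomials with negative
exponents holds between their inverse Laplace transforms. -/
theorem invMono_eq_zero_of_neg (hhalf : ∃ v : V, ∀ i, 0 < β i v) {a : StrongDual ℝ V}
    (ha : ∀ (σ : Fin (Module.finrank ℝ V) → Fin N) (hσ : IsBasisOf β σ)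
      (l : Fin (Module.finrank ℝ V)), hσ.basis.repr a l ≠ 0) {m : MonoIdx β →₀ ℂ}
    (hneg : ∀ i ∈ m.support, ∀ l, i.2 l < 0) (hm : evalMono m = 0) : invMono Γ a m = 0 := by
  obtain ⟨v, hv⟩ := hhalf
  let ψ : EuclideanSpace ℝ (Fin (Module.finrank ℝ V)) → StrongDual ℝ V :=
    fun y => formOf Γ (WithLp.ofLp y)
  have hψc : Continuous ψ := by
    have h1 : Continuous (formOf Γ) := (formOf Γ).toLinearMap.continuous_of_finiteDimensional
    exact h1.comp (PiLp.continuous_ofLp 2 _)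
  let f : EuclideanSpace ℝ (Fin (Module.finrank ℝ V)) → ℂ :=
    fun y => invMono Γ (ψ y) m * Complex.exp (-(ψ y v : ℂ))
  have hemb := (MeasurableEquiv.toLp 2 (Fin (Module.finrank ℝ V) → ℝ)).symm.measurableEmbedding
  have hvp := EuclideanSpace.volume_preserving_symm_measurableEquiv_toLp (Fin (Module.finrank ℝ V))
  -- the point `v + 2πi ξ` of the tube
  let z : EuclideanSpace ℝ (Fin (Module.finrank ℝ V)) → ℂ ⊗[ℝ] V := fun ξ =>
    (1 : ℂ) ⊗ₜ[ℝ] v + (2 * Real.pi * Complex.I : ℂ) ⊗ₜ[ℝ] (∑ j, ξ j • latticeBasis Γ j)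
  have hzre : ∀ ξ i, (pair (β i) (z ξ)).re = β i v := by
    intro ξ i
    simp [z, -map_sum]
  have hzreg : ∀ ξ, z ξ ∈ regularPoints β := by
    intro ξ i h
    have h1 := hzre ξ i
    rw [h] at h1
    exact (hv i).ne h1
  have hpair : ∀ (y ξ : EuclideanSpace ℝ (Fin (Module.finrank ℝ V))),
      pair (ψ y) (z ξ) = (ψ y v : ℂ) + 2 * Real.pi * Complex.I * (inner ℝ y ξ : ℝ) := by
    intro y ξ
    have h1 : ψ y (∑ j, ξ j • latticeBasis Γ j) = inner ℝ y ξ := by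
      simp [ψ, PiLp.inner_apply]
    simp only [z, map_add, pair_tmul, one_mul, h1]
  have hlap : ∀ ξ, Integrable (fun y => invMono Γ (ψ y) m * Complex.exp (-pair (ψ y) (z ξ))) ∧
      ∫ y, invMono Γ (ψ y) m * Complex.exp (-pair (ψ y) (z ξ)) = 0 := by
    intro ξ
    have h1 : ∀ i ∈ m.support, _ := fun i hi => laplace_monoInv Γ i (hneg i hi) ⟨z ξ, hzreg ξ⟩
      (fun j => by rw [hzre]; exact hv j)
    have h2 : ∀ y : Fin (Module.finrank ℝ V) → ℝ,
        invMono Γ (formOf Γ y) m * Complex.exp (-pair (formOf Γ y) (z ξ)) =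
        ∑ i ∈ m.support, m i * (monoInv Γ β (formOf Γ y) i *
          Complex.exp (-pair (formOf Γ y) (z ξ))) := by
      intro y
      rw [invMono, Finsupp.linearCombination_apply, Finsupp.sum, Finset.sum_mul]
      exact Finset.sum_congr rfl fun i _ => by rw [smul_eq_mul]; ring
    have h3 : Integrable fun y : Fin (Module.finrank ℝ V) → ℝ =>
        invMono Γ (formOf Γ y) m * Complex.exp (-pair (formOf Γ y) (z ξ)) := by
      simp only [h2]
      exact integrable_finsetSum _ fun i hi => (h1 i hi).1.const_mul _
    have h4 : ∫ y : Fin (Module.finrank ℝ V) → ℝ,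
        invMono Γ (formOf Γ y) m * Complex.exp (-pair (formOf Γ y) (z ξ)) = 0 := by
      simp only [h2]
      rw [integral_finsetSum _ fun i hi => (h1 i hi).1.const_mul _]
      have h5 := congrFun hm ⟨z ξ, hzreg ξ⟩
      rw [evalMono_apply] at h5
      rw [Pi.zero_apply] at h5
      rw [← h5]
      refine Finset.sum_congr rfl fun i hi => ?_
      rw [integral_const_mul, (h1 i hi).2]
    exact ⟨(hvp.integrable_comp_emb hemb).2 h3, (hvp.integral_comp hemb _).trans h4⟩
  have hfint : Integrable f := by
    refine (hlap 0).1.congr (Eventually.of_forall fun y => ?_)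
    simp [hpair, f]
  have hfour : FourierTransform.fourier f = 0 := by
    ext ξ
    rw [Real.fourier_eq', Pi.zero_apply, ← (hlap ξ).2]
    congr 1
    ext y
    rw [hpair, smul_eq_mul]
    simp only [f]
    rw [neg_add, Complex.exp_add]
    have : Complex.exp (((-2 * Real.pi * inner ℝ y ξ : ℝ) : ℂ) * Complex.I) =
        Complex.exp (-(2 * Real.pi * Complex.I * (inner ℝ y ξ : ℝ))) := by
      congr 1; push_cast; ring
    rw [this]; ring
  let y₀ : EuclideanSpace ℝ (Fin (Module.finrank ℝ V)) := WithLp.toLp 2 ((formOf Γ).symm a)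
  have hy₀ : ψ y₀ = a := by simp [ψ, y₀]
  have hcont : ContinuousAt f y₀ := by
    refine ContinuousAt.mul ?_ ?_
    · have h1 := continuousAt_invMono Γ ha m
      rw [← hy₀] at h1
      exact h1.comp hψc.continuousAt
    · have h2 : Continuous fun y => ψ y v := hψc.clm_apply continuous_const
      exact Continuous.continuousAt (by fun_prop)
  have hinv := hfint.fourierInv_fourier_eq (by rw [hfour]; exact integrable_zero _ _ _) hcont
  rw [hfour, Real.fourierInv_eq'] at hinv
  simp only [Pi.zero_apply, smul_zero, integral_zero] at hinv
  have := (mul_eq_zero.1 hinv.symm).resolve_right (Complex.exp_ne_zero _)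
  rwa [hy₀] at this

/-- A relation between Laurent monomials holds between their inverse Laplace transforms at generic
points. The monomials with nonnegative exponents are removed by derivatives, which act on the
inverse Laplace transforms by nonzero factors. -/
theorem invMono_eq_zero (hhalf : ∃ v : V, ∀ i, 0 < β i v) {a : StrongDual ℝ V}
    (ha : ∀ (σ : Fin (Module.finrank ℝ V) → Fin N) (hσ : IsBasisOf β σ)
      (l : Fin (Module.finrank ℝ V)), hσ.basis.repr a l ≠ 0) {m : MonoIdx β →₀ ℂ}
    (hm : evalMono m = 0) : invMono Γ a m = 0 := by
  classical
  suffices H : ∀ (S : Finset ({σ : Fin (Module.finrank ℝ V) → Fin N // IsBasisOf β σ} ×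
      Fin (Module.finrank ℝ V))) (m : MonoIdx β →₀ ℂ), (∀ q ∉ S, m ∈ poleBounded q 0) →
      evalMono m = 0 → invMono Γ a m = 0 from H Finset.univ m (by simp) hm
  intro S
  induction S using Finset.induction_on with
  | empty =>
    intro m h0 hm
    refine invMono_eq_zero_of_neg Γ hhalf ha (fun i hi l => ?_) hm
    exact_mod_cast h0 (i.1, l) (Finset.notMem_empty _) hi rfl
  | insert q S hq ih =>
    intro m h0 hm
    obtain ⟨K, hK⟩ := exists_poleBounded q m
    have key : ∀ (K : ℕ) (m : MonoIdx β →₀ ℂ), m ∈ poleBounded q K →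
        (∀ q' ∉ insert q S, m ∈ poleBounded q' 0) → evalMono m = 0 → invMono Γ a m = 0 := by
      intro K
      induction K with
      | zero =>
        intro m hK h0 hm
        refine ih m (fun q' hq' => ?_) hm
        by_cases h : q' = q
        · rw [h]; exact hK
        · exact h0 q' (by simp [h, hq'])
      | succ K ihK =>
        intro m hK h0 hm
        have h1 := ihK _ (dirDeriv_dualVec_mem_poleBounded hK)
          (fun q' hq' => dirDeriv_mem_poleBounded (h0 q' hq') _) (evalMono_dirDeriv hm _)
        rw [invMono_dirDeriv, q.1.2.apply_dualVec] at h1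
        exact (mul_eq_zero.1 h1).resolve_left (by exact_mod_cast ha q.1.1 q.1.2 q.2)
    exact key K m hK h0 hm

open Classical in
/-- The value of the residue functional of the chamber `c` on a Laurent monomial. -/
def monoRes (c : Set (StrongDual ℝ V)) (i : MonoIdx β) : ℂ :=
  if i.2 = -1 ∧ c ⊆ cone (β ∘ i.1.1) then ((latticeVol Γ (β ∘ i.1.1) : ℝ) : ℂ)⁻¹ else 0

/-- At `t x`, with `x` in the chamber and `t → 0`, the inverse Laplace transform of a Laurent
monomial tends to its residue. -/
theorem tendsto_monoInv {c : Set (StrongDual ℝ V)} (hc : IsBigChamber β c) {x : StrongDual ℝ V}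
    (hx : x ∈ c) (i : MonoIdx β) :
    Tendsto (fun t : ℝ => monoInv Γ β (t • x) i) (𝓝[>] 0) (𝓝 (monoRes Γ c i)) := by
  classical
  have hscale : ∀ (r : ℕ) (s : ℝ) {t : ℝ}, 0 < t →
      halfPow r (t * s) = (t : ℂ) ^ r * halfPow r s := by
    intro r s t ht
    unfold halfPow
    simp only [mul_nonneg_iff_of_pos_left ht]
    split_ifs
    · push_cast; ring
    · simp
  by_cases hneg : ∀ l, i.2 l < 0
  · have h1 : ∀ᶠ t : ℝ in 𝓝[>] 0, ((latticeVol Γ (β ∘ i.1.1) : ℝ) : ℂ)⁻¹ *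
        ∏ l, ((t : ℂ) ^ (-i.2 l - 1).toNat * halfPow (-i.2 l - 1).toNat (i.1.2.basis.repr x l)) =
        monoInv Γ β (t • x) i := by
      filter_upwards [self_mem_nhdsWithin] with t ht
      rw [monoInv, if_pos hneg]
      congr 1
      refine Finset.prod_congr rfl fun l _ => ?_
      rw [map_smul, Finsupp.smul_apply, smul_eq_mul, hscale _ _ ht]
    refine Tendsto.congr' h1 ?_
    have h2 : Continuous fun t : ℝ => ((latticeVol Γ (β ∘ i.1.1) : ℝ) : ℂ)⁻¹ *
        ∏ l, ((t : ℂ) ^ (-i.2 l - 1).toNat *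
          halfPow (-i.2 l - 1).toNat (i.1.2.basis.repr x l)) := by fun_prop
    have h3 := (h2.tendsto 0).mono_left (nhdsWithin_le_nhds (s := Set.Ioi 0))
    convert h3 using 2
    rw [monoRes]
    by_cases hk : i.2 = -1
    · simp only [hk, true_and]
      rw [hc.subset_cone_iff i.1.2 hx, i.1.2.mem_cone_iff]
      by_cases hcone : ∀ l, 0 ≤ i.1.2.basis.repr x l
      · rw [if_pos hcone]
        simp [halfPow, hcone]
      · rw [if_neg hcone]
        push Not at hcone
        obtain ⟨l, hl⟩ := hcone
        rw [Finset.prod_eq_zero (Finset.mem_univ l), mul_zero]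
        simp [halfPow, not_le.2 hl]
    · rw [if_neg fun h => hk h.1]
      obtain ⟨l, hl⟩ : ∃ l, i.2 l ≠ -1 := by
        by_contra! h
        exact hk (funext h)
      rw [Finset.prod_eq_zero (Finset.mem_univ l), mul_zero]
      have := hneg l
      rw [Complex.ofReal_zero, zero_pow (by omega), zero_mul]
  · have h1 : ∀ a, monoInv Γ β a i = 0 := fun a => if_neg hneg
    have h2 : monoRes Γ c i = 0 := by
      refine if_neg fun h => hneg fun l => ?_
      rw [h.1]; simp
    simp only [h1, h2]
    exact tendsto_const_nhds

/-- The residue functional: the linear functional on functions which takes the value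
`1 / vol(σ)` on `f_σ` if `c ⊆ C(σ)`, and vanishes on the other Laurent monomials. -/
theorem exists_residueFunctional (hhalf : ∃ v : V, ∀ i, 0 < β i v) {c : Set (StrongDual ℝ V)}
    (hc : IsBigChamber β c) :
    ∃ ℓ : (regularPoints β → ℂ) →ₗ[ℂ] ℂ, ∀ i : MonoIdx β, ℓ (mono β i.1 i.2) = monoRes Γ c i := by
  let ρ : (MonoIdx β →₀ ℂ) →ₗ[ℂ] ℂ := Finsupp.linearCombination ℂ (monoRes Γ c)
  have hker : LinearMap.ker (evalMono (β := β)) ≤ LinearMap.ker ρ := by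
    intro m hm
    rw [LinearMap.mem_ker] at hm ⊢
    obtain ⟨x, hx, hgen⟩ := hc.exists_generic
    have h1 : Tendsto (fun t : ℝ => invMono Γ (t • x) m) (𝓝[>] 0) (𝓝 (ρ m)) := by
      simp only [invMono, ρ, Finsupp.linearCombination_apply, Finsupp.sum]
      exact tendsto_finsetSum _ fun i _ => (tendsto_monoInv Γ hc hx i).const_smul _
    have h2 : ∀ᶠ t in 𝓝[>] (0 : ℝ), (0 : ℂ) = invMono Γ (t • x) m := by
      filter_upwards [self_mem_nhdsWithin] with t ht
      refine (invMono_eq_zero Γ hhalf (fun σ hσ l => ?_) hm).symm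
      rw [map_smul, Finsupp.smul_apply, smul_eq_mul]
      exact mul_ne_zero (ne_of_gt ht) (hgen σ hσ l)
    exact tendsto_nhds_unique (tendsto_const_nhds.congr' h2) h1 |>.symm
  let g : LinearMap.range (evalMono (β := β)) →ₗ[ℂ] ℂ :=
    ((LinearMap.ker evalMono).liftQ ρ hker) ∘ₗ
      (LinearMap.quotKerEquivRange evalMono).symm.toLinearMap
  obtain ⟨ℓ, hℓ⟩ := LinearMap.exists_extend g
  refine ⟨ℓ, fun i => ?_⟩
  have h1 : mono β i.1 i.2 = evalMono (Finsupp.single i (1 : ℂ)) := by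
    rw [evalMono_single, one_smul]
  have h2 := LinearMap.congr_fun hℓ (LinearMap.quotKerEquivRange evalMono
    (Submodule.Quotient.mk (Finsupp.single i (1 : ℂ))))
  rw [LinearMap.comp_apply, LinearMap.comp_apply, LinearEquiv.coe_coe,
    LinearEquiv.symm_apply_apply] at h2
  rw [h1]
  refine h2.trans ?_
  rw [Submodule.liftQ_apply]
  simp [ρ]

variable {Γ}

/-- The functional kills the derivatives of the members of `R_A`. -/
theorem residueFunctional_derivSpace (hspan : Submodule.span ℝ (Set.range β) = ⊤)
    {c : Set (StrongDual ℝ V)} {ℓ : (regularPoints β → ℂ) →ₗ[ℂ] ℂ}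
    (hℓ : ∀ i : MonoIdx β, ℓ (mono β i.1 i.2) = monoRes Γ c i) {g : regularPoints β → ℂ}
    (hg : g ∈ derivSpace β) : ℓ g = 0 := by
  rw [← LinearMap.mem_ker]
  refine Submodule.span_le.2 ?_ hg
  rintro g ⟨v, f, hf, hder⟩
  rw [← polarRing_univ] at hf
  have hmem : (fun z : regularPoints β => f z) ∈ LinearMap.range (evalMono (β := β)) := by
    refine Submodule.span_le.2 ?_ (polarRing_le_monoSpan hspan hf)
    rintro _ ⟨σ, k, hσ, -, rfl⟩
    exact ⟨Finsupp.single (⟨σ, hσ⟩, k) 1, by rw [evalMono_single, one_smul]⟩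
  obtain ⟨m, hm⟩ := hmem
  have h1 : g = ∑ i ∈ m.support, m i • ∑ l, ((i.2 l : ℂ) * pair (β (i.1.1 l)) v) •
      mono β i.1 (i.2 - Pi.single l 1) := by
    ext z
    rw [HasDerivAt.unique (hder z) (hasLineDerivAt_evalMono hm.symm v z)]
    simp
  rw [SetLike.mem_coe, LinearMap.mem_ker, h1, map_sum]
  refine Finset.sum_eq_zero fun i _ => ?_
  rw [map_smul, map_sum, Finset.sum_eq_zero, smul_zero]
  intro l _
  rw [map_smul, hℓ (i.1, i.2 - Pi.single l 1)]
  by_cases h : i.2 l = 0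
  · simp [h]
  · rw [monoRes, if_neg, smul_zero]
    rintro ⟨h2, -⟩
    have := congrFun h2 l
    simp at this
    omega

/-- A Laurent monomial is a simple fraction or a derivative. -/
theorem mono_mem_derivSpace {i : MonoIdx β} (hi : i.2 ≠ -1) : mono β i.1 i.2 ∈ derivSpace β := by
  obtain ⟨⟨σ, hσ⟩, k⟩ := i
  obtain ⟨l, hl⟩ : ∃ l, k l ≠ -1 := by
    by_contra! h
    exact hi (funext h)
  have hkl : (k l : ℂ) + 1 ≠ 0 := by
    intro h
    exact hl (by have : ((k l + 1 : ℤ) : ℂ) = 0 := by push_cast; exact h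
                 have := Int.cast_eq_zero.1 this
                 omega)
  have h1 : mono β σ k = ((k l : ℂ) + 1)⁻¹ • (((k l : ℂ) + 1) • mono β σ k) := by
    rw [smul_smul, inv_mul_cancel₀ hkl, one_smul]
  rw [h1]
  refine Submodule.smul_mem _ _ (Submodule.subset_span ⟨1 ⊗ₜ[ℝ] hσ.dualVec l,
    fun u => ∏ j, pair (β (σ j)) u ^ (k + Pi.single l 1 : Fin (Module.finrank ℝ V) → ℤ) j,
    mono_mem_ratRing σ (k + Pi.single l 1), fun z => ?_⟩)
  refine (hasDerivAt_mono_line σ (k + Pi.single l 1) z _).congr_deriv ?_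
  rw [Finset.sum_eq_single l]
  · simp [hσ.apply_dualVec, hσ.repr_self]
  · intro j _ hj
    simp [hσ.apply_dualVec, hσ.repr_self, hj]
  · simp

/-- Every element of the ring `R_A` has a total residue, by partial fractions: a monomial in a basis
is a simple fraction or a directional derivative. -/
theorem exists_totalResidue (hspan : Submodule.span ℝ (Set.range β) = ⊤)
    {f : regularPoints β → ℂ} (hf : f ∈ ratRing β) :
    ∃ s : simpleSpace β, f - (s : regularPoints β → ℂ) ∈ derivSpace β := by
  rw [← polarRing_univ] at hf
  have h1 : f ∈ simpleSpace β ⊔ derivSpace β := by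
    refine Submodule.span_le.2 ?_ (polarRing_le_monoSpan hspan hf)
    rintro _ ⟨σ, k, hσ, -, rfl⟩
    by_cases hk : k = -1
    · refine Submodule.mem_sup_left ?_
      rw [hk, mono_neg_one]
      exact simpleFraction_mem hσ
    · exact Submodule.mem_sup_right (mono_mem_derivSpace (i := (⟨σ, hσ⟩, k)) hk)
  obtain ⟨s, hs, d, hd, rfl⟩ := Submodule.mem_sup.1 h1
  exact ⟨⟨s, hs⟩, by simpa using hd⟩

/-- On `R_A` the residue functional is the Jeffrey-Kirwan residue of the total residue. -/
theorem jkResidue_totalResidue (hspan : Submodule.span ℝ (Set.range β) = ⊤)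
    {c : Set (StrongDual ℝ V)} (hc : IsBigChamber β c) {ℓ : (regularPoints β → ℂ) →ₗ[ℂ] ℂ}
    (hℓ : ∀ i : MonoIdx β, ℓ (mono β i.1 i.2) = monoRes Γ c i)
    {f : regularPoints β → ℂ} (hf : f ∈ ratRing β) :
    jkResidue Γ β c (totalResidue β f) = ℓ f := by
  classical
  have hval : ∀ (σ : Fin (Module.finrank ℝ V) → Fin N) (hσ : IsBasisOf β σ),
      ℓ (simpleFraction β σ) =
        if c ⊆ cone (β ∘ σ) then ((latticeVol Γ (β ∘ σ) : ℝ) : ℂ)⁻¹ else 0 := by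
    intro σ hσ
    rw [← mono_neg_one, hℓ (⟨σ, hσ⟩, -1), monoRes]
    simp
  obtain ⟨x, hx⟩ := hc.nonempty
  have hJ : ∃ J : simpleSpace β →ₗ[ℂ] ℂ, ∀ (σ : _) (hσ : IsBasisOf β σ),
      (c ⊆ cone (β ∘ σ) →
        J ⟨simpleFraction β σ, simpleFraction_mem hσ⟩ = ((latticeVol Γ (β ∘ σ) : ℝ) : ℂ)⁻¹) ∧
      (c ∩ cone (β ∘ σ) = ∅ → J ⟨simpleFraction β σ, simpleFraction_mem hσ⟩ = 0) := by
    refine ⟨ℓ ∘ₗ (simpleSpace β).subtype, fun σ hσ => ⟨fun h => ?_, fun h => ?_⟩⟩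
    · simp [hval σ hσ, h]
    · have h2 : ¬ c ⊆ cone (β ∘ σ) := fun h3 => by
        have : x ∈ c ∩ cone (β ∘ σ) := ⟨hx, h3 hx⟩
        rw [h] at this
        exact this
      simp [hval σ hσ, h2]
  have hjk : ∀ s : simpleSpace β, jkResidue Γ β c s = ℓ s := by
    rintro ⟨s, hs⟩
    rw [jkResidue, dif_pos hJ]
    have hspec := hJ.choose_spec
    set J := hJ.choose
    induction hs using Submodule.span_induction with
    | mem s h =>
      obtain ⟨σ, hσ, rfl⟩ := h
      change J ⟨simpleFraction β σ, simpleFraction_mem hσ⟩ = ℓ (simpleFraction β σ)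
      rw [hval σ hσ]
      split_ifs with h
      · exact (hspec σ hσ).1 h
      · refine (hspec σ hσ).2 (Set.eq_empty_of_forall_notMem fun y hy => h ?_)
        exact (hc.subset_cone_iff hσ hy.1).2 hy.2
    | zero => exact (map_zero J).trans (map_zero ℓ).symm
    | add s t hs ht h1 h2 =>
      exact (map_add J ⟨s, hs⟩ ⟨t, ht⟩).trans ((congrArg₂ (· + ·) h1 h2).trans (map_add ℓ s t).symm)
    | smul r s hs h1 =>
      exact (map_smul J r ⟨s, hs⟩).trans ((congrArg (r • ·) h1).trans (map_smul ℓ r s).symm)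
  have hex := exists_totalResidue hspan hf
  rw [hjk, totalResidue, dif_pos hex]
  have h1 := residueFunctional_derivSpace hspan hℓ hex.choose_spec
  rw [map_sub, sub_eq_zero] at h1
  exact h1.symm

end Relations
end VectorPartition
end

noncomputable section
namespace VectorPartition

/-! ### Partition counts and relations between generating functions -/

section Counting

variable {A : Type*} [AddCommGroup A] {N : ℕ}

/-- The number of solutions `x ∈ ℕ ^ N` of `∑ x_k γ_k = a`. -/
def solutionCount (γ : Fin N → A) (a : A) : ℕ := Set.ncard {x : Fin N → ℕ | ∑ k, x k • γ k = a}

/-- The denominator `∏ (1 - e^{γ_k})` of the generating function of the solution counts. -/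
def den (γ : Fin N → A) : AddMonoidAlgebra ℤ A := ∏ k, (1 - AddMonoidAlgebra.single (γ k) 1)

/-- The relation `1 / den γ = ∑_j c_j e^{δ_j} / den γ_j`, witnessed by a common denominator which
is a product of factors `1 - e^η`, `η ∈ S`. -/
def KernelRelation {J : Type*} (S : Set A) (γ : Fin N → A) (T : Finset J) (c : J → ℤ) (δ : J → A)
    (γ' : J → Fin N → A) : Prop :=
  ∃ (m : ℕ) (η : Fin m → A), (∀ k, η k ∈ S) ∧
    ∃ (R : AddMonoidAlgebra ℤ A) (R' : J → AddMonoidAlgebra ℤ A),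
      den γ * R = den η ∧ (∀ j ∈ T, den (γ' j) * R' j = den η) ∧
      R = ∑ j ∈ T, c j • (AddMonoidAlgebra.single (δ j) 1 * R' j)

/-- Translation of functions on `A`. -/
def shiftHom (A : Type*) [AddCommGroup A] : Multiplicative A →* Module.End ℤ (A → ℤ) where
  toFun g := LinearMap.funLeft ℤ ℤ fun a => a - g.toAdd
  map_one' := by ext f a; simp [LinearMap.funLeft_apply]
  map_mul' g h := by
    ext f a
    simp [LinearMap.funLeft_apply, sub_sub]

/-- The action of the group algebra on functions by translations. -/
def shiftAlg (A : Type*) [AddCommGroup A] : AddMonoidAlgebra ℤ A →ₐ[ℤ] Module.End ℤ (A → ℤ) :=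
  AddMonoidAlgebra.lift ℤ (Module.End ℤ (A → ℤ)) A (shiftHom A)

theorem shiftAlg_single (g : A) (f : A → ℤ) (a : A) :
    shiftAlg A (AddMonoidAlgebra.single g 1) f a = f (a - g) := by
  simp [shiftAlg, shiftHom, LinearMap.funLeft_apply]

/-- The function `f` vanishes where the height `v` is sufficiently negative. -/
def HalfBounded (v : A →+ ℝ) (f : A → ℤ) : Prop := ∃ C : ℝ, ∀ a, f a ≠ 0 → C ≤ v a

theorem HalfBounded.shift {v : A →+ ℝ} {f : A → ℤ} (hf : HalfBounded v f) (g : A) :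
    HalfBounded v fun a => f (a - g) := by
  obtain ⟨C, hC⟩ := hf
  refine ⟨C + v g, fun a ha => ?_⟩
  have := hC _ ha
  rw [map_sub] at this
  linarith

theorem HalfBounded.sub {v : A →+ ℝ} {f g : A → ℤ} (hf : HalfBounded v f) (hg : HalfBounded v g) :
    HalfBounded v (f - g) := by
  obtain ⟨C, hC⟩ := hf
  obtain ⟨D, hD⟩ := hg
  refine ⟨min C D, fun a ha => ?_⟩
  by_cases h : f a = 0
  · exact (min_le_right _ _).trans (hD a fun h' => ha (by simp [h, h']))
  · exact (min_le_left _ _).trans (hC a h)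

theorem HalfBounded.sum {J : Type*} {v : A →+ ℝ} (T : Finset J) (c : J → ℤ) {f : J → A → ℤ}
    (hf : ∀ j ∈ T, HalfBounded v (f j)) : HalfBounded v (∑ j ∈ T, c j • f j) := by
  classical
  induction T using Finset.induction_on with
  | empty => exact ⟨0, fun a ha => absurd rfl ha⟩
  | insert j T hj ih =>
    rw [Finset.sum_insert hj]
    obtain ⟨C, hC⟩ := hf j (Finset.mem_insert_self _ _)
    obtain ⟨D, hD⟩ := ih fun i hi => hf i (Finset.mem_insert_of_mem hi)
    refine ⟨min C D, fun a ha => ?_⟩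
    by_cases h : f j a = 0
    · exact (min_le_right _ _).trans (hD a fun h' => ha (by
        rw [Pi.add_apply, h', Pi.smul_apply, h]; simp))
    · exact (min_le_left _ _).trans (hC a h)

theorem HalfBounded.eq_zero_of_invariant {v : A →+ ℝ} {f : A → ℤ} (hf : HalfBounded v f) {g : A}
    (hg : 0 < v g) (h : ∀ a, f a = f (a - g)) : f = 0 := by
  obtain ⟨C, hC⟩ := hf
  ext a
  by_contra hne
  have h1 : ∀ m : ℕ, f (a - m • g) = f a := by
    intro m
    induction m with
    | zero => simp
    | succ m ih => rw [← ih, h (a - m • g), succ_nsmul, sub_sub]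
  obtain ⟨m, hm⟩ := exists_nat_gt ((v a - C) / v g)
  have h2 := hC (a - m • g) (by rw [h1]; exact hne)
  rw [map_sub, map_nsmul, nsmul_eq_mul] at h2
  rw [div_lt_iff₀ hg] at hm
  linarith

theorem shiftAlg_one_sub (g : A) (f : A → ℤ) :
    shiftAlg A (1 - AddMonoidAlgebra.single g 1) f = f - fun a => f (a - g) := by
  ext a
  rw [map_sub, map_one, LinearMap.sub_apply, Pi.sub_apply, shiftAlg_single]
  rfl

/-- Multiplication by `1 - e^g` with `g` of positive height is injective on half-bounded
functions. -/
theorem HalfBounded.eq_zero_of_den {v : A →+ ℝ} {m : ℕ} {η : Fin m → A} (hη : ∀ k, 0 < v (η k))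
    {f : A → ℤ} (hf : HalfBounded v f) (h : shiftAlg A (den η) f = 0) : f = 0 := by
  classical
  suffices H : ∀ (s : Finset (Fin m)) (f : A → ℤ), HalfBounded v f →
      shiftAlg A (∏ k ∈ s, (1 - AddMonoidAlgebra.single (η k) 1)) f = 0 → f = 0 from
    H Finset.univ f hf h
  intro s
  induction s using Finset.induction_on with
  | empty => intro f _ h; simpa using h
  | insert k s hk ih =>
    intro f hf h
    rw [Finset.prod_insert hk, mul_comm, map_mul, Module.End.mul_apply, shiftAlg_one_sub] at h
    have h1 := ih _ (hf.sub (hf.shift (η k))) h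
    refine hf.eq_zero_of_invariant (hη k) fun a => ?_
    have := congrFun h1 a
    exact sub_eq_zero.1 this

theorem finite_solutions {v : A →+ ℝ} {γ : Fin N → A} (hγ : ∀ k, 0 < v (γ k)) (a : A) :
    {x : Fin N → ℕ | ∑ k, x k • γ k = a}.Finite := by
  refine (Set.Finite.pi (t := fun k => Set.Iic ⌊v a / v (γ k)⌋₊)
    fun k => Set.finite_Iic _).subset fun x hx k _ => ?_
  have h1 : v a = ∑ j, (x j : ℝ) * v (γ j) := by
    rw [← (hx : ∑ k, x k • γ k = a), map_sum]
    simp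
  have h2 : (x k : ℝ) * v (γ k) ≤ v a := by
    rw [h1]
    exact Finset.single_le_sum (f := fun j => (x j : ℝ) * v (γ j))
      (fun j _ => mul_nonneg (Nat.cast_nonneg _) (hγ j).le) (Finset.mem_univ k)
  exact Nat.le_floor ((le_div_iff₀ (hγ k)).2 h2)

theorem halfBounded_solutionCount {v : A →+ ℝ} {γ : Fin N → A} (hγ : ∀ k, 0 < v (γ k)) :
    HalfBounded v fun a => (solutionCount γ a : ℤ) := by
  refine ⟨0, fun a ha => ?_⟩
  have h1 : {x : Fin N → ℕ | ∑ k, x k • γ k = a}.Nonempty := by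
    by_contra h
    rw [Set.not_nonempty_iff_eq_empty] at h
    exact ha (by simp [solutionCount, h])
  obtain ⟨x, hx⟩ := h1
  rw [← (hx : ∑ k, x k • γ k = a), map_sum]
  refine Finset.sum_nonneg fun k _ => ?_
  rw [map_nsmul]
  exact nsmul_nonneg (hγ k).le _

/-- The generating function of the solution counts is `1 / den γ`. -/
theorem den_solutionCount {v : A →+ ℝ} {γ : Fin N → A} (hγ : ∀ k, 0 < v (γ k)) :
    shiftAlg A (den γ) (fun a => (solutionCount γ a : ℤ)) = ({0} : Set A).indicator 1 := by
  classical
  let cnt : Finset (Fin N) → A → ℤ := fun s a =>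
    (Set.ncard {x : Fin N → ℕ | ∑ k, x k • γ k = a ∧ ∀ k ∈ s, x k = 0} : ℤ)
  have hfin : ∀ (s : Finset (Fin N)) (a : A),
      {x : Fin N → ℕ | ∑ k, x k • γ k = a ∧ ∀ k ∈ s, x k = 0}.Finite :=
    fun s a => (finite_solutions hγ a).subset fun x hx => hx.1
  have hrec : ∀ (s : Finset (Fin N)) (k : Fin N), k ∉ s → ∀ a,
      cnt s a = cnt (insert k s) a + cnt s (a - γ k) := by
    intro s k hk a
    have hinj : Function.Injective fun x : Fin N → ℕ => x + Pi.single k 1 :=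
      add_left_injective _
    have h1 : {x : Fin N → ℕ | ∑ j, x j • γ j = a ∧ ∀ j ∈ s, x j = 0} =
        {x : Fin N → ℕ | ∑ j, x j • γ j = a ∧ ∀ j ∈ insert k s, x j = 0} ∪
        (fun x : Fin N → ℕ => x + Pi.single k 1) ''
          {x : Fin N → ℕ | ∑ j, x j • γ j = a - γ k ∧ ∀ j ∈ s, x j = 0} := by
      have hsum : ∀ x : Fin N → ℕ, ∑ j, (x + Pi.single k 1 : Fin N → ℕ) j • γ j =
          ∑ j, x j • γ j + γ k := by
        intro x
        simp only [Pi.add_apply, add_smul, Finset.sum_add_distrib]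
        congr 1
        rw [Finset.sum_eq_single k] <;> simp +contextual
      ext x
      constructor
      · rintro ⟨hx, hs⟩
        by_cases h0 : x k = 0
        · refine Or.inl ⟨hx, fun j hj => ?_⟩
          rcases Finset.mem_insert.1 hj with rfl | hj
          exacts [h0, hs j hj]
        · have hxk : x = (x - Pi.single k 1) + Pi.single k 1 := by
            ext j
            by_cases hj : j = k
            · subst hj; simp; omega
            · simp [hj]
          refine Or.inr ⟨x - Pi.single k 1, ⟨?_, fun j hj => ?_⟩, hxk.symm⟩
          · rw [eq_sub_iff_add_eq, ← hsum, ← hxk, hx]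
          · simp [hs j hj]
      · rintro (⟨hx, hs⟩ | ⟨x, ⟨hx, hs⟩, rfl⟩)
        · exact ⟨hx, fun j hj => hs j (Finset.mem_insert_of_mem hj)⟩
        · refine ⟨?_, fun j hj => ?_⟩
          · dsimp only
            rw [hsum, hx, sub_add_cancel]
          · have : j ≠ k := by rintro rfl; exact hk hj
            simp [hs j hj, this]
    have hdisj : Disjoint {x : Fin N → ℕ | ∑ j, x j • γ j = a ∧ ∀ j ∈ insert k s, x j = 0}
        ((fun x : Fin N → ℕ => x + Pi.single k 1) ''
          {x : Fin N → ℕ | ∑ j, x j • γ j = a - γ k ∧ ∀ j ∈ s, x j = 0}) := by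
      rw [Set.disjoint_left]
      rintro _ ⟨-, h⟩ ⟨x, -, rfl⟩
      have := h k (Finset.mem_insert_self _ _)
      simp at this
    simp only [cnt]
    rw [h1, Set.ncard_union_eq hdisj (hfin _ _) ((hfin _ _).image _),
      Set.ncard_image_of_injective _ hinj]
    push_cast
    rfl
  have key : ∀ s : Finset (Fin N),
      shiftAlg A (∏ k ∈ s, (1 - AddMonoidAlgebra.single (γ k) 1)) (cnt ∅) = cnt s := by
    intro s
    induction s using Finset.induction_on with
    | empty => simp
    | insert k s hk ih =>
      rw [Finset.prod_insert hk, map_mul, Module.End.mul_apply, ih, shiftAlg_one_sub]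
      ext a
      rw [Pi.sub_apply, hrec s k hk a]
      ring
  have h0 : cnt ∅ = fun a => (solutionCount γ a : ℤ) := by
    ext a; simp [cnt, solutionCount]
  rw [den, ← h0, key]
  ext a
  simp only [cnt]
  by_cases ha : a = 0
  · have : {x : Fin N → ℕ | ∑ k, x k • γ k = a ∧ ∀ k ∈ Finset.univ, x k = 0} = {0} := by
      ext x
      constructor
      · rintro ⟨-, h⟩; ext k; exact h k (Finset.mem_univ k)
      · rintro rfl; simp [ha]
    rw [this, ha]
    simp
  · have : {x : Fin N → ℕ | ∑ k, x k • γ k = a ∧ ∀ k ∈ Finset.univ, x k = 0} = ∅ := by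
      refine Set.eq_empty_of_forall_notMem ?_
      rintro x ⟨h, h'⟩
      refine ha ?_
      rw [← h]
      exact Finset.sum_eq_zero fun k hk => by rw [h' k hk, zero_smul]
    rw [this]
    simp [ha]

/-- A relation between generating functions, read off coefficientwise. -/
theorem KernelRelation.solutionCount_eq {J : Type*} {S : Set A} {γ : Fin N → A} {T : Finset J}
    {c : J → ℤ} {δ : J → A} {γ' : J → Fin N → A} (h : KernelRelation S γ T c δ γ')
    {v : A →+ ℝ} (hS : ∀ a ∈ S, 0 < v a) (hγ : ∀ k, 0 < v (γ k))
    (hγ' : ∀ j ∈ T, ∀ k, 0 < v (γ' j k)) (a : A) :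
    (solutionCount γ a : ℤ) = ∑ j ∈ T, c j * solutionCount (γ' j) (a - δ j) := by
  obtain ⟨m, η, hη, R, R', h1, h2, h3⟩ := h
  let f : A → ℤ := (fun a => (solutionCount γ a : ℤ)) -
    ∑ j ∈ T, c j • fun a => (solutionCount (γ' j) (a - δ j) : ℤ)
  have hf : HalfBounded v f := (halfBounded_solutionCount hγ).sub
    (HalfBounded.sum T c fun j hj => (halfBounded_solutionCount (hγ' j hj)).shift (δ j))
  have hshift : ∀ j, (fun a => (solutionCount (γ' j) (a - δ j) : ℤ)) =
      shiftAlg A (AddMonoidAlgebra.single (δ j) 1) fun a => (solutionCount (γ' j) a : ℤ) := by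
    intro j; ext a; rw [shiftAlg_single]
  have h6 : shiftAlg A (den η) (fun a => (solutionCount γ a : ℤ)) =
      shiftAlg A R (({0} : Set A).indicator 1) := by
    rw [← h1, mul_comm, map_mul, Module.End.mul_apply, den_solutionCount hγ]
  have h7 : ∀ j ∈ T, shiftAlg A (den η) (c j • fun a => (solutionCount (γ' j) (a - δ j) : ℤ)) =
      shiftAlg A (c j • (AddMonoidAlgebra.single (δ j) 1 * R' j)) (({0} : Set A).indicator 1) := by
    intro j hj
    have h5 : den η * AddMonoidAlgebra.single (δ j) 1 =
        AddMonoidAlgebra.single (δ j) 1 * R' j * den (γ' j) := by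
      rw [← h2 j hj]; ring
    rw [map_smul, hshift, ← Module.End.mul_apply, ← map_mul, h5, map_mul, Module.End.mul_apply,
      den_solutionCount (hγ' j hj), map_smul, LinearMap.smul_apply]
  have h0 : shiftAlg A (den η) f = 0 := by
    simp only [f]
    rw [map_sub, map_sum, h6, Finset.sum_congr rfl h7, h3, map_sum, LinearMap.sum_apply, sub_self]
  have h4 := congrFun (hf.eq_zero_of_den (fun k => hS _ (hη k)) h0) a
  simp only [f, Pi.sub_apply, Pi.zero_apply, Finset.sum_apply, Pi.smul_apply, smul_eq_mul] at h4
  exact sub_eq_zero.1 h4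

/-- Clearing denominators: `1 / (1 - e^γ) = (1 + e^γ + ⋯ + e^{(M-1)γ}) / (1 - e^{Mγ})`. -/
theorem kernelRelation_scale {S : Set A} {γ : Fin N → A} {M : Fin N → ℕ}
    (hS : ∀ k, M k • γ k ∈ S) :
    KernelRelation S γ (Fintype.piFinset fun k => Finset.range (M k)) (fun _ => 1)
      (fun r => ∑ k, r k • γ k) (fun _ k => M k • γ k) := by
  refine ⟨N, fun k => M k • γ k, hS,
    ∏ k, ∑ r ∈ Finset.range (M k), AddMonoidAlgebra.single (γ k) 1 ^ r, fun _ => 1, ?_, ?_, ?_⟩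
  · rw [den, den, ← Finset.prod_mul_distrib]
    refine Finset.prod_congr rfl fun k _ => ?_
    rw [mul_neg_geom_sum, AddMonoidAlgebra.single_pow, one_pow]
  · intro j _; rw [mul_one]
  · rw [Finset.prod_univ_sum]
    refine Finset.sum_congr rfl fun r _ => ?_
    rw [one_smul, mul_one]
    simp only [AddMonoidAlgebra.single_pow, one_pow]
    exact
      (map_prod (AddMonoidAlgebra.of ℤ A) (fun k => Multiplicative.ofAdd (r k • γ k)) _).symm.trans
      (by rw [← ofAdd_sum]; rfl)

/-- A finite set ordered by a function `τ`, with ties broken in some way: `P j` is the set of the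
elements before `j`. -/
theorem exists_ordering {ι : Type*} [DecidableEq ι] (R : Type*) [CommRing R] (s : Finset ι)
    (τ : ι → ℝ) :
    ∃ P : ι → Finset ι, (∀ j ∈ s, P j ⊆ s ∧ j ∉ P j ∧ (∀ k ∈ P j, τ k ≤ τ j) ∧
      ∀ k ∈ s, k ∉ P j → τ j ≤ τ k) ∧
      ∀ w : ι → R, 1 - ∏ k ∈ s, w k = ∑ j ∈ s, (∏ k ∈ P j, w k) * (1 - w j) := by
  induction s using Finset.induction_on_max_value τ with
  | empty => exact ⟨fun _ => ∅, by simp, by simp⟩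
  | insert a s ha hmax ih =>
    obtain ⟨P, hP, hw⟩ := ih
    have hne : ∀ j ∈ s, j ≠ a := fun j hj h => ha (h ▸ hj)
    refine ⟨fun j => if j = a then s else P j, fun j hj => ?_, fun w => ?_⟩
    · rcases Finset.mem_insert.1 hj with rfl | hj'
      · simp only [if_true]
        refine ⟨Finset.subset_insert _ _, ha, hmax, fun k hk hks => ?_⟩
        rcases Finset.mem_insert.1 hk with rfl | hk
        exacts [le_rfl, absurd hk hks]
      · simp only [if_neg (hne j hj')]
        obtain ⟨h1, h2, h3, h4⟩ := hP j hj'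
        refine ⟨h1.trans (Finset.subset_insert _ _), h2, h3, fun k hk hks => ?_⟩
        rcases Finset.mem_insert.1 hk with rfl | hk'
        exacts [hmax j hj', h4 k hk' hks]
    · dsimp only
      rw [Finset.sum_insert ha, Finset.prod_insert ha, if_pos rfl,
        Finset.sum_congr rfl fun j hj => by rw [if_neg (hne j hj)], ← hw]
      ring

/-- Let `γ_{k₀} + ∑_{k ∈ s} ε_k γ_k = 0` with signs `ε_k`. The vectors `γ_k`, `k ∈ s`, can be
replaced one at a time with `γ_{k₀}`. This is the telescoping sum
`1 - e^{γ_{k₀}} = ∑_j (∏_{k ∈ P j} e^{-ε_k γ_k}) (1 - e^{-ε_j γ_j})`. -/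
theorem kernelRelation_exchange {S : Set A} {γ : Fin N → A} (hS : ∀ k, γ k ∈ S) {k₀ : Fin N}
    {s : Finset (Fin N)} {ε : Fin N → ℤ} (hε : ∀ k ∈ s, ε k = 1 ∨ ε k = -1)
    (hrel : γ k₀ + ∑ k ∈ s, ε k • γ k = 0) {P : Fin N → Finset (Fin N)}
    (hP : ∀ w : Fin N → AddMonoidAlgebra ℤ A,
      1 - ∏ k ∈ s, w k = ∑ j ∈ s, (∏ k ∈ P j, w k) * (1 - w j)) :
    KernelRelation S γ s (fun j => -ε j)
      (fun j => -∑ k ∈ P j, ε k • γ k - if ε j = 1 then γ j else 0)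
      (fun j => Function.update γ j (γ k₀)) := by
  have hprod : ∀ (t : Finset (Fin N)) (f : Fin N → A),
      ∏ k ∈ t, (AddMonoidAlgebra.single (f k) 1 : AddMonoidAlgebra ℤ A) =
        AddMonoidAlgebra.single (∑ k ∈ t, f k) 1 := fun t f =>
    (map_prod (AddMonoidAlgebra.of ℤ A) (fun k => Multiplicative.ofAdd (f k)) _).symm.trans
      (by rw [← ofAdd_sum]; rfl)
  refine ⟨N + 1, Fin.cons (γ k₀) γ, Fin.cases (hS k₀) hS,
    1 - AddMonoidAlgebra.single (γ k₀) 1, fun j => 1 - AddMonoidAlgebra.single (γ j) 1, ?_, ?_, ?_⟩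
  · simp [den, Fin.prod_univ_succ, mul_comm]
  · intro j _
    have h1 : den (Function.update γ j (γ k₀)) = (1 - AddMonoidAlgebra.single (γ k₀) 1) *
        ∏ k ∈ Finset.univ.erase j, (1 - AddMonoidAlgebra.single (γ k) 1) := by
      rw [den, ← Finset.mul_prod_erase _ _ (Finset.mem_univ j), Function.update_self]
      congr 1
      exact Finset.prod_congr rfl fun k hk => by
        rw [Function.update_of_ne (Finset.ne_of_mem_erase hk)]
    rw [h1, mul_assoc, mul_comm (∏ k ∈ Finset.univ.erase j, _),
      Finset.mul_prod_erase Finset.univ (fun k => 1 - AddMonoidAlgebra.single (γ k) (1 : ℤ))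
        (Finset.mem_univ j)]
    simp [den, Fin.prod_univ_succ]
  · have h1 := hP fun k => AddMonoidAlgebra.single (-(ε k • γ k)) 1
    simp only [hprod, Finset.sum_neg_distrib] at h1
    rw [← eq_neg_iff_add_eq_zero.2 hrel] at h1
    rw [h1]
    refine Finset.sum_congr rfl fun j hj => ?_
    rcases hε j hj with h | h
    · simp only [h, if_true, one_smul, neg_smul]
      have h2 : (AddMonoidAlgebra.single (-∑ k ∈ P j, ε k • γ k - γ j) 1 : AddMonoidAlgebra ℤ A) =
          AddMonoidAlgebra.single (-∑ k ∈ P j, ε k • γ k) 1 *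
            AddMonoidAlgebra.single (-γ j) 1 := by
        rw [AddMonoidAlgebra.single_mul_single, mul_one, sub_eq_add_neg]
      have h3 : (AddMonoidAlgebra.single (-γ j) 1 * AddMonoidAlgebra.single (γ j) 1 :
          AddMonoidAlgebra ℤ A) = 1 := by
        rw [AddMonoidAlgebra.single_mul_single, neg_add_cancel, mul_one, AddMonoidAlgebra.one_def]
      rw [h2]
      linear_combination -AddMonoidAlgebra.single (-∑ k ∈ P j, ε k • γ k) 1 * h3
    · simp [h]

end Counting
end VectorPartition
end

noncomputable section
namespace VectorPartition

/-! ### Kernels twisted by characters -/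

section Kernels

variable {V : Type*} [NormedAddCommGroup V] [NormedSpace ℝ V] [FiniteDimensional ℝ V]
variable {Γ : Submodule ℤ V} {N : ℕ} {β : Fin N → StrongDual ℝ V}

theorem expSeries_add (a b : ℂ) : expSeries (a + b) = expSeries a * expSeries b := by
  rw [expSeries, expSeries, expSeries, ← map_mul, PowerSeries.exp_mul_exp_eq_exp_add]

theorem expSeries_zero : expSeries 0 = 1 := by
  rw [expSeries, PowerSeries.rescale_zero_apply]
  simp

/-- The exponential `e^{⟨a, z⟩}` times the inverse of the character `ψ` at `a`. -/
def charExp (ψ : AddChar (dualLattice Γ) ℂ) (z : ℂ ⊗[ℝ] V) (a : dualLattice Γ) :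
    LaurentSeries ℂ :=
  HahnSeries.C (ψ (-a)) * expSeries (pair (a : StrongDual ℝ V) z)

theorem charExp_zero (ψ : AddChar (dualLattice Γ) ℂ) (z : ℂ ⊗[ℝ] V) : charExp ψ z 0 = 1 := by
  have h : pair (0 : StrongDual ℝ V) z = 0 := by
    have := map_zero (pairing z)
    rwa [pairing_apply] at this
  rw [charExp, neg_zero, AddChar.map_zero_eq_one, map_one, one_mul, ZeroMemClass.coe_zero, h,
    expSeries_zero]

theorem charExp_add (ψ : AddChar (dualLattice Γ) ℂ) (z : ℂ ⊗[ℝ] V) (a b : dualLattice Γ) :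
    charExp ψ z (a + b) = charExp ψ z a * charExp ψ z b := by
  rw [charExp, charExp, charExp, neg_add, AddChar.map_add_eq_mul, map_mul, Submodule.coe_add,
    pair_add, expSeries_add]
  ring

theorem one_sub_C_mul_expSeries_ne_zero {u w : ℂ} (hu : u ≠ 0) (hw : w ≠ 0) :
    1 - HahnSeries.C u * expSeries w ≠ (0 : LaurentSeries ℂ) := by
  intro h
  have h1 := congrArg (fun s : LaurentSeries ℂ => s.coeff 1) h
  have h2 : (expSeries w).coeff 1 = w := by
    have := HahnSeries.ofPowerSeries_apply_coeff (Γ := ℤ)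
      (PowerSeries.rescale w (PowerSeries.exp ℂ)) 1
    simpa [expSeries, PowerSeries.coeff_rescale] using this
  have h3 : (1 : LaurentSeries ℂ).coeff 1 = 0 := by
    rw [HahnSeries.coeff_one]; simp
  simp only [HahnSeries.coeff_sub, HahnSeries.coeff_zero, HahnSeries.C_mul_eq_smul,
    HahnSeries.coeff_smul, h2, h3, smul_eq_mul, zero_sub, neg_eq_zero, mul_eq_zero] at h1
  exact h1.elim hu hw

/-- The kernel `e^{⟨a, z⟩} / ∏ (1 - e^{-⟨γ_k, z⟩})`, twisted by the character `ψ`, expanded along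
the line through `z`. -/
def charKernel (ψ : AddChar (dualLattice Γ) ℂ) (γ : Fin N → dualLattice Γ) (a : dualLattice Γ)
    (z : ℂ ⊗[ℝ] V) : LaurentSeries ℂ :=
  charExp ψ z a / ∏ k, (1 - charExp ψ z (-γ k))

/-- The specialization `e^g ↦ e^{-⟨g, z⟩}` of the group algebra. -/
def charHom (ψ : AddChar (dualLattice Γ) ℂ) (z : ℂ ⊗[ℝ] V) :
    AddMonoidAlgebra ℤ (dualLattice Γ) →ₐ[ℤ] LaurentSeries ℂ :=
  AddMonoidAlgebra.lift ℤ (LaurentSeries ℂ) (dualLattice Γ)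
    { toFun := fun g => charExp ψ z (-g.toAdd)
      map_one' := by simp [charExp_zero]
      map_mul' := fun g h => by simp [charExp_add, add_comm] }

theorem charHom_single (ψ : AddChar (dualLattice Γ) ℂ) (z : ℂ ⊗[ℝ] V) (g : dualLattice Γ) :
    charHom ψ z (AddMonoidAlgebra.single g 1) = charExp ψ z (-g) := by
  rw [charHom, AddMonoidAlgebra.lift_single, Algebra.smul_def, map_one, one_mul]
  rfl

theorem charKernel_eq (ψ : AddChar (dualLattice Γ) ℂ) (γ : Fin N → dualLattice Γ)
    (a : dualLattice Γ) (z : ℂ ⊗[ℝ] V) :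
    charKernel ψ γ a z = charExp ψ z a / charHom ψ z (den γ) := by
  rw [charKernel, den, map_prod]
  congr 1
  exact Finset.prod_congr rfl fun k _ => by rw [map_sub, map_one, charHom_single]

/-- The elements `L β_i`, `L > 0`, of the dual lattice. -/
def positiveMultiples (Γ : Submodule ℤ V) (β : Fin N → StrongDual ℝ V) : Set (dualLattice Γ) :=
  {g | ∃ (L : ℕ) (i : Fin N), 0 < L ∧ (g : StrongDual ℝ V) = (L : ℝ) • β i}

theorem charHom_den_ne_zero (ψ : AddChar (dualLattice Γ) ℂ) (z : regularPoints β) {m : ℕ}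
    {η : Fin m → dualLattice Γ} (hη : ∀ k, η k ∈ positiveMultiples Γ β) :
    charHom ψ (z : ℂ ⊗[ℝ] V) (den η) ≠ 0 := by
  rw [den, map_prod]
  refine Finset.prod_ne_zero_iff.2 fun k _ => ?_
  rw [map_sub, map_one, charHom_single, charExp]
  refine one_sub_C_mul_expSeries_ne_zero (ψ.val_isUnit _).ne_zero ?_
  obtain ⟨L, i, hL, h⟩ := hη k
  have h1 : ((-η k : dualLattice Γ) : StrongDual ℝ V) = (-(L : ℝ)) • β i := by
    rw [Submodule.coe_neg, h]; exact (neg_smul _ _).symm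
  rw [h1, pair_smul]
  refine mul_ne_zero ?_ (pair_ne_zero z i)
  exact_mod_cast (neg_ne_zero.2 (Nat.cast_ne_zero.2 hL.ne') : (-(L : ℝ)) ≠ 0)

/-- Relations between generating functions are relations between kernels. -/
theorem KernelRelation.charKernel_eq {J : Type*} {γ : Fin N → dualLattice Γ} {T : Finset J}
    {e : J → ℤ} {δ : J → dualLattice Γ} {γ' : J → Fin N → dualLattice Γ}
    (h : KernelRelation (positiveMultiples Γ β) γ T e δ γ') (ψ : AddChar (dualLattice Γ) ℂ)
    (a : dualLattice Γ) (z : regularPoints β) :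
    charKernel ψ γ a (z : ℂ ⊗[ℝ] V) = ∑ j ∈ T, (e j : ℂ) • charKernel ψ (γ' j) (a - δ j) z := by
  obtain ⟨m, η, hη, R, R', h1, h2, h3⟩ := h
  have hD := charHom_den_ne_zero ψ z hη
  have hquot : ∀ (f : Fin N → dualLattice Γ) (r : AddMonoidAlgebra ℤ (dualLattice Γ)),
      den f * r = den η → (charHom ψ (z : ℂ ⊗[ℝ] V) (den f))⁻¹ =
        charHom ψ (z : ℂ ⊗[ℝ] V) r / charHom ψ (z : ℂ ⊗[ℝ] V) (den η) := by
    intro f r hr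
    rw [← hr, map_mul] at hD ⊢
    have := left_ne_zero_of_mul hD
    have := right_ne_zero_of_mul hD
    field_simp
  rw [VectorPartition.charKernel_eq, div_eq_mul_inv, hquot γ R h1, h3, map_sum, Finset.sum_div,
    Finset.mul_sum]
  refine Finset.sum_congr rfl fun j hj => ?_
  rw [VectorPartition.charKernel_eq, div_eq_mul_inv (charExp ψ (z : ℂ ⊗[ℝ] V) (a - δ j)),
    hquot _ _ (h2 j hj), map_zsmul, map_mul, charHom_single, sub_eq_add_neg, charExp_add,
    ← HahnSeries.C_mul_eq_smul, map_intCast, zsmul_eq_mul]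
  ring

variable (c : Set (StrongDual ℝ V)) (ℓ : (regularPoints β → ℂ) →ₗ[ℂ] ℂ)

/-- The contribution of the character `ψ` to the residue formula for the family `γ`. -/
def charResidue (ψ : AddChar (dualLattice Γ) ℂ) (γ : Fin N → dualLattice Γ) (a : dualLattice Γ) :
    ℂ :=
  ℓ fun z => (charKernel ψ γ a (z : ℂ ⊗[ℝ] V)).coeff (-(Module.finrank ℝ V : ℤ))

theorem KernelRelation.charResidue_eq {J : Type*} {γ : Fin N → dualLattice Γ} {T : Finset J}
    {e : J → ℤ} {δ : J → dualLattice Γ} {γ' : J → Fin N → dualLattice Γ}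
    (h : KernelRelation (positiveMultiples Γ β) γ T e δ γ') (ψ : AddChar (dualLattice Γ) ℂ)
    (a : dualLattice Γ) :
    charResidue ℓ ψ γ a = ∑ j ∈ T, (e j : ℂ) * charResidue ℓ ψ (γ' j) (a - δ j) := by
  simp only [charResidue]
  have h1 : (fun z : regularPoints β =>
      (charKernel ψ γ a (z : ℂ ⊗[ℝ] V)).coeff (-(Module.finrank ℝ V : ℤ))) =
      ∑ j ∈ T, (e j : ℂ) • fun z : regularPoints β =>
        (charKernel ψ (γ' j) (a - δ j) (z : ℂ ⊗[ℝ] V)).coeff (-(Module.finrank ℝ V : ℤ)) := by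
    ext z
    rw [h.charKernel_eq ψ a z, Finset.sum_apply, HahnSeries.coeff_sum]
    rfl
  rw [h1, map_sum]
  exact Finset.sum_congr rfl fun j _ => by rw [map_smul, smul_eq_mul]

/-- The residue formula for the family `γ`: for all sufficiently divisible `M`, the number of
solutions of `∑ x_k γ_k = a` is the sum of the residues over the characters of order dividing `M`,
provided that `a` lies in the chamber up to a translation by an element of the box of `γ`. -/
def ResidueFormula (γ : Fin N → dualLattice Γ) : Prop :=
  ∃ M₀ : ℕ, M₀ ≠ 0 ∧ ∀ M : ℕ, M ≠ 0 → M₀ ∣ M → ∀ X : Finset (AddChar (dualLattice Γ) ℂ),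
    (∀ ψ, ψ ∈ X ↔ ∀ a, ψ a ^ M = 1) → ∀ (a : dualLattice Γ) (t : Fin N → ℝ),
      (∀ k, 0 ≤ t k ∧ t k ≤ 1) →
      (a : StrongDual ℝ V) + ∑ k, t k • (γ k : StrongDual ℝ V) ∈ c →
      (solutionCount γ a : ℂ) = ∑ ψ ∈ X, charResidue ℓ ψ γ a

/-- The residue formula is inherited along relations between generating functions. The
coefficients of the relation may depend on the translation `t`. -/
theorem ResidueFormula.of_relation (hhalf : ∃ v : V, ∀ i, 0 < β i v) {J : Type*} {T : Finset J}
    {γ : Fin N → dualLattice Γ} {γ' : J → Fin N → dualLattice Γ}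
    (hγ : ∀ k, γ k ∈ positiveMultiples Γ β)
    (hγ' : ∀ j ∈ T, ∀ k, γ' j k ∈ positiveMultiples Γ β)
    (h : ∀ j ∈ T, ResidueFormula c ℓ (γ' j))
    (hrel : ∀ t : Fin N → ℝ, (∀ k, 0 ≤ t k ∧ t k ≤ 1) → ∃ (e : J → ℤ) (δ : J → dualLattice Γ),
      KernelRelation (positiveMultiples Γ β) γ T e δ γ' ∧ ∀ j ∈ T, ∃ t' : Fin N → ℝ,
        (∀ k, 0 ≤ t' k ∧ t' k ≤ 1) ∧ ∑ k, t' k • (γ' j k : StrongDual ℝ V) =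
          ∑ k, t k • (γ k : StrongDual ℝ V) + (δ j : StrongDual ℝ V)) :
    ResidueFormula c ℓ γ := by
  classical
  obtain ⟨v, hv⟩ := hhalf
  let height : dualLattice Γ →+ ℝ :=
    { toFun := fun a => (a : StrongDual ℝ V) v
      map_zero' := by simp
      map_add' := fun a b => by simp }
  have hheight : ∀ g ∈ positiveMultiples Γ β, 0 < height g := by
    rintro g ⟨L, i, hL, hg⟩
    change 0 < (g : StrongDual ℝ V) v
    rw [hg]
    exact mul_pos (Nat.cast_pos.2 hL) (hv i)
  choose! M₀ hM₀ hM using h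
  refine ⟨∏ j ∈ T, M₀ j, Finset.prod_ne_zero_iff.2 hM₀, fun M hM0 hdvd X hX a t ht ha => ?_⟩
  obtain ⟨e, δ, hker, hbox⟩ := hrel t ht
  have h1 := hker.solutionCount_eq hheight (fun k => hheight _ (hγ k))
    (fun j hj k => hheight _ (hγ' j hj k)) a
  have h2 : (solutionCount γ a : ℂ) = ∑ j ∈ T, (e j : ℂ) * solutionCount (γ' j) (a - δ j) := by
    exact_mod_cast congrArg (Int.cast : ℤ → ℂ) h1
  rw [h2, Finset.sum_congr rfl fun ψ _ => hker.charResidue_eq ℓ ψ a, Finset.sum_comm]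
  refine Finset.sum_congr rfl fun j hj => ?_
  rw [← Finset.mul_sum]
  congr 1
  obtain ⟨t', ht', hsum⟩ := hbox j hj
  refine hM j hj M hM0 ((Finset.dvd_prod_of_mem _ hj).trans hdvd) X hX _ t' ht' ?_
  rw [hsum, Submodule.coe_sub]
  convert ha using 1
  abel

/-- The residue formula may be checked after replacing the `γ_k` by multiples `M_k γ_k`. Splitting
`x_k = M_k y_k + r_k` shifts `a` by `∑ r_k γ_k`, and the translation `t_k` becomes
`(t_k + r_k) / M_k`, which is at most `1`. -/
theorem ResidueFormula.of_nsmul (hhalf : ∃ v : V, ∀ i, 0 < β i v) {γ : Fin N → dualLattice Γ}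
    (hγ : ∀ k, γ k ∈ positiveMultiples Γ β) {M : Fin N → ℕ} (hM : ∀ k, 0 < M k)
    (h : ResidueFormula c ℓ fun k => M k • γ k) : ResidueFormula c ℓ γ := by
  classical
  have hS : ∀ k, M k • γ k ∈ positiveMultiples Γ β := by
    intro k
    obtain ⟨L, i, hL, hg⟩ := hγ k
    refine ⟨M k * L, i, Nat.mul_pos (hM k) hL, ?_⟩
    have h1 : ((M k • γ k : dualLattice Γ) : StrongDual ℝ V) = M k • (γ k : StrongDual ℝ V) := rfl
    rw [h1, hg, Nat.cast_mul, mul_smul, Nat.cast_smul_eq_nsmul ℝ (M k)]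
  refine ResidueFormula.of_relation c ℓ hhalf hγ (fun _ _ => hS) (fun _ _ => h)
    fun t ht => ⟨_, _, kernelRelation_scale hS, fun r hr => ?_⟩
  rw [Fintype.mem_piFinset] at hr
  have hpos : ∀ k, (0 : ℝ) < M k := fun k => Nat.cast_pos.2 (hM k)
  refine ⟨fun k => (t k + r k) / M k, fun k => ⟨?_, ?_⟩, ?_⟩
  · exact div_nonneg (add_nonneg (ht k).1 (Nat.cast_nonneg _)) (hpos k).le
  · rw [div_le_one (hpos k)]
    have h1 : r k + 1 ≤ M k := Finset.mem_range.1 (hr k)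
    have h2 : (r k : ℝ) + 1 ≤ M k := by exact_mod_cast h1
    linarith [(ht k).2]
  · rw [Submodule.coe_sum, ← Finset.sum_add_distrib]
    refine Finset.sum_congr rfl fun k _ => ?_
    have h1 : ∀ m : ℕ, ((m • γ k : dualLattice Γ) : StrongDual ℝ V) =
        (m : ℝ) • (γ k : StrongDual ℝ V) := fun m => (Nat.cast_smul_eq_nsmul ℝ m _).symm
    rw [h1, h1, smul_smul, div_mul_cancel₀ _ (hpos k).ne', add_smul]

/-- Given a relation `γ_{k₀} + ∑_{k ∈ s} ± γ_k = 0`, the residue formula may be checked after each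
of the exchanges of a `γ_j`, `j ∈ s`, for `γ_{k₀}`. The telescoping relation is used in an order of
`s` that depends on the translation `t`, chosen such that all translations stay in the box. -/
theorem ResidueFormula.of_exchange (hhalf : ∃ v : V, ∀ i, 0 < β i v) {γ : Fin N → dualLattice Γ}
    (hγ : ∀ k, γ k ∈ positiveMultiples Γ β) {k₀ : Fin N} {s : Finset (Fin N)} {ε : Fin N → ℤ}
    (hε : ∀ k ∈ s, ε k = 1 ∨ ε k = -1) (hrel : γ k₀ + ∑ k ∈ s, ε k • γ k = 0)
    (h : ∀ j ∈ s, ResidueFormula c ℓ (Function.update γ j (γ k₀))) : ResidueFormula c ℓ γ := by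
  classical
  refine ResidueFormula.of_relation c ℓ hhalf hγ (fun j _ k => ?_) h fun t ht => ?_
  · by_cases hk : k = j
    · subst hk; rw [Function.update_self]; exact hγ k₀
    · rw [Function.update_of_ne hk]; exact hγ k
  -- after the exchange of `j`, the coordinate of `k ∈ s` is `±(τ j - τ k)` modulo `1`, and the
  -- order of `τ j` and `τ k` determines its representative in `[0, 1]`
  let τ : Fin N → ℝ := fun k => if ε k = 1 then 1 - t k else t k
  obtain ⟨P, hP, hw⟩ := exists_ordering (AddMonoidAlgebra ℤ (dualLattice Γ)) s τ
  refine ⟨_, _, kernelRelation_exchange hγ hε hrel hw, fun j hj => ?_⟩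
  obtain ⟨hPs, hjP, hle, hge⟩ := hP j hj
  have hτ : ∀ k, 0 ≤ τ k ∧ τ k ≤ 1 := by
    intro k
    simp only [τ]
    split_ifs
    · constructor <;> linarith [(ht k).1, (ht k).2]
    · exact ht k
  -- `τ j` times the relation is added, which makes the coordinate of `γ j` integral
  refine ⟨fun k => if k = j then τ j else if k ∈ s then
    t k + τ j * ε k - (if k ∈ P j then (ε k : ℝ) else 0) else t k, fun k => ?_, ?_⟩
  · dsimp only
    by_cases hk : k = j
    · rw [if_pos hk]; exact hτ j
    rw [if_neg hk]
    by_cases hks : k ∈ s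
    · rw [if_pos hks]
      by_cases hkP : k ∈ P j
      · have h1 := hle k hkP
        rw [if_pos hkP]
        rcases hε k hks with h2 | h2 <;> simp only [τ, h2] at h1 hτ ⊢ <;> norm_num at h1 ⊢ <;>
          constructor <;> linarith [(ht k).1, (ht k).2, (hτ j).1, (hτ j).2]
      · have h1 := hge k hks hkP
        rw [if_neg hkP]
        rcases hε k hks with h2 | h2 <;> simp only [τ, h2] at h1 hτ ⊢ <;> norm_num at h1 ⊢ <;>
          constructor <;> linarith [(ht k).1, (ht k).2, (hτ j).1, (hτ j).2]
    · rw [if_neg hks]; exact ht k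
  · have hz : ∀ (m : ℤ) (g : dualLattice Γ), ((m • g : dualLattice Γ) : StrongDual ℝ V) =
        (m : ℝ) • (g : StrongDual ℝ V) := fun m g => (Int.cast_smul_eq_zsmul ℝ m _).symm
    have hrel' : (γ k₀ : StrongDual ℝ V) + ∑ k ∈ s, (ε k : ℝ) • (γ k : StrongDual ℝ V) = 0 := by
      have := congrArg (Subtype.val : dualLattice Γ → StrongDual ℝ V) hrel
      simpa only [Submodule.coe_add, Submodule.coe_sum, hz, ZeroMemClass.coe_zero] using this
    have hδ : ((-∑ k ∈ P j, ε k • γ k - if ε j = 1 then γ j else 0 : dualLattice Γ) :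
        StrongDual ℝ V) = -∑ k ∈ P j, (ε k : ℝ) • (γ k : StrongDual ℝ V) -
          (if ε j = 1 then (1 : ℝ) else 0) • (γ j : StrongDual ℝ V) := by
      rw [Submodule.coe_sub, Submodule.coe_neg, Submodule.coe_sum]
      simp only [hz]
      split_ifs <;> simp
    have hexp : ∀ (x y w r : ℝ) (g : StrongDual ℝ V),
        (x + y * w - r) • g = x • g + y • w • g - r • g := by intros; module
    have hexp' : ∀ (x y w : ℝ) (g : StrongDual ℝ V),
        (x + y * w) • g = x • g + y • w • g := by intros; module
    have hcoef : ∀ k, (if k = j then τ j else if k ∈ s then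
        t k + τ j * ε k - (if k ∈ P j then (ε k : ℝ) else 0) else t k) •
          (Function.update γ j (γ k₀) k : StrongDual ℝ V) =
        t k • (γ k : StrongDual ℝ V) +
          τ j • (if k ∈ s then (ε k : ℝ) • (γ k : StrongDual ℝ V) else 0)
          - (if k ∈ P j then (ε k : ℝ) • (γ k : StrongDual ℝ V) else 0)
          + (if k = j then τ j • (γ k₀ : StrongDual ℝ V) -
            (if ε j = 1 then (1 : ℝ) else 0) • (γ j : StrongDual ℝ V) else 0) := by
      intro k
      by_cases hk : k = j
      · subst hk
        rw [Function.update_self, if_pos rfl, if_pos rfl, if_pos hj, if_neg hjP]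
        have h1 : t k + τ k * ε k - (if ε k = 1 then (1 : ℝ) else 0) = 0 := by
          rcases hε k hj with h2 | h2 <;> simp [τ, h2]
        have h2 : (t k + τ k * ε k - (if ε k = 1 then (1 : ℝ) else 0)) •
          (γ k : StrongDual ℝ V) = 0 := by rw [h1, zero_smul]
        rw [hexp] at h2
        have h3 : ∀ x y w r : StrongDual ℝ V, x + y - r = 0 → w = x + y - 0 + (w - r) := by
          intro x y w r h
          rw [sub_zero, ← add_sub_assoc, add_sub_right_comm, h, zero_add]
        exact h3 _ _ _ _ h2
      · rw [Function.update_of_ne hk, if_neg hk, if_neg hk]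
        by_cases hks : k ∈ s
        · rw [if_pos hks, if_pos hks]
          split_ifs
          · rw [hexp, add_zero]
          · rw [sub_zero, hexp', sub_zero, add_zero]
        · rw [if_neg hks, if_neg hks, if_neg fun h => hks (hPs h)]
          simp
    rw [hδ, Finset.sum_congr rfl fun k _ => hcoef k]
    rw [Finset.sum_add_distrib, Finset.sum_sub_distrib, Finset.sum_add_distrib, ← Finset.smul_sum,
      Finset.sum_ite_mem, Finset.sum_ite_mem, Finset.sum_ite_eq', if_pos (Finset.mem_univ _),
      Finset.univ_inter, Finset.univ_inter, ← neg_eq_of_add_eq_zero_right hrel', smul_neg]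
    abel

end Kernels
end VectorPartition
end

noncomputable section
namespace VectorPartition

/-! ### Reduction to simplicial families -/

section Reduction

variable {V : Type*} [NormedAddCommGroup V] [NormedSpace ℝ V] [FiniteDimensional ℝ V]
variable (Γ : Submodule ℤ V) [DiscreteTopology Γ] [IsZLattice ℝ Γ]
variable {N : ℕ} {β : Fin N → StrongDual ℝ V}

theorem formOf_mem_dualLattice (y : Fin (Module.finrank ℝ V) → ℤ) :
    formOf Γ (fun j => (y j : ℝ)) ∈ dualLattice Γ := by
  intro γ hγ
  rw [← span_latticeBasis Γ] at hγ
  induction hγ using Submodule.span_induction with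
  | mem x hx =>
    obtain ⟨j, rfl⟩ := hx
    exact ⟨y j, formOf_apply_latticeBasis Γ _ j⟩
  | zero => exact ⟨0, by simp⟩
  | add x x' _ _ h h' =>
    obtain ⟨m, hm⟩ := h
    obtain ⟨m', hm'⟩ := h'
    exact ⟨m + m', by rw [map_add, hm, hm', Int.cast_add]⟩
  | smul k x _ h =>
    obtain ⟨m, hm⟩ := h
    exact ⟨k * m, by rw [map_zsmul, hm, zsmul_eq_mul, Int.cast_mul]⟩

theorem latticeBasis_mem (j : Fin (Module.finrank ℝ V)) : latticeBasis Γ j ∈ Γ := by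
  have : latticeBasis Γ j ∈ Submodule.span ℤ (Set.range (latticeBasis Γ)) :=
    Submodule.subset_span ⟨j, rfl⟩
  rwa [span_latticeBasis] at this

/-- The coordinates on the dual lattice: the values at the chosen basis of `Γ`. -/
def latticeCoords : dualLattice Γ ≃+ (Fin (Module.finrank ℝ V) → ℤ) :=
  (AddEquiv.ofBijective
    ({ toFun := fun y => ⟨formOf Γ fun j => (y j : ℝ), formOf_mem_dualLattice Γ y⟩
       map_zero' := by
        ext1
        exact (congrArg (formOf Γ) (by ext; simp)).trans (map_zero _)
       map_add' := fun y y' => by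
        ext1
        exact (congrArg (formOf Γ) (by ext; simp)).trans (map_add _ (fun j => (y j : ℝ)) _) } :
      (Fin (Module.finrank ℝ V) → ℤ) →+ dualLattice Γ) ⟨fun y y' h => by
        have h1 := (formOf Γ).injective (congrArg Subtype.val h)
        ext j
        exact_mod_cast congrFun h1 j, fun a => by
        choose y hy using fun j => a.2 _ (latticeBasis_mem Γ j)
        refine ⟨y, Subtype.ext ?_⟩
        apply ContinuousLinearMap.coe_injective
        refine (latticeBasis Γ).ext fun j => ?_
        exact (formOf_apply_latticeBasis Γ _ j).trans (hy j).symm⟩).symm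

theorem latticeCoords_apply (a : dualLattice Γ) (j : Fin (Module.finrank ℝ V)) :
    (latticeCoords Γ a j : ℝ) = (a : StrongDual ℝ V) (latticeBasis Γ j) := by
  obtain ⟨y, rfl⟩ := (latticeCoords Γ).symm.surjective a
  rw [AddEquiv.apply_symm_apply]
  exact (formOf_apply_latticeBasis Γ (fun j => (y j : ℝ)) j).symm

/-- The basis of the dual lattice dual to the chosen basis of `Γ`. -/
def dualLatticeBasis : Module.Basis (Fin (Module.finrank ℝ V)) ℤ (dualLattice Γ) :=
  Module.Basis.ofEquivFun (latticeCoords Γ).toIntLinearEquiv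

theorem dualLatticeBasis_repr (a : dualLattice Γ) (j : Fin (Module.finrank ℝ V)) :
    ((dualLatticeBasis Γ).repr a j : ℝ) = (a : StrongDual ℝ V) (latticeBasis Γ j) := by
  rw [← latticeCoords_apply]
  rfl

variable {Γ}

/-- The family `β` as a family of elements of the dual lattice. -/
def latticeFamily (hΓ : ∀ i, β i ∈ dualLattice Γ) (i : Fin N) : dualLattice Γ := ⟨β i, hΓ i⟩

theorem nsmul_latticeFamily_mem (hΓ : ∀ i, β i ∈ dualLattice Γ) {L : ℕ} (hL : 0 < L) (i : Fin N) :
    L • latticeFamily hΓ i ∈ positiveMultiples Γ β :=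
  ⟨L, i, hL, (Nat.cast_smul_eq_nsmul ℝ L (β i)).symm⟩

/-- A sub-multiset of `Φ` which spans and has linearly independent support is, up to repetitions,
a basis. -/
theorem exists_basis_of_linearIndependent (hΓ : ∀ i, β i ∈ dualLattice Γ) {ν : Fin N → Fin N}
    (hν : Submodule.span ℝ (Set.range (β ∘ ν)) = ⊤)
    (hli : LinearIndependent ℤ fun i : Set.range ν => latticeFamily hΓ i) :
    ∃ (σ : Fin (Module.finrank ℝ V) → Fin N) (τ : Fin N → Fin (Module.finrank ℝ V)),
      IsBasisOf β σ ∧ Function.Surjective τ ∧ ∀ k, ν k = σ (τ k) := by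
  classical
  have : Module.Finite ℤ (dualLattice Γ) := Module.Finite.of_basis (dualLatticeBasis Γ)
  have hrange : Set.range (fun i : Set.range ν => β i) = Set.range (β ∘ ν) := by
    rw [Set.range_comp]
    ext; simp
  have h1 : Fintype.card (Set.range ν) ≤ Module.finrank ℝ V := by
    have := hli.fintype_card_le_finrank
    rwa [Module.finrank_eq_card_basis (dualLatticeBasis Γ), Fintype.card_fin] at this
  have h2 : LinearIndependent ℝ fun i : Set.range ν => β i :=
    linearIndependent_of_top_le_span_of_card_le_finrank (by rw [hrange, hν])
      (by rwa [finrank_strongDual])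
  have h3 : Module.finrank ℝ V ≤ Fintype.card (Set.range ν) := by
    have := finrank_range_le_card (R := ℝ) fun i : Set.range ν => β i
    rwa [Set.finrank, hrange, hν, finrank_top, finrank_strongDual] at this
  let e : Fin (Module.finrank ℝ V) ≃ Set.range ν :=
    (finCongr (le_antisymm h3 h1)).trans (Fintype.equivFin _).symm
  refine ⟨fun l => e l, fun k => e.symm ⟨ν k, k, rfl⟩, h2.comp e e.injective, fun l => ?_,
    fun k => by simp⟩
  obtain ⟨k, hk⟩ := (e l).2
  exact ⟨k, by simp [hk]⟩

/-- The residue formula holds for all families of multiples of members of `Φ` that span, if it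
holds for those supported on a basis: along a linear relation, the terms of large index are
exchanged for the one of smallest index until no relation is left. -/
theorem ResidueFormula.of_simplicial (hΓ : ∀ i, β i ∈ dualLattice Γ)
    (hhalf : ∃ v : V, ∀ i, 0 < β i v) {c : Set (StrongDual ℝ V)}
    {ℓ : (regularPoints β → ℂ) →ₗ[ℂ] ℂ}
    (hbase : ∀ (σ : Fin (Module.finrank ℝ V) → Fin N) (τ : Fin N → Fin (Module.finrank ℝ V)),
      IsBasisOf β σ → Function.Surjective τ → ∀ L : ℕ, 0 < L →
        ResidueFormula c ℓ fun k => L • latticeFamily hΓ (σ (τ k)))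
    (ν : Fin N → Fin N) (L : Fin N → ℕ) (hL : ∀ k, 0 < L k)
    (hν : Submodule.span ℝ (Set.range (β ∘ ν)) = ⊤) :
    ResidueFormula c ℓ fun k => L k • latticeFamily hΓ (ν k) := by
  classical
  induction hd : ∑ k, (ν k : ℕ) using Nat.strong_induction_on generalizing ν L with
  | _ d ih =>
  have hprod : 0 < ∏ k, L k := Finset.prod_pos fun k _ => hL k
  have hdiv : ∀ k, (∏ k, L k) / L k * L k = ∏ k, L k := fun k =>
    Nat.div_mul_cancel (Finset.dvd_prod_of_mem _ (Finset.mem_univ k))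
  have hdivpos : ∀ k, 0 < (∏ k, L k) / L k := fun k =>
    Nat.div_pos (Nat.le_of_dvd hprod (Finset.dvd_prod_of_mem _ (Finset.mem_univ k))) (hL k)
  by_cases hli : LinearIndependent ℤ fun i : Set.range ν => latticeFamily hΓ i
  · obtain ⟨σ, τ, hσ, hτ, hνσ⟩ := exists_basis_of_linearIndependent hΓ hν hli
    refine ResidueFormula.of_nsmul c ℓ hhalf (fun k => nsmul_latticeFamily_mem hΓ (hL k) _)
      hdivpos ?_
    have h1 := hbase σ τ hσ hτ _ hprod
    convert h1 using 2 with k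
    rw [smul_smul, hdiv, hνσ]
  -- a relation whose term of smallest index has a positive coefficient; rescaling the members of
  -- the family turns all its coefficients into signs, times a common factor
  obtain ⟨g, hg, i₀, hi₀, hmin⟩ : ∃ g : Set.range ν → ℤ, ∑ i, g i • latticeFamily hΓ i = 0 ∧
      ∃ i₀, 0 < g i₀ ∧ ∀ i, g i ≠ 0 → (i₀ : Fin N) ≤ i := by
    obtain ⟨g, hg, i, hi⟩ := Fintype.not_linearIndependent_iff.1 hli
    obtain ⟨i₀, h1, h2⟩ := Finset.exists_min_image (Finset.univ.filter fun i => g i ≠ 0)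
      (fun i => (i : Fin N)) ⟨i, by simp [hi]⟩
    simp only [Finset.mem_filter, Finset.mem_univ, true_and] at h1 h2
    rcases lt_or_gt_of_ne h1 with h | h
    · refine ⟨-g, ?_, i₀, by simpa using h, fun i hi => h2 i (by simpa using hi)⟩
      simp [Finset.sum_neg_distrib, hg]
    · exact ⟨g, hg, i₀, h, h2⟩
  choose r hr using fun i : Set.range ν => i.2
  let q : Fin N → Set.range ν := fun k => ⟨ν k, k, rfl⟩
  have hqr : ∀ i, q (r i) = i := fun i => Subtype.ext (hr i)
  let w : Fin N → ℕ := fun k => if g (q k) = 0 then 1 else (g (q k)).natAbs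
  have hw : ∀ k, 0 < w k := by
    intro k
    simp only [w]
    split_ifs with h
    · exact one_pos
    · exact Int.natAbs_pos.2 h
  let L' : Fin N → ℕ := fun k => w k * ∏ k, L k
  have hL' : ∀ k, 0 < L' k := fun k => Nat.mul_pos (hw k) hprod
  refine ResidueFormula.of_nsmul c ℓ hhalf (M := fun k => w k * ((∏ k, L k) / L k))
    (fun k => nsmul_latticeFamily_mem hΓ (hL k) _) (fun k => Nat.mul_pos (hw k) (hdivpos k)) ?_
  have h1 : (fun k => (w k * ((∏ k, L k) / L k)) • L k • latticeFamily hΓ (ν k)) =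
      fun k => L' k • latticeFamily hΓ (ν k) := by
    ext1 k
    rw [smul_smul, mul_assoc, hdiv]
  rw [h1]
  let S : Finset (Set.range ν) := (Finset.univ.filter fun i => g i ≠ 0).erase i₀
  have hterm : ∀ i, g i ≠ 0 → (g (q (r i))).sign • L' (r i) • latticeFamily hΓ (ν (r i)) =
      (∏ k, L k) • g i • latticeFamily hΓ i := by
    intro i hi
    have h2 : L' (r i) = (g i).natAbs * ∏ k, L k := by
      simp only [L', w, hqr, if_neg hi]
    rw [hqr, h2, hr, ← natCast_zsmul, ← natCast_zsmul, smul_smul, smul_smul, Nat.cast_mul,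
      ← mul_assoc, Int.sign_mul_natAbs, mul_comm]
  refine ResidueFormula.of_exchange c ℓ hhalf (k₀ := r i₀) (s := S.image r)
    (ε := fun k => (g (q k)).sign) (fun k => nsmul_latticeFamily_mem hΓ (hL' k) _) ?_ ?_ ?_
  · intro k hk
    obtain ⟨i, hi, rfl⟩ := Finset.mem_image.1 hk
    have h2 : g i ≠ 0 := by simpa using (Finset.mem_erase.1 hi).2
    simp only [hqr]
    rcases lt_or_gt_of_ne h2 with h | h
    · exact Or.inr (Int.sign_eq_neg_one_of_neg h)
    · exact Or.inl (Int.sign_eq_one_of_pos h)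
  · have hfilter : ∑ i ∈ Finset.univ.filter (fun i => g i ≠ 0), g i • latticeFamily hΓ i =
        ∑ i, g i • latticeFamily hΓ i :=
      Finset.sum_filter_of_ne fun i _ h h0 => h (by rw [h0, zero_smul])
    rw [Finset.sum_image fun i _ j _ h => by rw [← hqr i, h, hqr]]
    have h2 := hterm i₀ hi₀.ne'
    rw [hqr, Int.sign_eq_one_of_pos hi₀, one_smul] at h2
    rw [h2, Finset.sum_congr rfl fun i hi => hterm i (by simpa using (Finset.mem_erase.1 hi).2),
      Finset.add_sum_erase _ (fun i => (∏ k, L k) • g i • latticeFamily hΓ i) (by simp [hi₀.ne']),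
      ← Finset.smul_sum, hfilter, hg, smul_zero]
  · intro j hj
    obtain ⟨i, hi, rfl⟩ := Finset.mem_image.1 hj
    obtain ⟨hne, hgi⟩ := Finset.mem_erase.1 hi
    replace hgi : g i ≠ 0 := by simpa using hgi
    have hupd : Function.update (fun k => L' k • latticeFamily hΓ (ν k)) (r i)
        (L' (r i₀) • latticeFamily hΓ (ν (r i₀))) =
        fun k => Function.update L' (r i) (L' (r i₀)) k •
          latticeFamily hΓ (Function.update ν (r i) i₀ k) := by
      ext1 k
      by_cases hk : k = r i
      · subst hk; simp [hr]
      · simp [hk]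
    rw [hupd]
    refine ih _ ?_ (Function.update ν (r i) i₀) _ (fun k => ?_) ?_ rfl
    · rw [← hd]
      have hlt : (i₀ : Fin N) < ν (r i) := by
        rw [hr]
        exact lt_of_le_of_ne (hmin i hgi) fun h => hne (Subtype.ext h.symm)
      refine Finset.sum_lt_sum (fun k _ => ?_) ⟨r i, Finset.mem_univ _, by simpa using hlt⟩
      by_cases hk : k = r i
      · subst hk; simpa using hlt.le
      · simp [hk]
    · by_cases hk : k = r i
      · subst hk; simpa using hL' _
      · simpa [hk] using hL' k
    · have hmem : ∀ i' : Set.range ν, i' ≠ i →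
          β i' ∈ Submodule.span ℝ (Set.range (β ∘ Function.update ν (r i) i₀)) := by
        intro i' hi'
        refine Submodule.subset_span ⟨r i', ?_⟩
        have : r i' ≠ r i := fun h => hi' (by rw [← hqr i', h, hqr])
        simp [this, hr]
      have hmem' : β i ∈ Submodule.span ℝ (Set.range (β ∘ Function.update ν (r i) i₀)) := by
        have h2 : ∑ i, (g i : ℝ) • β i = 0 := by
          have := congrArg (Subtype.val : dualLattice Γ → StrongDual ℝ V) hg
          rw [Submodule.coe_sum, ZeroMemClass.coe_zero] at this
          rw [← this]
          exact Finset.sum_congr rfl fun i _ => Int.cast_smul_eq_zsmul ℝ (g i) (β i)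
        rw [← Finset.add_sum_erase _ _ (Finset.mem_univ i)] at h2
        have h3 : β i = (g i : ℝ)⁻¹ • -∑ j ∈ Finset.univ.erase i, (g j : ℝ) • β j := by
          rw [← eq_neg_of_add_eq_zero_left h2, inv_smul_smul₀ (Int.cast_ne_zero.2 hgi)]
        rw [h3]
        exact Submodule.smul_mem _ _ (Submodule.neg_mem _ (Submodule.sum_mem _ fun j hj =>
          Submodule.smul_mem _ _ (hmem j (Finset.ne_of_mem_erase hj))))
      rw [eq_top_iff, ← hν, Submodule.span_le]
      rintro _ ⟨k, rfl⟩
      by_cases hk : q k = i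
      · have : ν k = i := congrArg Subtype.val hk
        simpa [this] using hmem'
      · exact hmem (q k) hk

end Reduction
end VectorPartition
end

noncomputable section
namespace VectorPartition

/-! ### One-dimensional residues -/

section OneDim

open PowerSeries

/-- The power series `(1 - e^{-X}) / X`. -/
def expQuot : PowerSeries ℂ := PowerSeries.mk fun k => (-1) ^ k / ((k + 1).factorial : ℂ)

/-- The Todd series `X / (1 - e^{-X})`. -/
def toddSeries : PowerSeries ℂ := expQuot⁻¹

/-- The residue at `0` of `e^{α X} / (1 - e^{-X}) ^ {m + 1}`. -/
def expResidue (α : ℂ) (m : ℕ) : ℂ :=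
  coeff m (rescale α (exp ℂ) * toddSeries ^ (m + 1))

theorem X_mul_expQuot : X * expQuot = 1 - rescale (-1) (exp ℂ) := by
  ext k
  cases k with
  | zero =>
    rw [coeff_zero_X_mul, map_sub, coeff_rescale]
    simp
  | succ k =>
    rw [coeff_succ_X_mul, expQuot, coeff_mk, map_sub, coeff_one, if_neg k.succ_ne_zero,
      coeff_rescale, coeff_exp]
    simp [pow_succ, div_eq_mul_inv]

theorem constantCoeff_expQuot : constantCoeff expQuot = 1 := by
  rw [← coeff_zero_eq_constantCoeff_apply, expQuot, coeff_mk]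
  simp

theorem expQuot_mul_toddSeries : expQuot * toddSeries = 1 :=
  PowerSeries.mul_inv_cancel _ (by rw [constantCoeff_expQuot]; exact one_ne_zero)

theorem constantCoeff_toddSeries : constantCoeff toddSeries = 1 := by
  have := congrArg constantCoeff expQuot_mul_toddSeries
  rwa [map_mul, constantCoeff_expQuot, one_mul, map_one] at this

theorem expResidue_zero (α : ℂ) : expResidue α 0 = 1 := by
  rw [expResidue, coeff_zero_eq_constantCoeff_apply, map_mul, map_pow, constantCoeff_toddSeries,
    ← coeff_zero_eq_constantCoeff_apply, coeff_rescale]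
  simp

/-- The Pascal recurrence, from `1 = e^{-X} + (1 - e^{-X})`. -/
theorem expResidue_succ (α : ℂ) (m : ℕ) :
    expResidue α (m + 1) = expResidue (α - 1) (m + 1) + expResidue α m := by
  have h1 : rescale (α - 1) (exp ℂ) = rescale α (exp ℂ) * rescale (-1) (exp ℂ) := by
    rw [exp_mul_exp_eq_exp_add, sub_eq_add_neg]
  have h2 : rescale α (exp ℂ) * toddSeries ^ (m + 1 + 1) =
      rescale (α - 1) (exp ℂ) * toddSeries ^ (m + 1 + 1) +
        X * (rescale α (exp ℂ) * toddSeries ^ (m + 1)) := by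
    rw [h1]
    linear_combination (-rescale α (exp ℂ) * toddSeries ^ (m + 2)) * X_mul_expQuot +
      (rescale α (exp ℂ) * toddSeries ^ (m + 1) * X) * expQuot_mul_toddSeries
  rw [expResidue, h2, map_add, coeff_succ_X_mul]
  rfl

/-- The residue of `e^{-X} / (1 - e^{-X}) ^ {m + 2}` vanishes, this being a derivative. -/
theorem expResidue_neg_one (m : ℕ) : expResidue (-1) (m + 1) = 0 := by
  have hm : ((m : ℂ) + 1) ≠ 0 := by exact_mod_cast m.succ_ne_zero
  have hd1 : derivative ℂ expQuot * toddSeries + expQuot * derivative ℂ toddSeries = 0 := by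
    have := congrArg (derivative ℂ) expQuot_mul_toddSeries
    rw [Derivation.leibniz, Derivation.map_one_eq_zero, smul_eq_mul, smul_eq_mul] at this
    linear_combination this
  have hd2 : expQuot + X * derivative ℂ expQuot = rescale (-1) (exp ℂ) := by
    ext k
    cases k with
    | zero => simp [expQuot, coeff_rescale]
    | succ k =>
      rw [map_add, coeff_succ_X_mul, coeff_derivative, expQuot, coeff_mk, coeff_rescale, coeff_exp,
        Nat.factorial_succ (k + 1)]
      have h1 : (((k + 1).factorial : ℕ) : ℂ) ≠ 0 := Nat.cast_ne_zero.2 (Nat.factorial_ne_zero _)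
      have h2 : ((k : ℂ) + 1 + 1) ≠ 0 := by exact_mod_cast (k + 1).succ_ne_zero
      push_cast
      field_simp
      ring
  have hd3 : derivative ℂ (toddSeries ^ (m + 1)) =
      ((m : PowerSeries ℂ) + 1) * toddSeries ^ m * derivative ℂ toddSeries := by
    rw [Derivation.leibniz_pow]
    simp [smul_eq_mul, nsmul_eq_mul, mul_assoc]
  have h1 : ((m : PowerSeries ℂ) + 1) * (rescale (-1) (exp ℂ) * toddSeries ^ (m + 1 + 1)) =
      ((m : PowerSeries ℂ) + 1) * toddSeries ^ (m + 1) -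
        X * derivative ℂ (toddSeries ^ (m + 1)) := by
    rw [hd3, ← hd2]
    linear_combination (((m : PowerSeries ℂ) + 1) * toddSeries ^ (m + 1) -
      ((m : PowerSeries ℂ) + 1) * X * toddSeries ^ m * derivative ℂ toddSeries) *
        expQuot_mul_toddSeries + ((m : PowerSeries ℂ) + 1) * X * toddSeries ^ (m + 1) * hd1
  have h2 := congrArg (coeff (m + 1)) h1
  have hC : ((m : PowerSeries ℂ) + 1) = C ((m : ℂ) + 1) := by simp
  rw [map_sub, coeff_succ_X_mul, coeff_derivative, hC, coeff_C_mul, coeff_C_mul] at h2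
  have h3 : ((m : ℂ) + 1) * expResidue (-1) (m + 1) = 0 := by
    rw [expResidue, h2]; ring
  exact (mul_eq_zero.1 h3).resolve_left hm

theorem expResidue_natCast (b m : ℕ) : expResidue b m = Nat.multichoose (m + 1) b := by
  induction m generalizing b with
  | zero => simp [expResidue_zero]
  | succ m ihm =>
    induction b with
    | zero =>
      rw [expResidue_succ, ihm, Nat.cast_zero, zero_sub, expResidue_neg_one, zero_add]
      simp
    | succ b ihb =>
      rw [expResidue_succ, ihm, Nat.cast_succ, add_sub_cancel_right, ihb,
        Nat.multichoose_succ_succ (m + 1) b]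
      push_cast
      ring

/-- The residue vanishes for the exponents `-1, …, -m`, where the polynomial giving the number of
solutions of an equation in `m + 1` unknowns has its roots. -/
theorem expResidue_neg (b m : ℕ) (h : b < m) : expResidue (-(b + 1)) m = 0 := by
  induction b generalizing m with
  | zero =>
    obtain ⟨m, rfl⟩ := Nat.exists_eq_succ_of_ne_zero (Nat.ne_of_gt h)
    simpa using expResidue_neg_one m
  | succ b ih =>
    obtain ⟨m, rfl⟩ := Nat.exists_eq_succ_of_ne_zero (Nat.ne_of_gt (Nat.zero_lt_of_lt h))
    have h1 := expResidue_succ (-((b : ℂ) + 1)) m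
    rw [ih (m + 1) (by omega), ih m (by omega), add_zero] at h1
    have h2 : (-(((b + 1 : ℕ) : ℂ) + 1)) = -((b : ℂ) + 1) - 1 := by push_cast; ring
    rw [h2, ← h1]

/-- The residue counts the solutions of `x_1 + ⋯ + x_m = b`, for all `b > -m`. -/
theorem expResidue_eq_ncard {ι : Type*} [Fintype ι] {b : ℤ} (hι : 0 < Fintype.card ι)
    (hb : -(Fintype.card ι : ℤ) < b) :
    expResidue b (Fintype.card ι - 1) = ({x : ι → ℕ | ∑ i, (x i : ℤ) = b}.ncard : ℂ) := by
  classical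
  obtain ⟨m, hm⟩ := Nat.exists_eq_succ_of_ne_zero hι.ne'
  rw [hm, Nat.succ_sub_one]
  rcases le_or_gt 0 b with h | h
  · lift b to ℕ using h
    rw [Int.cast_natCast, expResidue_natCast, ← Nat.succ_eq_add_one, ← hm, ← Finset.card_univ,
      ← Finset.card_finsuppAntidiag_nat_eq_multichoose]
    have h1 : {x : ι → ℕ | ∑ i, (x i : ℤ) = b} =
        (fun f : ι →₀ ℕ => (f : ι → ℕ)) '' (Finset.finsuppAntidiag (Finset.univ : Finset ι) b) := by
      ext x
      simp only [Set.mem_ofPred_eq, Set.mem_image, Finset.mem_coe, Finset.mem_finsuppAntidiag,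
        Finset.subset_univ, and_true]
      constructor
      · intro h
        refine ⟨Finsupp.equivFunOnFinite.symm x, ?_, by simp⟩
        simp only [Finsupp.coe_equivFunOnFinite_symm]
        exact_mod_cast h
      · rintro ⟨f, hf, rfl⟩
        exact_mod_cast hf
    rw [h1, Set.ncard_image_of_injective _ DFunLike.coe_injective, Set.ncard_coe_finset]
  · obtain ⟨k, hk⟩ : ∃ k : ℕ, b = -(k + 1) := ⟨(-b - 1).toNat, by omega⟩
    have h1 : {x : ι → ℕ | ∑ i, (x i : ℤ) = b} = ∅ := by
      refine Set.eq_empty_of_forall_notMem fun x hx => ?_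
      have : 0 ≤ ∑ i, (x i : ℤ) := Finset.sum_nonneg fun i _ => Int.natCast_nonneg _
      rw [show ∑ i, (x i : ℤ) = b from hx] at this
      omega
    rw [h1, hk]
    push_cast
    rw [expResidue_neg k m (by omega)]
    simp

/-- The Laurent expansion of `e^{α w} / (1 - u e^{-w}) ^ m`, homogeneous in `w`. -/
theorem exists_powerSeries_expSeries_div (α u : ℂ) (hu : u ≠ 0) {m : ℕ} (hm : 0 < m) :
    ∃ P : PowerSeries ℂ, coeff (m - 1) P = (if u = 1 then expResidue α (m - 1) else 0) ∧
      ∀ w : ℂ, w ≠ 0 → expSeries (α * w) / (1 - HahnSeries.C u * expSeries (-w)) ^ m =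
        HahnSeries.single (-(m : ℤ)) (w⁻¹ ^ m) * HahnSeries.ofPowerSeries ℤ ℂ (rescale w P) := by
  obtain ⟨m, rfl⟩ := Nat.exists_eq_succ_of_ne_zero hm.ne'
  let D : PowerSeries ℂ := 1 - C u * rescale (-1) (exp ℂ)
  obtain ⟨P, hP, hPD⟩ : ∃ P : PowerSeries ℂ,
      coeff m P = (if u = 1 then expResidue α m else 0) ∧
        P * D ^ (m + 1) = X ^ (m + 1) * rescale α (exp ℂ) := by
    by_cases h1 : u = 1
    · refine ⟨rescale α (exp ℂ) * toddSeries ^ (m + 1), by rw [if_pos h1]; rfl, ?_⟩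
      have hD : D = X * expQuot := by rw [X_mul_expQuot]; simp [D, h1]
      calc rescale α (exp ℂ) * toddSeries ^ (m + 1) * D ^ (m + 1)
          = rescale α (exp ℂ) * X ^ (m + 1) * (expQuot * toddSeries) ^ (m + 1) := by
            rw [hD]; ring
        _ = _ := by rw [expQuot_mul_toddSeries]; ring
    · refine ⟨X ^ (m + 1) * (rescale α (exp ℂ) * D⁻¹ ^ (m + 1)), ?_, ?_⟩
      · rw [if_neg h1, coeff_X_pow_mul', if_neg (by omega)]
      · have hD : D * D⁻¹ = 1 := by
          refine PowerSeries.mul_inv_cancel _ ?_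
          have : constantCoeff D = 1 - u := by
            simp only [D, map_sub, map_one, map_mul, constantCoeff_C]
            rw [← coeff_zero_eq_constantCoeff_apply, coeff_rescale]
            simp
          rw [this]
          exact sub_ne_zero.2 (Ne.symm h1)
        calc _ = X ^ (m + 1) * rescale α (exp ℂ) * (D * D⁻¹) ^ (m + 1) := by rw [mul_pow]; ring
          _ = _ := by rw [hD]; ring
  refine ⟨P, hP, fun w hw => ?_⟩
  have hne := one_sub_C_mul_expSeries_ne_zero hu (neg_ne_zero.2 hw)
  have hresc : ∀ r : ℂ, rescale w (rescale r (exp ℂ)) = rescale (r * w) (exp ℂ) := fun r => by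
    ext k; simp only [coeff_rescale]; ring
  have hCC : ∀ r : ℂ, rescale w (C r) = C r := fun r => by
    ext k
    rw [coeff_rescale, coeff_C]
    split_ifs with h <;> simp [h]
  have hD : 1 - HahnSeries.C u * expSeries (-w) =
      HahnSeries.ofPowerSeries ℤ ℂ (rescale w D) := by
    simp only [D, map_sub, map_mul, map_one, hresc, hCC, HahnSeries.ofPowerSeries_C]
    rw [neg_one_mul]
    rfl
  have hX : HahnSeries.ofPowerSeries ℤ ℂ (rescale w X) = HahnSeries.single 1 w := by
    have : rescale w (X : PowerSeries ℂ) = C w * X := by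
      ext k
      rw [coeff_rescale, coeff_C_mul, coeff_X]
      split_ifs with h <;> simp [h]
    rw [this, map_mul, HahnSeries.ofPowerSeries_C, HahnSeries.ofPowerSeries_X]
    simp [HahnSeries.C_apply, HahnSeries.single_mul_single]
  rw [div_eq_iff (pow_ne_zero _ hne), hD, mul_assoc, ← map_pow (HahnSeries.ofPowerSeries ℤ ℂ),
    ← map_pow (rescale w), ← map_mul, ← map_mul, hPD, map_mul, map_mul,
    map_pow (rescale w), map_pow (HahnSeries.ofPowerSeries ℤ ℂ), hX, hresc, HahnSeries.single_pow,
    ← mul_assoc,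
    HahnSeries.single_mul_single, ← mul_pow, inv_mul_cancel₀ hw, one_pow]
  simp only [Nat.succ_eq_add_one, nsmul_eq_mul, mul_one, neg_add_cancel]
  exact (one_mul (expSeries (α * w))).symm

end OneDim
end VectorPartition
end

noncomputable section
namespace VectorPartition

/-! ### The residue formula for simplicial families -/

section Simplicial

variable {V : Type*} [NormedAddCommGroup V] [NormedSpace ℝ V] [FiniteDimensional ℝ V]
variable {Γ : Submodule ℤ V} [DiscreteTopology Γ] [IsZLattice ℝ Γ]
variable {N : ℕ} {β : Fin N → StrongDual ℝ V}

theorem expSeries_sum {ι : Type*} (s : Finset ι) (f : ι → ℂ) :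
    expSeries (∑ i ∈ s, f i) = ∏ i ∈ s, expSeries (f i) := by
  classical
  induction s using Finset.induction_on with
  | empty => simp [expSeries_zero]
  | insert i s hi ih => rw [Finset.sum_insert hi, Finset.prod_insert hi, expSeries_add, ih]

theorem prod_single_mul_ofPowerSeries {ι : Type*} (s : Finset ι) (m : ι → ℤ) (r : ι → ℂ)
    (P : ι → PowerSeries ℂ) :
    ∏ i ∈ s, (HahnSeries.single (m i) (r i) * HahnSeries.ofPowerSeries ℤ ℂ (P i)) =
      HahnSeries.single (∑ i ∈ s, m i) (∏ i ∈ s, r i) *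
        HahnSeries.ofPowerSeries ℤ ℂ (∏ i ∈ s, P i) := by
  classical
  induction s using Finset.induction_on with
  | empty => simp
  | insert i s hi ih =>
    rw [Finset.prod_insert hi, ih, Finset.sum_insert hi, Finset.prod_insert hi,
      Finset.prod_insert hi, map_mul (HahnSeries.ofPowerSeries ℤ ℂ), mul_mul_mul_comm,
      HahnSeries.single_mul_single]

theorem charKernel_simplicial (hΓ : ∀ i, β i ∈ dualLattice Γ)
    {σ : Fin (Module.finrank ℝ V) → Fin N} (hσ : IsBasisOf β σ)
    (τ : Fin N → Fin (Module.finrank ℝ V)) {L : ℕ} (hL : 0 < L)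
    (ψ : AddChar (dualLattice Γ) ℂ) (a : dualLattice Γ) (z : ℂ ⊗[ℝ] V) :
    charKernel ψ (fun k => L • latticeFamily hΓ (σ (τ k))) a z =
      HahnSeries.C (ψ (-a)) * ∏ l, (expSeries
        (((hσ.basis.repr (a : StrongDual ℝ V) l / L : ℝ) : ℂ) * (L * pair (β (σ l)) z)) /
          (1 - HahnSeries.C (ψ (L • latticeFamily hΓ (σ l))) *
            expSeries (-(L * pair (β (σ l)) z))) ^ Fintype.card {k // τ k = l}) := by
  have hL' : (L : ℂ) ≠ 0 := Nat.cast_ne_zero.2 hL.ne'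
  have h1 : expSeries (pair (a : StrongDual ℝ V) z) = ∏ l, expSeries
      (((hσ.basis.repr (a : StrongDual ℝ V) l / L : ℝ) : ℂ) * (L * pair (β (σ l)) z)) := by
    rw [← expSeries_sum, hσ.pair_eq]
    congr 1
    refine Finset.sum_congr rfl fun l _ => ?_
    push_cast
    field_simp
  have h2 : ∀ l, charExp ψ z (-(L • latticeFamily hΓ (σ l))) =
      HahnSeries.C (ψ (L • latticeFamily hΓ (σ l))) * expSeries (-(L * pair (β (σ l)) z)) := by
    intro l
    have h3 : ((-(L • latticeFamily hΓ (σ l)) : dualLattice Γ) : StrongDual ℝ V) =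
        (-(L : ℝ)) • β (σ l) := by
      have : ((-(L • latticeFamily hΓ (σ l)) : dualLattice Γ) : StrongDual ℝ V) =
        -(L • β (σ l)) := rfl
      rw [this, ← Nat.cast_smul_eq_nsmul ℝ]
      exact (neg_smul _ _).symm
    rw [charExp, neg_neg, h3, pair_smul]
    congr 2
    push_cast
    ring
  rw [charKernel, charExp, h1, mul_div_assoc, Finset.prod_div_distrib]
  congr 2
  rw [← Finset.prod_fiberwise' Finset.univ τ fun l =>
    (1 - charExp ψ z (-(L • latticeFamily hΓ (σ l))))]
  refine Finset.prod_congr rfl fun l _ => ?_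
  rw [Finset.prod_const, h2, Fintype.card_subtype]

/-- The residue of the kernel of a simplicial family is a product of one-dimensional residues. -/
theorem charResidue_simplicial (hΓ : ∀ i, β i ∈ dualLattice Γ) {c : Set (StrongDual ℝ V)}
    {ℓ : (regularPoints β → ℂ) →ₗ[ℂ] ℂ}
    (hℓ : ∀ i : MonoIdx β, ℓ (mono β i.1 i.2) = monoRes Γ c i)
    {σ : Fin (Module.finrank ℝ V) → Fin N} (hσ : IsBasisOf β σ)
    {τ : Fin N → Fin (Module.finrank ℝ V)} (hτ : Function.Surjective τ) {L : ℕ} (hL : 0 < L)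
    (ψ : AddChar (dualLattice Γ) ℂ) (a : dualLattice Γ) :
    charResidue ℓ ψ (fun k => L • latticeFamily hΓ (σ (τ k))) a =
      ψ (-a) * (∏ l, if ψ (L • latticeFamily hΓ (σ l)) = 1 then
        expResidue ((hσ.basis.repr (a : StrongDual ℝ V) l / L : ℝ) : ℂ)
          (Fintype.card {k // τ k = l} - 1) else 0) *
        (((L : ℂ)⁻¹) ^ Module.finrank ℝ V * monoRes Γ c (⟨σ, hσ⟩, -1)) := by
  classical
  have hL' : (L : ℂ) ≠ 0 := Nat.cast_ne_zero.2 hL.ne'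
  set m : Fin (Module.finrank ℝ V) → ℕ := fun l => Fintype.card {k // τ k = l} with hm
  have hmpos : ∀ l, 0 < m l := fun l => by
    obtain ⟨k, hk⟩ := hτ l
    exact Fintype.card_pos_iff.2 ⟨⟨k, hk⟩⟩
  choose P hP hPw using fun l => exists_powerSeries_expSeries_div
    ((hσ.basis.repr (a : StrongDual ℝ V) l / L : ℝ) : ℂ) (ψ (L • latticeFamily hΓ (σ l)))
    (ψ.val_isUnit _).ne_zero (hmpos l)
  let d : ℕ := ∑ l, (m l - 1)
  have hd : -(Module.finrank ℝ V : ℤ) - ∑ l, -(m l : ℤ) = (d : ℕ) := by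
    simp only [d]
    push_cast
    have : ∀ l, ((m l - 1 : ℕ) : ℤ) = m l - 1 := fun l => by have := hmpos l; omega
    rw [Finset.sum_congr rfl fun l _ => this l, Finset.sum_sub_distrib, Finset.sum_neg_distrib]
    simp
    ring
  let e : (Fin (Module.finrank ℝ V) →₀ ℕ) → Fin (Module.finrank ℝ V) → ℤ :=
    fun k l => (k l : ℤ) - m l
  have hcoeff : (fun z : regularPoints β => (charKernel ψ
      (fun k => L • latticeFamily hΓ (σ (τ k))) a (z : ℂ ⊗[ℝ] V)).coeff
        (-(Module.finrank ℝ V : ℤ))) =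
      ∑ k ∈ Finset.finsuppAntidiag Finset.univ d, (ψ (-a) *
        ((∏ l, PowerSeries.coeff (k l) (P l)) * ∏ l, (L : ℂ) ^ e k l)) • mono β σ (e k) := by
    ext z
    have hw : ∀ l, (L : ℂ) * pair (β (σ l)) (z : ℂ ⊗[ℝ] V) ≠ 0 := fun l =>
      mul_ne_zero hL' (pair_ne_zero z _)
    rw [charKernel_simplicial hΓ hσ τ hL,
      Finset.prod_congr rfl fun l _ => hPw l _ (hw l), prod_single_mul_ofPowerSeries,
      HahnSeries.C_mul_eq_smul, HahnSeries.coeff_smul, HahnSeries.coeff_single_mul, hd,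
      HahnSeries.ofPowerSeries_apply_coeff, PowerSeries.coeff_prod, Finset.sum_apply, smul_eq_mul,
      Finset.mul_sum, Finset.mul_sum]
    refine Finset.sum_congr rfl fun k _ => ?_
    rw [Pi.smul_apply, smul_eq_mul, mono, mul_assoc, mul_assoc, ← Finset.prod_mul_distrib,
      ← Finset.prod_mul_distrib, ← Finset.prod_mul_distrib]
    congr 1
    refine Finset.prod_congr rfl fun l _ => ?_
    rw [PowerSeries.coeff_rescale, ← mul_zpow, zpow_sub₀ (hw l), zpow_natCast, zpow_natCast,
      inv_pow]
    field_simp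
  rw [charResidue, hcoeff, map_sum]
  let k₀ : Fin (Module.finrank ℝ V) →₀ ℕ := Finsupp.equivFunOnFinite.symm fun l => m l - 1
  have hk₀ : ∀ l, k₀ l = m l - 1 := fun l => rfl
  have hek₀ : e k₀ = -1 := by
    ext l
    simp only [e, hk₀, Pi.neg_apply, Pi.one_apply]
    have := hmpos l
    omega
  rw [Finset.sum_eq_single k₀]
  · rw [map_smul, hek₀, hℓ (⟨σ, hσ⟩, -1), smul_eq_mul]
    have h1 : ∀ l, PowerSeries.coeff (k₀ l) (P l) =
        if ψ (L • latticeFamily hΓ (σ l)) = 1 then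
          expResidue ((hσ.basis.repr (a : StrongDual ℝ V) l / L : ℝ) : ℂ) (m l - 1) else 0 :=
      fun l => by rw [hk₀, hP]
    rw [Finset.prod_congr rfl fun l _ => h1 l]
    simp only [Pi.neg_apply, Pi.one_apply, zpow_neg_one, Finset.prod_const, Finset.card_univ,
      Fintype.card_fin, hm]
    ring
  · intro k _ hk
    rw [map_smul, hℓ (⟨σ, hσ⟩, e k), monoRes, if_neg, smul_zero]
    rintro ⟨h1, -⟩
    refine hk (Finsupp.ext fun l => ?_)
    have h2 := congrFun h1 l
    simp only [e, Pi.neg_apply, Pi.one_apply] at h2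
    have := hmpos l
    rw [hk₀]
    omega
  · intro h
    refine absurd (Finset.mem_finsuppAntidiag.2 ⟨?_, Finset.subset_univ _⟩) h
    exact Finset.sum_congr rfl fun l _ => hk₀ l

/-- Orthogonality of characters: the characters of order dividing `M` that are trivial on a
subgroup `H` of index dividing `M` are those of the quotient by `H`. -/
theorem sum_characters_trivial_on {A : Type*} [AddCommGroup A] (H : AddSubgroup A)
    [H.FiniteIndex] {M : ℕ} (hM : H.index ∣ M) {X : Finset (AddChar A ℂ)}
    (hX : ∀ ψ, ψ ∈ X ↔ ∀ a, ψ a ^ M = 1) [DecidablePred fun ψ : AddChar A ℂ => ∀ h ∈ H, ψ h = 1]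
    (a : A) [Decidable (a ∈ H)] :
    ∑ ψ ∈ X.filter (fun ψ => ∀ h ∈ H, ψ h = 1), ψ a = if a ∈ H then (H.index : ℂ) else 0 := by
  classical
  have : Fintype (A ⧸ H) := Fintype.ofFinite _
  have h1 := AddChar.sum_apply_eq_ite (QuotientAddGroup.mk a : A ⧸ H)
  have hidx : (Fintype.card (A ⧸ H) : ℂ) = H.index := by
    rw [← Nat.card_eq_fintype_card]; rfl
  simp only [QuotientAddGroup.eq_zero_iff, hidx] at h1
  refine Eq.trans ?_ (h1.trans (by congr))
  symm
  refine Finset.sum_bij (fun ψ _ => ψ.compAddMonoidHom (QuotientAddGroup.mk' H)) ?_ ?_ ?_ ?_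
  · intro ψ _
    refine Finset.mem_filter.2 ⟨(hX _).2 fun b => ?_, fun h hh => ?_⟩
    · have h2 : M • (QuotientAddGroup.mk b : A ⧸ H) = 0 := by
        rw [← QuotientAddGroup.mk_nsmul, QuotientAddGroup.eq_zero_iff]
        obtain ⟨r, rfl⟩ := hM
        rw [mul_smul]
        exact H.nsmul_index_mem _
      change ψ (QuotientAddGroup.mk b) ^ M = 1
      rw [← AddChar.map_nsmul_eq_pow, h2, AddChar.map_zero_eq_one]
    · change ψ (QuotientAddGroup.mk h) = 1
      rw [(QuotientAddGroup.eq_zero_iff h).2 hh, AddChar.map_zero_eq_one]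
  · intro ψ _ φ _ h
    ext q
    obtain ⟨b, rfl⟩ := QuotientAddGroup.mk_surjective q
    exact DFunLike.congr_fun h b
  · intro ψ hψ
    have hψH := (Finset.mem_filter.1 hψ).2
    let φ : A ⧸ H →+ Additive ℂ := QuotientAddGroup.lift H ψ.toAddMonoidHom fun h hh =>
      congrArg Additive.ofMul (hψH h hh)
    exact ⟨AddChar.toAddMonoidHomEquiv.symm φ, Finset.mem_univ _, by ext b; rfl⟩
  · intro ψ _
    rfl

end Simplicial
end VectorPartition
end

noncomputable section
namespace VectorPartition

section SimplicialCount

variable {V : Type*} [NormedAddCommGroup V] [NormedSpace ℝ V] [FiniteDimensional ℝ V]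
variable {Γ : Submodule ℤ V} [DiscreteTopology Γ] [IsZLattice ℝ Γ]
variable {N : ℕ} {β : Fin N → StrongDual ℝ V}

/-- Solutions supported on an independent family are counted one coordinate at a time. -/
theorem solutionCount_comp {A : Type*} [AddCommGroup A] {n : ℕ} {η : Fin n → A}
    (hη : LinearIndependent ℤ η) (τ : Fin N → Fin n) (y : Fin n → ℤ) :
    solutionCount (fun k => η (τ k)) (∑ l, y l • η l) =
      ∏ l, {x : {k // τ k = l} → ℕ | ∑ k, (x k : ℤ) = y l}.ncard := by
  classical
  have h1 : {x : Fin N → ℕ | ∑ k, x k • η (τ k) = ∑ l, y l • η l} =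
      {x : Fin N → ℕ | ∀ l, ∑ k : {k // τ k = l}, (x k : ℤ) = y l} := by
    ext x
    have h2 : ∑ k, x k • η (τ k) = ∑ l, (∑ k : {k // τ k = l}, (x k : ℤ)) • η l := by
      rw [← Fintype.sum_fiberwise τ]
      refine Finset.sum_congr rfl fun l _ => ?_
      rw [Finset.sum_smul]
      refine Finset.sum_congr rfl fun k _ => ?_
      rw [k.2, natCast_zsmul]
    constructor
    · intro hx l
      rw [Set.mem_ofPred_eq, h2] at hx
      have h3 := Fintype.linearIndependent_iff.1 hη
        (fun l => (∑ k : {k // τ k = l}, (x k : ℤ)) - y l) (by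
          simp only [sub_smul, Finset.sum_sub_distrib]
          rw [hx, sub_self]) l
      exact sub_eq_zero.1 h3
    · intro hx
      rw [Set.mem_ofPred_eq, h2]
      exact Finset.sum_congr rfl fun l _ => by rw [hx l]
  let e : {x : Fin N → ℕ | ∀ l, ∑ k : {k // τ k = l}, (x k : ℤ) = y l} ≃
      ∀ l, {x : {k // τ k = l} → ℕ | ∑ k, (x k : ℤ) = y l} :=
    { toFun := fun x l => ⟨fun k => x.1 k, x.2 l⟩
      invFun := fun g => ⟨fun k => (g (τ k)).1 ⟨k, rfl⟩, fun l => by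
        rw [← (g l).2]
        refine Finset.sum_congr rfl ?_
        rintro ⟨k, rfl⟩ _
        rfl⟩
      left_inv := fun x => rfl
      right_inv := fun g => by
        ext l ⟨k, rfl⟩
        rfl }
  rw [solutionCount, h1, ← Nat.card_coe_set_eq, Nat.card_congr e, Nat.card_pi]
  rfl

theorem linearIndependent_latticeFamily (hΓ : ∀ i, β i ∈ dualLattice Γ)
    {σ : Fin (Module.finrank ℝ V) → Fin N} (hσ : IsBasisOf β σ) {L : ℕ} (hL : 0 < L) :
    LinearIndependent ℤ fun l => L • latticeFamily hΓ (σ l) := by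
  rw [Fintype.linearIndependent_iff]
  intro g hg l
  have h1 := congrArg (Subtype.val : dualLattice Γ → StrongDual ℝ V) hg
  rw [Submodule.coe_sum, ZeroMemClass.coe_zero] at h1
  have h2 : ∑ l, ((g l : ℝ) * L) • (β ∘ σ) l = 0 := by
    rw [← h1]
    refine Finset.sum_congr rfl fun l _ => ?_
    rw [mul_smul, Nat.cast_smul_eq_nsmul]
    exact Int.cast_smul_eq_zsmul ℝ (g l) (L • β (σ l))
  have h3 := Fintype.linearIndependent_iff.1 hσ _ h2 l
  exact_mod_cast (mul_eq_zero.1 h3).resolve_right (Nat.cast_ne_zero.2 hL.ne')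

/-- The index in `Γ*` of the sublattice spanned by the multiples of a basis. -/
theorem index_span_latticeFamily (hΓ : ∀ i, β i ∈ dualLattice Γ)
    {σ : Fin (Module.finrank ℝ V) → Fin N} (hσ : IsBasisOf β σ) {L : ℕ} (hL : 0 < L) :
    ((Submodule.span ℤ (Set.range fun l =>
      L • latticeFamily hΓ (σ l))).toAddSubgroup.index : ℝ) =
      (L : ℝ) ^ Module.finrank ℝ V * latticeVol Γ (β ∘ σ) := by
  have hli := linearIndependent_latticeFamily hΓ hσ hL
  rw [AddSubgroup.index_eq_natAbs_det (dualLatticeBasis Γ) _ (Module.Basis.span hli),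
    Nat.cast_natAbs, Int.cast_abs, latticeVol_eq, ← Nat.abs_cast L, ← abs_pow, ← abs_mul]
  congr 1
  rw [Module.Basis.det_apply, Int.cast_det, ← Matrix.det_transpose]
  have h1 : ((((dualLatticeBasis Γ).toMatrix fun l =>
      ((Module.Basis.span hli l : _) : dualLattice Γ)).map (Int.cast : ℤ → ℝ))).transpose =
      (L : ℝ) • Matrix.of fun i j => (β ∘ σ) i (latticeBasis Γ j) := by
    ext i j
    rw [Matrix.transpose_apply, Matrix.map_apply, Module.Basis.toMatrix_apply,
      dualLatticeBasis_repr, Module.Basis.span_apply]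
    simp [latticeFamily]
  exact (congrArg Matrix.det h1).trans (by rw [Matrix.det_smul, Fintype.card_fin])

theorem latticeVol_pos {σ : Fin (Module.finrank ℝ V) → Fin N} (hσ : IsBasisOf β σ) :
    0 < latticeVol Γ (β ∘ σ) := by
  rw [latticeVol_eq]
  exact abs_pos.2 (hσ.det_ne_zero Γ)

/-- The residue formula for the multiples `L β_{σ(l)}` of a basis, with repetitions. Each residue is
a product of one-dimensional ones if the character is trivial on the sublattice `H` spanned by the
`L β_{σ(l)}`, and vanishes otherwise; the sum over the characters of the quotient selects
`a ∈ H`. -/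
theorem residueFormula_simplicial (hΓ : ∀ i, β i ∈ dualLattice Γ) {c : Set (StrongDual ℝ V)}
    (hc : IsBigChamber β c) {ℓ : (regularPoints β → ℂ) →ₗ[ℂ] ℂ}
    (hℓ : ∀ i : MonoIdx β, ℓ (mono β i.1 i.2) = monoRes Γ c i)
    (σ : Fin (Module.finrank ℝ V) → Fin N) (τ : Fin N → Fin (Module.finrank ℝ V))
    (hσ : IsBasisOf β σ) (hτ : Function.Surjective τ) (L : ℕ) (hL : 0 < L) :
    ResidueFormula c ℓ fun k => L • latticeFamily hΓ (σ (τ k)) := by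
  classical
  have hL' : (0 : ℝ) < L := Nat.cast_pos.2 hL
  let H : AddSubgroup (dualLattice Γ) := (Submodule.span ℤ (Set.range fun l =>
    L • latticeFamily hΓ (σ l))).toAddSubgroup
  have hidx : (H.index : ℝ) = (L : ℝ) ^ Module.finrank ℝ V * latticeVol Γ (β ∘ σ) :=
    index_span_latticeFamily hΓ hσ hL
  have hidx0 : H.index ≠ 0 := by
    intro h
    rw [h, Nat.cast_zero] at hidx
    exact (mul_pos (pow_pos hL' _) (latticeVol_pos hσ)).ne hidx
  have : H.FiniteIndex := ⟨hidx0⟩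
  have hmem : ∀ l, L • latticeFamily hΓ (σ l) ∈ H := fun l => Submodule.subset_span ⟨l, rfl⟩
  refine ⟨H.index, hidx0, fun M _ hM X hX a t ht ha => ?_⟩
  rw [Finset.sum_congr rfl fun ψ _ => charResidue_simplicial hΓ hℓ hσ hτ hL ψ a, ← Finset.sum_mul]
  have hcoord : ∀ (f : Fin N → ℝ) l, hσ.basis.repr (∑ k, f k •
      ((L • latticeFamily hΓ (σ (τ k)) : dualLattice Γ) : StrongDual ℝ V)) l =
      L * ∑ k : {k // τ k = l}, f k := by
    intro f l
    have h1 : ∀ k, ((L • latticeFamily hΓ (σ (τ k)) : dualLattice Γ) : StrongDual ℝ V) =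
        (L : ℝ) • β (σ (τ k)) := fun k => (Nat.cast_smul_eq_nsmul ℝ L _).symm
    simp only [h1, map_sum, map_smul, hσ.repr_self, Finsupp.coe_finsetSum, Finset.sum_apply,
      Finsupp.smul_apply, smul_eq_mul]
    rw [← Fintype.sum_fiberwise τ, Finset.sum_eq_single l, Finset.mul_sum]
    · refine Finset.sum_congr rfl fun k _ => ?_
      rw [k.2, Finsupp.single_eq_same]
      ring
    · intro l' _ hl'
      refine Finset.sum_eq_zero fun k _ => ?_
      rw [k.2, Finsupp.single_eq_of_ne hl'.symm, mul_zero, mul_zero]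
    · exact fun h => absurd (Finset.mem_univ l) h
  have hsmul : ∀ (x : Fin N → ℕ),
      ((∑ k, x k • L • latticeFamily hΓ (σ (τ k)) : dualLattice Γ) : StrongDual ℝ V) =
        ∑ k, (x k : ℝ) • ((L • latticeFamily hΓ (σ (τ k)) : dualLattice Γ) : StrongDual ℝ V) := by
    intro x
    rw [Submodule.coe_sum]
    exact Finset.sum_congr rfl fun k _ => (Nat.cast_smul_eq_nsmul ℝ (x k) _).symm
  by_cases hcσ : c ⊆ cone (β ∘ σ)
  · have hpos : ∀ l, -(Fintype.card {k // τ k = l} : ℝ) <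
        hσ.basis.repr (a : StrongDual ℝ V) l / L := by
      intro l
      have h1 := hc.repr_pos hσ ha (hcσ ha) ha l
      rw [map_add, Finsupp.add_apply, hcoord] at h1
      have h2 : ∑ k : {k // τ k = l}, t k ≤ Fintype.card {k // τ k = l} := by
        have := Finset.sum_le_card_nsmul Finset.univ (fun k : {k // τ k = l} => t k) 1
          fun k _ => (ht k).2
        simpa using this
      rw [lt_div_iff₀ hL']
      nlinarith
    have hiff : ∀ ψ : AddChar (dualLattice Γ) ℂ,
        (∀ l ∈ Finset.univ, ψ (L • latticeFamily hΓ (σ l)) = 1) ↔ ∀ h ∈ H, ψ h = 1 := by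
      refine fun ψ => ⟨fun hψ h hh => ?_, fun hψ l _ => hψ _ (hmem l)⟩
      have hh' : h ∈ Submodule.span ℤ (Set.range fun l => L • latticeFamily hΓ (σ l)) := hh
      induction hh' using Submodule.span_induction with
      | mem x hx => obtain ⟨l, rfl⟩ := hx; exact hψ l (Finset.mem_univ l)
      | zero => exact ψ.map_zero_eq_one
      | add x y hx hy h1 h2 => rw [ψ.map_add_eq_mul, h1 hx, h2 hy, mul_one]
      | smul k x hx h1 => rw [ψ.map_zsmul_eq_zpow, h1 hx, one_zpow]
    have hsum := sum_characters_trivial_on H hM hX (-a)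
    rw [monoRes, if_pos ⟨rfl, hcσ⟩]
    simp only [Finset.prod_ite_zero, hiff, mul_ite, mul_zero]
    rw [← Finset.sum_filter, ← Finset.sum_mul, hsum]
    simp only [neg_mem_iff]
    by_cases haH : a ∈ H
    · rw [if_pos haH]
      obtain ⟨y, hy⟩ := (Submodule.mem_span_range_iff_exists_fun ℤ).1
        (show a ∈ Submodule.span ℤ (Set.range fun l => L • latticeFamily hΓ (σ l)) from haH)
      have hrepr : ∀ l, hσ.basis.repr (a : StrongDual ℝ V) l / L = y l := by
        intro l
        have h1 : (a : StrongDual ℝ V) = ∑ l, ((y l : ℝ) * L) • β (σ l) := by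
          rw [← hy, Submodule.coe_sum]
          refine Finset.sum_congr rfl fun l _ => ?_
          rw [mul_smul, Nat.cast_smul_eq_nsmul]
          exact (Int.cast_smul_eq_zsmul ℝ (y l) (L • β (σ l))).symm
        rw [h1, map_sum]
        simp only [map_smul, hσ.repr_self, Finsupp.coe_finsetSum, Finset.sum_apply,
          Finsupp.smul_apply, smul_eq_mul, Finsupp.single_apply, mul_ite, mul_one, mul_zero,
          Finset.sum_ite_eq', Finset.mem_univ, if_true]
        field_simp
      have hcount := solutionCount_comp (linearIndependent_latticeFamily hΓ hσ hL) τ y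
      rw [hy] at hcount
      rw [hcount, Nat.cast_prod]
      have hvol : (H.index : ℂ) * ((L : ℂ)⁻¹ ^ Module.finrank ℝ V *
          ((latticeVol Γ (β ∘ σ) : ℝ) : ℂ)⁻¹) = 1 := by
        have h1 : (H.index : ℂ) = (L : ℂ) ^ Module.finrank ℝ V * (latticeVol Γ (β ∘ σ) : ℝ) := by
          exact_mod_cast congrArg (Complex.ofReal) hidx
        have h2 : ((latticeVol Γ (β ∘ σ) : ℝ) : ℂ) ≠ 0 :=
          Complex.ofReal_ne_zero.2 (latticeVol_pos hσ).ne'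
        have h3 : (L : ℂ) ≠ 0 := Nat.cast_ne_zero.2 hL.ne'
        rw [h1, inv_pow]
        field_simp
      rw [mul_right_comm, hvol, one_mul]
      refine Finset.prod_congr rfl fun l _ => ?_
      obtain ⟨k, hk⟩ := hτ l
      rw [hrepr l, Complex.ofReal_intCast, expResidue_eq_ncard (Fintype.card_pos_iff.2 ⟨⟨k, hk⟩⟩)]
      have := hpos l
      rw [hrepr l] at this
      exact_mod_cast this
    · rw [if_neg haH, zero_mul, zero_mul, Nat.cast_eq_zero, solutionCount]
      suffices h : {x : Fin N → ℕ | ∑ k, x k • L • latticeFamily hΓ (σ (τ k)) = a} = ∅ by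
        rw [h, Set.ncard_empty]
      refine Set.eq_empty_of_forall_notMem fun x hx => haH ?_
      rw [← (hx : ∑ k, x k • L • latticeFamily hΓ (σ (τ k)) = a)]
      exact sum_mem fun k _ => nsmul_mem (hmem _) _
  · -- a solution would put the translate of `a` into the cone of `σ`
    rw [monoRes, if_neg fun h => hcσ h.2, mul_zero, mul_zero, Nat.cast_eq_zero, solutionCount]
    suffices h : {x : Fin N → ℕ | ∑ k, x k • L • latticeFamily hΓ (σ (τ k)) = a} = ∅ by
      rw [h, Set.ncard_empty]
    refine Set.eq_empty_of_forall_notMem fun x hx => hcσ ((hc.subset_cone_iff hσ ha).2 ?_)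
    rw [hσ.mem_cone_iff]
    intro l
    rw [map_add, Finsupp.add_apply, hcoord,
      ← (hx : ∑ k, x k • L • latticeFamily hΓ (σ (τ k)) = a), hsmul, hcoord]
    exact add_nonneg (mul_nonneg hL'.le (Finset.sum_nonneg fun k _ => Nat.cast_nonneg _))
      (mul_nonneg hL'.le (Finset.sum_nonneg fun k _ => (ht k).1))

/-- The number of solutions `x ∈ ℕ ^ N` of `∑ x_i β_i = a` is a sum of residues over the
characters of a sufficiently divisible order, for `a` in the translate of the chamber by an
element of the box. -/
theorem residueFormula_latticeFamily (hΓ : ∀ i, β i ∈ dualLattice Γ)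
    (hspan : Submodule.span ℝ (Set.range β) = ⊤)
    (hhalf : ∃ v : V, ∀ i, 0 < β i v) {c : Set (StrongDual ℝ V)}
    (hc : IsBigChamber β c) {ℓ : (regularPoints β → ℂ) →ₗ[ℂ] ℂ}
    (hℓ : ∀ i : MonoIdx β, ℓ (mono β i.1 i.2) = monoRes Γ c i) :
    ResidueFormula c ℓ (latticeFamily hΓ) := by
  have h := ResidueFormula.of_simplicial hΓ hhalf (residueFormula_simplicial hΓ hc hℓ) id
    (fun _ => 1) (fun _ => one_pos) (by simpa using hspan)
  simpa using h

end SimplicialCount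
end VectorPartition
end

noncomputable section
namespace VectorPartition

/-! ### Homogeneous components of the kernel -/

section KernelComponents

variable {V : Type*} [NormedAddCommGroup V] [NormedSpace ℝ V] [FiniteDimensional ℝ V]
variable {Γ : Submodule ℤ V} {N : ℕ} {β : Fin N → StrongDual ℝ V}

/-- The homogeneous component of degree `-n` of the kernel is a polynomial in `⟨a, z⟩` whose
coefficients have poles only on the hyperplanes `β_i = 0` with `e^{⟨β_i, p⟩} = 1`. -/
theorem exists_coeff_kernelFun (hspan : Submodule.span ℝ (Set.range β) = ⊤) (p : ℂ ⊗[ℝ] V) :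
    ∃ (d : ℕ) (g : ℕ → regularPoints β → ℂ),
      (∀ j, g j ∈ polarRing β {i | Complex.exp (pair (β i) p) = 1}) ∧
      ∀ a : StrongDual ℝ V,
        (fun z => (kernelFun β a p z).coeff (-(Module.finrank ℝ V : ℤ))) =
          ∑ ij ∈ Finset.HasAntidiagonal.antidiagonal d, ((ij.1.factorial : ℂ)⁻¹) •
            ((fun z : regularPoints β => pair a (z : ℂ ⊗[ℝ] V)) ^ ij.1 * g ij.2) := by
  classical
  have hN : Module.finrank ℝ V ≤ N := by
    have := finrank_range_le_card (R := ℝ) β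
    rwa [Set.finrank, hspan, finrank_top, finrank_strongDual, Fintype.card_fin] at this
  choose P hP0 hP using fun i => exists_powerSeries_expSeries_div 0
    (Complex.exp (pair (β i) p)) (Complex.exp_ne_zero _) one_pos
  let G : Fin N → regularPoints β → PowerSeries ℂ := fun i z =>
    PowerSeries.C (pair (β i) (z : ℂ ⊗[ℝ] V))⁻¹ *
      PowerSeries.rescale (pair (β i) (z : ℂ ⊗[ℝ] V)) (P i)
  have hG : ∀ i k, (fun z => PowerSeries.coeff k (G i z)) ∈
      polarRing β {i | Complex.exp (pair (β i) p) = 1} := by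
    intro i k
    have h1 : (fun z : regularPoints β => PowerSeries.coeff k (G i z)) =
        fun z : regularPoints β => (pair (β i) (z : ℂ ⊗[ℝ] V))⁻¹ *
          ((pair (β i) (z : ℂ ⊗[ℝ] V)) ^ k * PowerSeries.coeff k (P i)) := by
      ext z
      rw [PowerSeries.coeff_C_mul, PowerSeries.coeff_rescale]
    have hform := form_mem_polarRing (β := β)
      (Ψ := {i | Complex.exp (pair (β i) p) = 1}) (pair (β i))
    rw [h1]
    cases k with
    | zero =>
      by_cases hu : Complex.exp (pair (β i) p) = 1
      · have := Subalgebra.smul_mem _ (inv_mem_polarRing (β := β)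
          (Ψ := {i | Complex.exp (pair (β i) p) = 1}) hu) (PowerSeries.coeff 0 (P i))
        convert this using 1
        ext z
        simp [mul_comm]
      · have h2 : PowerSeries.coeff 0 (P i) = 0 := by
          have := hP0 i
          rwa [if_neg hu] at this
        simp only [h2, mul_zero]
        exact zero_mem _
    | succ k =>
      have := Subalgebra.smul_mem _ (pow_mem hform k) (PowerSeries.coeff (k + 1) (P i))
      convert this using 1
      ext z
      have := pair_ne_zero z i
      simp only [Pi.smul_apply, Pi.pow_apply, smul_eq_mul, pow_succ]
      field_simp
  refine ⟨N - Module.finrank ℝ V, fun j z => PowerSeries.coeff j (∏ i, G i z), fun j => ?_,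
    fun a => ?_⟩
  · have h1 : (fun z => PowerSeries.coeff j (∏ i, G i z)) =
        ∑ l ∈ Finset.finsuppAntidiag Finset.univ j,
          ∏ i, fun z => PowerSeries.coeff (l i) (G i z) := by
      ext z
      rw [PowerSeries.coeff_prod, Finset.sum_apply]
      exact Finset.sum_congr rfl fun l _ => by rw [Finset.prod_apply]
    change (fun z => PowerSeries.coeff j (∏ i, G i z)) ∈ _
    rw [h1]
    exact sum_mem fun l _ => prod_mem fun i _ => hG i _
  · ext z
    have h1 : ∀ i, (1 - HahnSeries.C (Complex.exp (pair (β i) p)) *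
        expSeries (-(pair (β i) (z : ℂ ⊗[ℝ] V))))⁻¹ =
        HahnSeries.single (-1) 1 * HahnSeries.ofPowerSeries ℤ ℂ (G i z) := by
      intro i
      have h2 := hP i _ (pair_ne_zero z i)
      rw [zero_mul, expSeries_zero, pow_one, one_div, pow_one] at h2
      rw [h2, map_mul (HahnSeries.ofPowerSeries ℤ ℂ), HahnSeries.ofPowerSeries_C, ← mul_assoc,
        HahnSeries.C_apply, HahnSeries.single_mul_single, add_zero, one_mul, Nat.cast_one]
    have h3 : kernelFun β a p z = HahnSeries.single (-(N : ℤ)) 1 *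
        HahnSeries.ofPowerSeries ℤ ℂ (PowerSeries.rescale (pair a (z : ℂ ⊗[ℝ] V))
          (PowerSeries.exp ℂ) * ∏ i, G i z) := by
      rw [kernelFun, div_eq_mul_inv, ← Finset.prod_inv_distrib,
        Finset.prod_congr rfl fun i _ => h1 i, prod_single_mul_ofPowerSeries,
        map_mul (HahnSeries.ofPowerSeries ℤ ℂ), ← mul_assoc, ← mul_assoc, mul_comm (expSeries _)]
      simp [expSeries]
    have h4 : -(Module.finrank ℝ V : ℤ) - -(N : ℤ) = ((N - Module.finrank ℝ V : ℕ) : ℤ) := by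
      omega
    dsimp only
    rw [h3, HahnSeries.coeff_single_mul, one_mul, h4, HahnSeries.ofPowerSeries_apply_coeff,
      PowerSeries.coeff_mul, Finset.sum_apply]
    refine Finset.sum_congr rfl fun ij _ => ?_
    rw [PowerSeries.coeff_rescale, PowerSeries.coeff_exp]
    simp only [Pi.smul_apply, Pi.mul_apply, Pi.pow_apply, smul_eq_mul, map_div₀, map_one,
      map_natCast]
    ring

theorem coeff_kernelFun_mem_polarRing (hspan : Submodule.span ℝ (Set.range β) = ⊤)
    (p : ℂ ⊗[ℝ] V) (a : StrongDual ℝ V) :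
    (fun z => (kernelFun β a p z).coeff (-(Module.finrank ℝ V : ℤ))) ∈
      polarRing β {i | Complex.exp (pair (β i) p) = 1} := by
  obtain ⟨d, g, hg, h⟩ := exists_coeff_kernelFun hspan p
  rw [h a]
  exact sum_mem fun ij _ => Subalgebra.smul_mem _
    (mul_mem (pow_mem (form_mem_polarRing (pair a)) _) (hg _)) _

variable [DiscreteTopology Γ] [IsZLattice ℝ Γ]

/-- Away from the poles of a chamber, a residue with poles on too few hyperplanes vanishes. -/
theorem residueFunctional_eq_zero (hspan : Submodule.span ℝ (Set.range β) = ⊤)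
    {c : Set (StrongDual ℝ V)} {ℓ : (regularPoints β → ℂ) →ₗ[ℂ] ℂ}
    (hℓ : ∀ i : MonoIdx β, ℓ (mono β i.1 i.2) = monoRes Γ c i) {p : ℂ ⊗[ℝ] V}
    (hp : p ∉ poleSet β c) {f : regularPoints β → ℂ}
    (hf : f ∈ polarRing β {i | Complex.exp (pair (β i) p) = 1}) : ℓ f = 0 := by
  rw [← LinearMap.mem_ker]
  refine Submodule.span_le.2 ?_ (polarRing_le_monoSpan hspan hf)
  rintro _ ⟨σ, k, hσ, hk, rfl⟩
  rw [SetLike.mem_coe, LinearMap.mem_ker, hℓ (⟨σ, hσ⟩, k), monoRes, if_neg]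
  rintro ⟨h1, h2⟩
  refine hp ⟨σ, hσ, h2, fun l => hk l ?_⟩
  rw [show k = -1 from h1]
  simp

end KernelComponents

/-! ### Characters of the dual lattice -/

section Characters

variable {V : Type*} [NormedAddCommGroup V] [NormedSpace ℝ V] [FiniteDimensional ℝ V]
variable (Γ : Submodule ℤ V)
variable {N : ℕ} {β : Fin N → StrongDual ℝ V}

/-- The character `a ↦ e^{⟨a, p⟩}` of the dual lattice. -/
def pointChar (p : ℂ ⊗[ℝ] V) : AddChar (dualLattice Γ) ℂ where
  toFun a := Complex.exp (pair (a : StrongDual ℝ V) p)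
  map_zero_eq_one' := by
    have h : pairing p 0 = 0 := map_zero _
    rw [pairing_apply] at h
    rw [ZeroMemClass.coe_zero, h, Complex.exp_zero]
  map_add_eq_mul' a b := by rw [Submodule.coe_add, pair_add, Complex.exp_add]

variable {Γ}

theorem pointChar_apply (p : ℂ ⊗[ℝ] V) (a : dualLattice Γ) :
    pointChar Γ p a = Complex.exp (pair (a : StrongDual ℝ V) p) := rfl

/-- The term of `p` in the chamber function is the residue of the character `a ↦ e^{⟨a, p⟩}`. -/
theorem charResidue_pointChar (hΓ : ∀ i, β i ∈ dualLattice Γ)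
    (ℓ : (regularPoints β → ℂ) →ₗ[ℂ] ℂ) (p : ℂ ⊗[ℝ] V) (a : dualLattice Γ) :
    charResidue ℓ (pointChar Γ p) (latticeFamily hΓ) a =
      Complex.exp (-pair (a : StrongDual ℝ V) p) *
        ℓ fun z => (kernelFun β (a : StrongDual ℝ V) p z).coeff (-(Module.finrank ℝ V : ℤ)) := by
  have hneg : ∀ (α : StrongDual ℝ V) (z : ℂ ⊗[ℝ] V), pair (-α) z = -pair α z := fun α z =>
    map_neg (pairing z) α
  rw [charResidue, ← smul_eq_mul, ← map_smul]
  congr 1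
  ext z
  have hden : ∀ i, charExp (pointChar Γ p) (z : ℂ ⊗[ℝ] V) (-latticeFamily hΓ i) =
      HahnSeries.C (Complex.exp (pair (β i) p)) * expSeries (-(pair (β i) (z : ℂ ⊗[ℝ] V))) := by
    intro i
    rw [charExp, neg_neg, pointChar_apply, Submodule.coe_neg, hneg]
    rfl
  simp only [charKernel, hden]
  rw [charExp, pointChar_apply, Submodule.coe_neg, hneg, mul_div_assoc,
    HahnSeries.C_mul_eq_smul, HahnSeries.coeff_smul, Pi.smul_apply, kernelFun]

variable [DiscreteTopology Γ] [IsZLattice ℝ Γ]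

theorem dualLatticeBasis_apply_latticeBasis (i j : Fin (Module.finrank ℝ V)) :
    ((dualLatticeBasis Γ i : dualLattice Γ) : StrongDual ℝ V) (latticeBasis Γ j) =
      if i = j then 1 else 0 := by
  rw [← dualLatticeBasis_repr, Module.Basis.repr_self, Finsupp.single_apply]
  split_ifs <;> simp

/-- The expansion of a point of `V_ℂ` in the chosen basis of `Γ`. -/
theorem eq_sum_pair_dualLatticeBasis (z : ℂ ⊗[ℝ] V) :
    z = ∑ j, pair ((dualLatticeBasis Γ j : dualLattice Γ) : StrongDual ℝ V) z ⊗ₜ[ℝ]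
      latticeBasis Γ j := by
  induction z using TensorProduct.induction_on with
  | zero => simp
  | add x y hx hy =>
    simp only [map_add, TensorProduct.add_tmul, Finset.sum_add_distrib]
    rw [← hx, ← hy]
  | tmul s v =>
    have hv : v = ∑ j, ((dualLatticeBasis Γ j : dualLattice Γ) : StrongDual ℝ V) v •
        latticeBasis Γ j := by
      have h1 : (LinearMap.id : V →ₗ[ℝ] V) = ∑ j,
          (((dualLatticeBasis Γ j : dualLattice Γ) : StrongDual ℝ V) : V →ₗ[ℝ] ℝ).smulRight
            (latticeBasis Γ j) := by
        refine (latticeBasis Γ).ext fun i => ?_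
        simp [dualLatticeBasis_apply_latticeBasis]
      have h2 := congrArg (fun f : V →ₗ[ℝ] V => f v) h1
      simpa using h2
    conv_lhs => rw [hv]
    rw [TensorProduct.tmul_sum]
    refine Finset.sum_congr rfl fun j _ => ?_
    rw [TensorProduct.tmul_smul, TensorProduct.smul_tmul', pair_tmul]
    congr 1
    rw [Complex.real_smul, mul_comm]

theorem pair_eq_sum_dualLatticeBasis (a : dualLattice Γ) (z : ℂ ⊗[ℝ] V) :
    pair (a : StrongDual ℝ V) z = ∑ j, ((dualLatticeBasis Γ).repr a j : ℂ) *
      pair ((dualLatticeBasis Γ j : dualLattice Γ) : StrongDual ℝ V) z := by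
  conv_lhs => rw [eq_sum_pair_dualLatticeBasis (Γ := Γ) z]
  rw [map_sum]
  refine Finset.sum_congr rfl fun j _ => ?_
  rw [pair_tmul, ← dualLatticeBasis_repr, mul_comm]
  norm_cast

/-- A character is the exponential of a point whose coordinates are logarithms of its values on a
basis of the dual lattice. -/
theorem pointChar_surjective : Function.Surjective (pointChar Γ) := by
  intro ψ
  have hne : ∀ a, ψ a ≠ 0 := fun a => (ψ.val_isUnit a).ne_zero
  refine ⟨∑ j, Complex.log (ψ (dualLatticeBasis Γ j)) ⊗ₜ[ℝ] latticeBasis Γ j, ?_⟩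
  ext a
  rw [pointChar_apply, map_sum, Complex.exp_sum]
  conv_rhs => rw [← (dualLatticeBasis Γ).sum_repr a]
  have h1 : ∀ (s : Finset (Fin (Module.finrank ℝ V))) (f : Fin (Module.finrank ℝ V) →
      dualLattice Γ), ψ (∑ j ∈ s, f j) = ∏ j ∈ s, ψ (f j) := fun s f => by
    classical
    induction s using Finset.induction_on with
    | empty => simp
    | insert j s hj ih => rw [Finset.sum_insert hj, Finset.prod_insert hj, ψ.map_add_eq_mul, ih]
  rw [h1]
  refine Finset.prod_congr rfl fun j _ => ?_
  rw [pair_tmul, ← dualLatticeBasis_repr, Complex.ofReal_intCast, mul_comm, Complex.exp_int_mul,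
    Complex.exp_log (hne _), ψ.map_zsmul_eq_zpow]

theorem pointChar_eq_iff {p q : ℂ ⊗[ℝ] V} :
    pointChar Γ p = pointChar Γ q ↔ p - q ∈ periodLattice Γ := by
  have h2pi : (2 * Real.pi * Complex.I : ℂ) ≠ 0 := Complex.two_pi_I_ne_zero
  have hsub : pointChar Γ p = pointChar Γ q ↔
      ∀ a : dualLattice Γ, Complex.exp (pair (a : StrongDual ℝ V) (p - q)) = 1 := by
    rw [DFunLike.ext_iff]
    refine forall_congr' fun a => ?_
    rw [pointChar_apply, pointChar_apply, map_sub, Complex.exp_sub,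
      div_eq_one_iff_eq (Complex.exp_ne_zero _)]
  rw [hsub]
  constructor
  · intro h
    choose m hm using fun j => Complex.exp_eq_one_iff.1 (h (dualLatticeBasis Γ j))
    refine ⟨∑ j, m j • latticeBasis Γ j,
      Submodule.sum_mem _ fun j _ => Submodule.smul_mem _ _ (latticeBasis_mem Γ j), ?_⟩
    rw [eq_sum_pair_dualLatticeBasis (Γ := Γ) (p - q), TensorProduct.tmul_sum]
    refine Finset.sum_congr rfl fun j _ => ?_
    rw [hm, ← Int.cast_smul_eq_zsmul ℝ, TensorProduct.tmul_smul, TensorProduct.smul_tmul',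
      Complex.real_smul, Complex.ofReal_intCast]
  · rintro ⟨γ, hγ, h⟩ a
    obtain ⟨m, hm⟩ := a.2 γ hγ
    rw [h, pair_tmul, hm, Complex.exp_eq_one_iff]
    exact ⟨m, by push_cast; ring⟩

theorem finite_torsionChars {M : ℕ} (hM : M ≠ 0) :
    {ψ : AddChar (dualLattice Γ) ℂ | ∀ a, ψ a ^ M = 1}.Finite := by
  have hne : ∀ (ψ : AddChar (dualLattice Γ) ℂ) a, ψ a ≠ 0 := fun ψ a =>
    (ψ.val_isUnit a).ne_zero
  refine Set.Finite.of_finite_image (f := fun ψ j => ψ (dualLatticeBasis Γ j)) ?_ ?_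
  · refine (Set.Finite.pi' fun _ => (Polynomial.nthRootsFinset M (1 : ℂ)).finite_toSet).subset ?_
    rintro _ ⟨ψ, hψ, rfl⟩ j
    exact (Polynomial.mem_nthRootsFinset (Nat.pos_of_ne_zero hM) _).2 (hψ _)
  · intro ψ _ φ _ h
    obtain ⟨p, rfl⟩ := pointChar_surjective ψ
    obtain ⟨q, rfl⟩ := pointChar_surjective φ
    have h0 : ∀ j, pointChar Γ p (dualLatticeBasis Γ j) = pointChar Γ q (dualLatticeBasis Γ j) :=
      fun j => congrFun h j
    ext a
    rw [pointChar_apply, pointChar_apply, pair_eq_sum_dualLatticeBasis a p,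
      pair_eq_sum_dualLatticeBasis a q, Complex.exp_sum, Complex.exp_sum]
    refine Finset.prod_congr rfl fun j _ => ?_
    rw [Complex.exp_int_mul, Complex.exp_int_mul]
    exact congrArg (· ^ _) (h0 j)

end Characters
end VectorPartition
end

noncomputable section
namespace VectorPartition

/-! ### The chamber function -/

section ChamberFunction

variable {V : Type*} [NormedAddCommGroup V] [NormedSpace ℝ V] [FiniteDimensional ℝ V]
variable {Γ : Submodule ℤ V} [DiscreteTopology Γ] [IsZLattice ℝ Γ]
variable {N : ℕ} {β : Fin N → StrongDual ℝ V} {c : Set (StrongDual ℝ V)} {R : Set (ℂ ⊗[ℝ] V)}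

theorem partitionFunction_eq_solutionCount (hΓ : ∀ i, β i ∈ dualLattice Γ) (a : dualLattice Γ) :
    partitionFunction β (a : StrongDual ℝ V) = solutionCount (latticeFamily hΓ) a := by
  rw [partitionFunction, solutionCount]
  congr 1
  ext x
  have h1 : ((∑ i, x i • latticeFamily hΓ i : dualLattice Γ) : StrongDual ℝ V) =
      ∑ i, x i • β i := by
    rw [Submodule.coe_sum]
    rfl
  rw [Set.mem_ofPred_eq, Set.mem_ofPred_eq, ← h1, Subtype.coe_inj]

theorem zero_mem_periodLattice : (0 : ℂ ⊗[ℝ] V) ∈ periodLattice Γ :=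
  ⟨0, Γ.zero_mem, by simp⟩

theorem IsReducedPoleSet.injOn (hR : IsReducedPoleSet Γ β c R) : Set.InjOn (pointChar Γ) R := by
  intro p hp q hq h
  obtain ⟨r, -, hr⟩ := hR.2 p (hR.1 hp)
  rw [hr p ⟨hp, by rw [sub_self]; exact zero_mem_periodLattice⟩,
    hr q ⟨hq, pointChar_eq_iff.1 h⟩]

/-- The characters of the poles have a common finite order. -/
theorem exists_order_poleSet (hΓ : ∀ i, β i ∈ dualLattice Γ) (c : Set (StrongDual ℝ V)) :
    ∃ M : ℕ, M ≠ 0 ∧ ∀ p ∈ poleSet β c, ∀ a, pointChar Γ p a ^ M = 1 := by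
  classical
  let H : (Fin (Module.finrank ℝ V) → Fin N) → AddSubgroup (dualLattice Γ) := fun σ =>
    (Submodule.span ℤ (Set.range fun l => 1 • latticeFamily hΓ (σ l))).toAddSubgroup
  refine ⟨∏ σ ∈ Finset.univ.filter (IsBasisOf β), (H σ).index,
    Finset.prod_ne_zero_iff.2 fun σ hσ => ?_, ?_⟩
  · have hσ' : IsBasisOf β σ := (Finset.mem_filter.1 hσ).2
    have h1 := index_span_latticeFamily hΓ hσ' one_pos
    intro h2
    rw [show (Submodule.span ℤ (Set.range fun l =>
      1 • latticeFamily hΓ (σ l))).toAddSubgroup.index = 0 from h2] at h1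
    simp [(latticeVol_pos (Γ := Γ) hσ').ne] at h1
  · rintro p ⟨σ, hσ, -, hp⟩ a
    have h1 : ∀ h ∈ Submodule.span ℤ (Set.range fun l => 1 • latticeFamily hΓ (σ l)),
        pointChar Γ p h = 1 := by
      intro h hh
      induction hh using Submodule.span_induction with
      | mem x hx =>
        obtain ⟨l, rfl⟩ := hx
        dsimp only
        rw [one_smul]
        exact hp l
      | zero => exact (pointChar Γ p).map_zero_eq_one
      | add x y _ _ h1 h2 => rw [(pointChar Γ p).map_add_eq_mul, h1, h2, mul_one]
      | smul k x _ h1 => rw [(pointChar Γ p).map_zsmul_eq_zpow, h1, one_zpow]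
    obtain ⟨r, hr⟩ := Finset.dvd_prod_of_mem (fun σ => (H σ).index)
      (Finset.mem_filter.2 ⟨Finset.mem_univ σ, hσ⟩)
    rw [hr, pow_mul, ← (pointChar Γ p).map_nsmul_eq_pow, h1 _ ((H σ).nsmul_index_mem a), one_pow]

theorem IsReducedPoleSet.finite (hR : IsReducedPoleSet Γ β c R)
    (hΓ : ∀ i, β i ∈ dualLattice Γ) : R.Finite := by
  obtain ⟨M, hM, h⟩ := exists_order_poleSet hΓ c
  refine Set.Finite.of_finite_image ((finite_torsionChars hM).subset ?_) hR.injOn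
  rintro _ ⟨p, hp, rfl⟩
  exact h p (hR.1 hp)

theorem jkResidue_kernelFun (hspan : Submodule.span ℝ (Set.range β) = ⊤) (hc : IsBigChamber β c)
    {ℓ : (regularPoints β → ℂ) →ₗ[ℂ] ℂ} (hℓ : ∀ i : MonoIdx β, ℓ (mono β i.1 i.2) = monoRes Γ c i)
    (a : StrongDual ℝ V) (p : ℂ ⊗[ℝ] V) :
    jkResidue Γ β c (totalResidueFormal β (kernelFun β a p)) =
      ℓ fun z => (kernelFun β a p z).coeff (-(Module.finrank ℝ V : ℤ)) := by
  rw [totalResidueFormal]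
  refine jkResidue_totalResidue hspan hc hℓ ?_
  rw [← polarRing_univ]
  exact polarRing_mono (Set.subset_univ _) (coeff_kernelFun_mem_polarRing hspan p a)

theorem chamberFunction_eq_sum (hspan : Submodule.span ℝ (Set.range β) = ⊤)
    (hc : IsBigChamber β c) (hR : R.Finite) {ℓ : (regularPoints β → ℂ) →ₗ[ℂ] ℂ}
    (hℓ : ∀ i : MonoIdx β, ℓ (mono β i.1 i.2) = monoRes Γ c i) (a : dualLattice Γ) :
    chamberFunction Γ β c R a = ∑ p ∈ hR.toFinset, Complex.exp (-(pair (a : StrongDual ℝ V) p)) *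
      ℓ fun z => (kernelFun β (a : StrongDual ℝ V) p z).coeff (-(Module.finrank ℝ V : ℤ)) := by
  rw [chamberFunction, finsum_mem_eq_finite_toFinset_sum _ hR]
  exact Finset.sum_congr rfl fun p _ => by rw [jkResidue_kernelFun hspan hc hℓ]

/-- The characters in the residue formula that do not come from a pole in the reduced set contribute
zero. -/
theorem partitionFunction_eq_chamberFunction (hΓ : ∀ i, β i ∈ dualLattice Γ)
    (hspan : Submodule.span ℝ (Set.range β) = ⊤) (hhalf : ∃ v : V, ∀ i, 0 < β i v)
    (hc : IsBigChamber β c) (hR : IsReducedPoleSet Γ β c R) {a : dualLattice Γ}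
    (ha : (a : StrongDual ℝ V) ∈ c - box β) :
    (partitionFunction β (a : StrongDual ℝ V) : ℂ) = chamberFunction Γ β c R a := by
  classical
  obtain ⟨ℓ, hℓ⟩ := exists_residueFunctional Γ hhalf hc
  obtain ⟨M₀, hM₀, hM⟩ := residueFormula_latticeFamily hΓ hspan hhalf hc hℓ
  obtain ⟨M₁, hM₁, hpole⟩ := exists_order_poleSet hΓ c
  have hne : M₀ * M₁ ≠ 0 := mul_ne_zero hM₀ hM₁
  have hfin := finite_torsionChars (Γ := Γ) hne
  obtain ⟨x, hx, y, ⟨t, ht, rfl⟩, hxy⟩ := ha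
  have hformula := hM (M₀ * M₁) hne (dvd_mul_right _ _) hfin.toFinset (fun ψ => by simp) a t ht
    (by
      have : (a : StrongDual ℝ V) + ∑ k, t k • (latticeFamily hΓ k : StrongDual ℝ V) = x := by
        rw [← hxy]
        exact sub_add_cancel _ _
      rwa [this])
  have hRfin := hR.finite hΓ
  rw [partitionFunction_eq_solutionCount hΓ, hformula, chamberFunction_eq_sum hspan hc hRfin hℓ]
  have hsub : hRfin.toFinset.image (pointChar Γ) ⊆ hfin.toFinset := by
    intro ψ hψ
    obtain ⟨p, hp, rfl⟩ := Finset.mem_image.1 hψ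
    rw [Set.Finite.mem_toFinset]
    intro b
    rw [mul_comm, pow_mul, hpole p (hR.1 (hRfin.mem_toFinset.1 hp)), one_pow]
  rw [← Finset.sum_subset hsub, Finset.sum_image]
  · exact Finset.sum_congr rfl fun p _ => charResidue_pointChar hΓ ℓ p a
  · intro p hp q hq h
    exact hR.injOn (by simpa using hp) (by simpa using hq) h
  · -- a character which does not come from a pole contributes nothing
    intro ψ _ hψ
    obtain ⟨q, rfl⟩ := pointChar_surjective ψ
    have hq : q ∉ poleSet β c := by
      intro hq
      obtain ⟨p, ⟨hp, hqp⟩, -⟩ := hR.2 q hq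
      exact hψ (Finset.mem_image.2 ⟨p, hRfin.mem_toFinset.2 hp, (pointChar_eq_iff.2 hqp).symm⟩)
    rw [charResidue_pointChar, residueFunctional_eq_zero hspan hℓ hq
      (coeff_kernelFun_mem_polarRing hspan q _), mul_zero]

/-! ### Periodic polynomiality -/

/-- The algebra of periodic-polynomial functions. -/
def periodicPolynomials (W : Type*) [AddCommGroup W] : Subalgebra ℂ (W → ℂ) :=
  Algebra.adjoin ℂ
    ({g : W → ℂ | ∃ φ : W →+ ℂ, g = fun w => φ w} ∪
      {g : W → ℂ | ∃ χ : Multiplicative W →* ℂˣ,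
        (∀ w, ∃ k : ℕ, 0 < k ∧ χ w ^ k = 1) ∧ g = fun w => (χ (Multiplicative.ofAdd w) : ℂ)})

theorem addMonoidHom_mem_periodicPolynomials {W : Type*} [AddCommGroup W] (φ : W →+ ℂ) :
    (fun w => φ w) ∈ periodicPolynomials W :=
  Algebra.subset_adjoin (Set.mem_union_left _ ⟨φ, rfl⟩)

theorem addChar_mem_periodicPolynomials {W : Type*} [AddCommGroup W] (ψ : AddChar W ℂ) {M : ℕ}
    (hM : M ≠ 0) (hψ : ∀ w, ψ w ^ M = 1) : (fun w => ψ w) ∈ periodicPolynomials W := by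
  refine Algebra.subset_adjoin (Set.mem_union_right _
    ⟨ψ.toMonoidHom.toHomUnits, fun w => ⟨M, Nat.pos_of_ne_zero hM, ?_⟩, rfl⟩)
  ext
  exact hψ w.toAdd

/-- The functional applied to `⟨a, z⟩ ^ m g(z)` is a polynomial in `a`, expanding one factor
`⟨a, z⟩` at a time in coordinates. -/
theorem residue_pow_mul_mem_periodicPolynomials (ℓ : (regularPoints β → ℂ) →ₗ[ℂ] ℂ) (m : ℕ)
    (g : regularPoints β → ℂ) :
    (fun a : dualLattice Γ => ℓ ((fun z : regularPoints β =>
      pair (a : StrongDual ℝ V) (z : ℂ ⊗[ℝ] V)) ^ m * g)) ∈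
        periodicPolynomials (dualLattice Γ) := by
  induction m generalizing g with
  | zero =>
    simp only [pow_zero, one_mul]
    exact Subalgebra.algebraMap_mem (periodicPolynomials (dualLattice Γ)) (ℓ g)
  | succ m ih =>
    let e : Fin (Module.finrank ℝ V) → regularPoints β → ℂ := fun j z =>
      pair ((dualLatticeBasis Γ j : dualLattice Γ) : StrongDual ℝ V) (z : ℂ ⊗[ℝ] V)
    let φ : Fin (Module.finrank ℝ V) → dualLattice Γ →+ ℂ := fun j =>
      (Int.castAddHom ℂ).comp ((dualLatticeBasis Γ).coord j).toAddMonoidHom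
    have h1 : (fun a : dualLattice Γ => ℓ ((fun z : regularPoints β =>
        pair (a : StrongDual ℝ V) (z : ℂ ⊗[ℝ] V)) ^ (m + 1) * g)) =
        ∑ j, (fun a => φ j a) * fun a : dualLattice Γ => ℓ ((fun z : regularPoints β =>
          pair (a : StrongDual ℝ V) (z : ℂ ⊗[ℝ] V)) ^ m * (e j * g)) := by
      ext a
      have h2 : (fun z : regularPoints β =>
            pair (a : StrongDual ℝ V) (z : ℂ ⊗[ℝ] V)) ^ (m + 1) * g =
          ∑ j, φ j a • ((fun z : regularPoints β =>
            pair (a : StrongDual ℝ V) (z : ℂ ⊗[ℝ] V)) ^ m * (e j * g)) := by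
        ext z
        simp only [Pi.mul_apply, Pi.pow_apply, Finset.sum_apply, Pi.smul_apply, smul_eq_mul,
          pow_succ]
        conv_lhs =>
          enter [1, 2]
          rw [pair_eq_sum_dualLatticeBasis]
        rw [Finset.mul_sum, Finset.sum_mul]
        refine Finset.sum_congr rfl fun j _ => ?_
        change _ = (((dualLatticeBasis Γ).repr a j : ℤ) : ℂ) * _
        ring
      rw [h2, map_sum, Finset.sum_apply]
      exact Finset.sum_congr rfl fun j _ => by rw [map_smul, smul_eq_mul, Pi.mul_apply]
    rw [h1]
    exact sum_mem fun j _ => mul_mem (addMonoidHom_mem_periodicPolynomials _) (ih _)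

theorem isPeriodicPolynomial_chamberFunction (hΓ : ∀ i, β i ∈ dualLattice Γ)
    (hspan : Submodule.span ℝ (Set.range β) = ⊤) (hhalf : ∃ v : V, ∀ i, 0 < β i v)
    (hc : IsBigChamber β c) (hR : IsReducedPoleSet Γ β c R) :
    IsPeriodicPolynomial (chamberFunction Γ β c R) := by
  obtain ⟨ℓ, hℓ⟩ := exists_residueFunctional Γ hhalf hc
  obtain ⟨M, hM, hpole⟩ := exists_order_poleSet hΓ c
  have hRfin := hR.finite hΓ
  change chamberFunction Γ β c R ∈ periodicPolynomials (dualLattice Γ)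
  have h1 : chamberFunction Γ β c R = ∑ p ∈ hRfin.toFinset,
      (fun a : dualLattice Γ => (pointChar Γ p)⁻¹ a) * fun a : dualLattice Γ =>
        ℓ fun z => (kernelFun β (a : StrongDual ℝ V) p z).coeff (-(Module.finrank ℝ V : ℤ)) := by
    ext a
    rw [chamberFunction_eq_sum hspan hc hRfin hℓ, Finset.sum_apply]
    refine Finset.sum_congr rfl fun p _ => ?_
    rw [Pi.mul_apply, AddChar.inv_apply', pointChar_apply, Complex.exp_neg]
  rw [h1]
  refine sum_mem fun p hp => mul_mem (addChar_mem_periodicPolynomials _ hM fun a => ?_) ?_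
  · rw [AddChar.inv_apply', inv_pow, hpole p (hR.1 (hRfin.mem_toFinset.1 hp)), inv_one]
  · obtain ⟨d, g, -, hg⟩ := exists_coeff_kernelFun hspan p
    have h2 : (fun a : dualLattice Γ => ℓ fun z =>
        (kernelFun β (a : StrongDual ℝ V) p z).coeff (-(Module.finrank ℝ V : ℤ))) =
        ∑ ij ∈ Finset.HasAntidiagonal.antidiagonal d, ((ij.1.factorial : ℂ)⁻¹) •
          fun a : dualLattice Γ => ℓ ((fun z : regularPoints β =>
            pair (a : StrongDual ℝ V) (z : ℂ ⊗[ℝ] V)) ^ ij.1 * g ij.2) := by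
      ext a
      rw [hg, map_sum, Finset.sum_apply]
      exact Finset.sum_congr rfl fun ij _ => by rw [map_smul, Pi.smul_apply]
    rw [h2]
    exact sum_mem fun ij _ => Subalgebra.smul_mem _
      (residue_pow_mul_mem_periodicPolynomials ℓ _ _) _

end ChamberFunction
end VectorPartition
end

theorem mainTheorem2 {V : Type*} [NormedAddCommGroup V] [NormedSpace ℝ V]
    [FiniteDimensional ℝ V] (Γ : Submodule ℤ V) [DiscreteTopology Γ] [IsZLattice ℝ Γ]
    {N : ℕ} (β : Fin N → StrongDual ℝ V)
    (hΓ : ∀ i, β i ∈ VectorPartition.dualLattice Γ)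
    (hspan : Submodule.span ℝ (Set.range β) = ⊤)
    (hhalf : ∃ v : V, ∀ i, 0 < β i v)
    (c : Set (StrongDual ℝ V)) (hc : VectorPartition.IsBigChamber β c)
    (R : Set (ℂ ⊗[ℝ] V)) (hR : VectorPartition.IsReducedPoleSet Γ β c R) :
    R.Finite ∧
    VectorPartition.IsPeriodicPolynomial (VectorPartition.chamberFunction Γ β c R) ∧
    (∀ a : VectorPartition.dualLattice Γ,
      (a : StrongDual ℝ V) ∈ c - VectorPartition.box β →
        (VectorPartition.partitionFunction β (a : StrongDual ℝ V) : ℂ) =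
          VectorPartition.chamberFunction Γ β c R a) ∧
    (c ⊆ VectorPartition.cone β →
      closure c ⊆ c - VectorPartition.box β ∧
      (0 < Module.finrank ℝ V → closure c ⊂ c - VectorPartition.box β)) := by
  exact ⟨hR.finite hΓ, VectorPartition.isPeriodicPolynomial_chamberFunction hΓ hspan hhalf hc hR,
    fun _ ha => VectorPartition.partitionFunction_eq_chamberFunction hΓ hspan hhalf hc hR ha,
    fun hcΦ => ⟨hc.closure_subset hspan hcΦ, fun hn => hc.closure_ssubset hspan hhalf hcΦ hn⟩⟩
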